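/- Let $d=d_x+d_y$, $z=(x,y)\in\mathbb R^{d_x}\times\mathbb R^{d_y}=\mathbb R^d$, and let $f:\mathbb R^d\to\mathbb R$ be four times continuously differentiable with bounded third and fourth derivatives, with Lipschitz partial gradients $\nabla_xf,\nabla_yf$, such that $f(\cdot,y)$ is $\mu_x$-strongly convex for every $y$ and $f(x,\cdot)$ is $\mu_y$-strongly concave for every $x$ ($\mu_x,\mu_y>0$). Let $z_*=(x_*,y_*)$ be its saddle point, $H=\nabla^2f(z_*)$, and for a $d\times d$ matrix $M$ let $\nabla^3f_*M\in\mathbb R^d$ have the components $\sum_{i,j}\partial_i\partial_j\partial_lf(z_*)M_{ij}$. Stochastic accelerated primal-dual iterations (SAPD) with parameters $\tau,\sigma,\theta$: from $\xi_k=(z_k,z_{k-1})$, $$y_{k+1}=y_k+\sigma\big((1+\theta)\tilde\nabla_yf(z_k)-\theta\tilde\nabla_yf(z_{k-1})\big),\qquad x_{k+1}=x_k-\tau\tilde\nabla_xf(x_k,y_{k+1}),$$ and $\xi_{k+1}=(z_{k+1},z_k)$. The stochastic gradients are $\tilde\nabla_xf(z)=g_x(z,\omega)$ and $\tilde\nabla_yf(z)=g_y(z,\omega)$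 with measurable $g_x,g_y$. The samples of an iteration are independent of the past; in an iteration, the $x$-sample is independent of the pair of $y$-samples, which have a fixed joint law (they may, but need not, be independent of each other). For every $z$ all the estimates are unbiased, and their errors have fourth moments bounded uniformly in $z$. Hence $(\xi_k)$ is a time-homogeneous Markov chain on $\mathbb R^{2d}$; for $\tau=\frac{1-\theta}{\mu_x\theta}$, $\sigma=\frac{1-\theta}{\mu_y\theta}$ denote its transition kernel by $\mathcal R^{(\theta)}$. Put $C_0=\begin{bmatrix}-\mu_x^{-1}I&0\\0&\mu_y^{-1}I\end{bmatrix}$, $T_1=\begin{bmatrix}-\mu_x^{-1}I&0&0\\0&\mu_y^{-1}I&0\end{bmatrix}$, $T_2=\begin{bmatrix}0&0&0\\0&\mu_y^{-1}I&-\mu_y^{-1}I\end{bmatrix}$. For an invariant probability measure $\pi$ of $\mathcal R^{(\theta)}$ let $W=\mathbb E_\pi[ww^\top]$, where $w=(w^0,w^1,w^2)$ is the vector of the errors of $\tilde\nabla_xf(x_1,y_2)$, $\tilde\nabla_yf(z_1)$, $\tilde\nabla_yf(z_0)$ in an iteration from $\xi_1=(z_1,z_0)\sim\pi$; let $W_1=T_1WT_1^\top$,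 $W_2=T_1WT_2^\top+T_2WT_1^\top$, $W_3=T_2WT_2^\top$. Then $H$ is invertible, and so is the Lyapunov operator $X\mapsto C_0HX+X(C_0H)^\top$ on $d\times d$ matrices; let $\Gamma$ be its inverse and $M=\tfrac12\Gamma(W_1+W_2+W_3)$. There are $\theta_0\in(0,1)$ and $C$ such that for all $\theta\in[\theta_0,1)$: (i) if the law of $z_{k+1}$ given $\xi_k=\xi$ has a density $p(\xi,z)$ that is continuous in $\xi$ for each $z$, then $\mathcal R^{(\theta)}$ has an invariant probability measure; (ii) every invariant probability measure $\pi$ of $\mathcal R^{(\theta)}$ has a mean $\bar\xi^{(\theta)}=\int\xi\,d\pi$, all entries of $M$ are bounded by $C$ in absolute value, and, with $\xi_*=(z_*,z_*)$, $$\Big\|\bar\xi^{(\theta)}-\xi_*-(1-\theta)\begin{bmatrix}H^{-1}\nabla^3f_*M\\H^{-1}\nabla^3f_*M\end{bmatrix}\Big\|\le C(1-\theta)^{3/2},$$ that is, $\bar\xi^{(\theta)}=\xi_*+(1-\theta)\,\big[H^{-1}\nabla^3f_*M;\,H^{-1}\nabla^3f_*M\big]+\mathcal O((1-\theta)^{3/2})$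 with $M=\mathcal O(1)$ as $\theta\to1$. If the error covariance of $g_x$ is a constant matrix $A$ at all points, and the joint error covariance of the two $y$-estimates is a constant matrix $B$ at all pairs of points, then $W=\begin{bmatrix}A&0\\0&B\end{bmatrix}$, so that $M$ does not depend on $\theta$. -/

import Mathlib

open MeasureTheory ProbabilityTheory
open scoped Matrix ENNReal

noncomputable section

namespace SAPD

variable {dx dy : ℕ}

/-- The primal space `ℝ^{d_x}`. -/
abbrev XSpace (dx : ℕ) : Type := EuclideanSpace ℝ (Fin dx)

/-- The dual space `ℝ^{d_y}`. -/
abbrev YSpace (dy : ℕ) : Type := EuclideanSpace ℝ (Fin dy)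

/-- The space `ℝ^d`, `d = d_x + d_y`, of the pairs `z = (x, y)`, with the Euclidean norm. -/
abbrev ZSpace (dx dy : ℕ) : Type := EuclideanSpace ℝ (Fin dx ⊕ Fin dy)

/-- The vector `z = (x, y)`. -/
def pair (x : XSpace dx) (y : YSpace dy) : ZSpace dx dy :=
  WithLp.toLp 2 (Sum.elim (fun i => x i) (fun j => y j))

/-- The `x`-block of `z`. -/
def xPart (z : ZSpace dx dy) : XSpace dx := WithLp.toLp 2 fun i => z (Sum.inl i)

/-- The `y`-block of `z`. -/
def yPart (z : ZSpace dx dy) : YSpace dy := WithLp.toLp 2 fun j => z (Sum.inr j)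

/-- The partial gradient `∇_x f`. -/
def gradX (f : ZSpace dx dy → ℝ) (z : ZSpace dx dy) : XSpace dx := xPart (gradient f z)

/-- The partial gradient `∇_y f`. -/
def gradY (f : ZSpace dx dy → ℝ) (z : ZSpace dx dy) : YSpace dy := yPart (gradient f z)

/-- The standing assumptions on the objective: `f` is `C⁴` with bounded third and fourth
derivatives, `f(·, y)` is `μ_x`-strongly convex, `f(x, ·)` is `μ_y`-strongly concave, and the
partial gradients are Lipschitz. -/
structure IsAdmissibleObjective (f : ZSpace dx dy → ℝ) (μx μy : ℝ) : Prop where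
  contDiff : ContDiff ℝ 4 f
  convex : ∀ y : YSpace dy, StrongConvexOn Set.univ μx fun x : XSpace dx => f (pair x y)
  concave : ∀ x : XSpace dx, StrongConcaveOn Set.univ μy fun y : YSpace dy => f (pair x y)
  lipschitz_gradX : ∃ Lxx Lxy : ℝ, ∀ (x x' : XSpace dx) (y y' : YSpace dy),
    ‖gradX f (pair x y) - gradX f (pair x' y')‖ ≤ Lxx * ‖x - x'‖ + Lxy * ‖y - y'‖
  lipschitz_gradY : ∃ Lyx Lyy : ℝ, ∀ (x x' : XSpace dx) (y y' : YSpace dy),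
    ‖gradY f (pair x y) - gradY f (pair x' y')‖ ≤ Lyx * ‖x - x'‖ + Lyy * ‖y - y'‖
  bounded_third : ∃ B : ℝ, ∀ z, ‖iteratedFDeriv ℝ 3 f z‖ ≤ B
  bounded_fourth : ∃ B : ℝ, ∀ z, ‖iteratedFDeriv ℝ 4 f z‖ ≤ B

/-- `z_* = (x_*, y_*)` is a saddle point of `min_x max_y f(x, y)`. -/
def IsSaddlePoint (f : ZSpace dx dy → ℝ) (zs : ZSpace dx dy) : Prop :=
  (∀ x : XSpace dx, f zs ≤ f (pair x (yPart zs))) ∧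
    ∀ y : YSpace dy, f (pair (xPart zs) y) ≤ f zs

variable {Ωx Ωy : Type*} [MeasurableSpace Ωx] [MeasurableSpace Ωy]

/-- The assumptions on the stochastic first-order oracle `(g_x, g_y)`. In one iteration the
oracle for `∇_x f` uses a sample with law `P`, the two calls of the oracle for `∇_y f` use an
independent pair of samples with joint law `Q`. All estimates are unbiased, and their errors
have uniformly bounded fourth moments. -/
structure IsAdmissibleOracle (f : ZSpace dx dy → ℝ)
    (gx : ZSpace dx dy → Ωx → XSpace dx) (gy : ZSpace dx dy → Ωy → YSpace dy)
    (P : Measure Ωx) (Q : Measure (Ωy × Ωy)) : Prop where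
  measurable_gx : Measurable (Function.uncurry gx)
  measurable_gy : Measurable (Function.uncurry gy)
  unbiased_x : ∀ z, ∫ ω, gx z ω ∂P = gradX f z
  unbiased_y₁ : ∀ z, ∫ ω, gy z ω.1 ∂Q = gradY f z
  unbiased_y₂ : ∀ z, ∫ ω, gy z ω.2 ∂Q = gradY f z
  moment : ∃ δ : ℝ, ∀ z,
    ∫⁻ ω, ‖gx z ω - gradX f z‖ₑ ^ 4 ∂P ≤ ENNReal.ofReal (δ ^ 4) ∧
    ∫⁻ ω, ‖gy z ω.1 - gradY f z‖ₑ ^ 4 ∂Q ≤ ENNReal.ofReal (δ ^ 4) ∧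
    ∫⁻ ω, ‖gy z ω.2 - gradY f z‖ₑ ^ 4 ∂Q ≤ ENNReal.ofReal (δ ^ 4)

/-- The dual update `y_{k+1} = y_k + σ q̃_k` from `ξ = (z_k, z_{k-1})`, where
`q̃_k = (1 + θ) ∇̃_y f(z_k) - θ ∇̃_y f(z_{k-1})`. -/
def nextY (gy : ZSpace dx dy → Ωy → YSpace dy) (σ θ : ℝ)
    (ξ : ZSpace dx dy × ZSpace dx dy) (ω : Ωy × Ωy) : YSpace dy :=
  yPart ξ.1 + σ • ((1 + θ) • gy ξ.1 ω.1 - θ • gy ξ.2 ω.2)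

/-- One SAPD iteration, `(z_k, z_{k-1}) ↦ (z_{k+1}, z_k)`, where
`x_{k+1} = x_k - τ ∇̃_x f(x_k, y_{k+1})`. -/
def step (gx : ZSpace dx dy → Ωx → XSpace dx) (gy : ZSpace dx dy → Ωy → YSpace dy)
    (τ σ θ : ℝ) (ξ : ZSpace dx dy × ZSpace dx dy) (ω : Ωx × Ωy × Ωy) :
    ZSpace dx dy × ZSpace dx dy :=
  (pair (xPart ξ.1 - τ • gx (pair (xPart ξ.1) (nextY gy σ θ ξ ω.2)) ω.1)
    (nextY gy σ θ ξ ω.2), ξ.1)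

/-- The transition kernel of the Markov chain `ξ_k = (z_k, z_{k-1})` of SAPD with parameters
`τ, σ, θ`. -/
def transition (gx : ZSpace dx dy → Ωx → XSpace dx) (gy : ZSpace dx dy → Ωy → YSpace dy)
    (P : Measure Ωx) (Q : Measure (Ωy × Ωy)) (τ σ θ : ℝ) :
    Kernel (ZSpace dx dy × ZSpace dx dy) (ZSpace dx dy × ZSpace dx dy) :=
  (Kernel.id ×ₖ Kernel.const _ (P.prod Q)).map (Function.uncurry (step gx gy τ σ θ))

/-- The transition kernel of SAPD with `τ = (1 - θ) / (μ_x θ)` and `σ = (1 - θ) / (μ_y θ)`. -/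
def chain (gx : ZSpace dx dy → Ωx → XSpace dx) (gy : ZSpace dx dy → Ωy → YSpace dy)
    (P : Measure Ωx) (Q : Measure (Ωy × Ωy)) (μx μy θ : ℝ) :
    Kernel (ZSpace dx dy × ZSpace dx dy) (ZSpace dx dy × ZSpace dx dy) :=
  transition gx gy P Q ((1 - θ) / (μx * θ)) ((1 - θ) / (μy * θ)) θ

/-- From the state `ξ`, the next iterate has a density `p(ξ, ·)` that is continuous in `ξ`. -/
def HasContinuousDensity
    (R : Kernel (ZSpace dx dy × ZSpace dx dy) (ZSpace dx dy × ZSpace dx dy)) : Prop :=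
  ∃ p : ZSpace dx dy × ZSpace dx dy → ZSpace dx dy → ℝ,
    (∀ ξ, Measurable (p ξ)) ∧ (∀ ξ z, 0 ≤ p ξ z) ∧ (∀ z, Continuous fun ξ => p ξ z) ∧
    ∀ ξ, (R ξ).map Prod.fst = volume.withDensity fun z => ENNReal.ofReal (p ξ z)

/-- The gradient error `w = (w⁰, w¹, w²)` of one iteration from `ξ = (z, z')`: the errors of
`∇̃_x f(x, y⁺)`, where `y⁺` is the updated `y`, of `∇̃_y f(z)` and of `∇̃_y f(z')`. -/
def noise (f : ZSpace dx dy → ℝ)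
    (gx : ZSpace dx dy → Ωx → XSpace dx) (gy : ZSpace dx dy → Ωy → YSpace dy) (σ θ : ℝ)
    (ξ : ZSpace dx dy × ZSpace dx dy) (ω : Ωx × Ωy × Ωy) :
    Fin dx ⊕ (Fin dy ⊕ Fin dy) → ℝ :=
  Sum.elim
    (fun i => (gx (pair (xPart ξ.1) (nextY gy σ θ ξ ω.2)) ω.1
      - gradX f (pair (xPart ξ.1) (nextY gy σ θ ξ ω.2))) i)
    (Sum.elim (fun j => (gy ξ.1 ω.2.1 - gradY f ξ.1) j)
      (fun j => (gy ξ.2 ω.2.2 - gradY f ξ.2) j))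

/-- The covariance `W = E_π[w wᵀ]` of the gradient error when `ξ` has law `π`, with
`σ = (1 - θ) / (μ_y θ)`. -/
def noiseCov (f : ZSpace dx dy → ℝ)
    (gx : ZSpace dx dy → Ωx → XSpace dx) (gy : ZSpace dx dy → Ωy → YSpace dy)
    (P : Measure Ωx) (Q : Measure (Ωy × Ωy)) (μy θ : ℝ)
    (π : Measure (ZSpace dx dy × ZSpace dx dy)) :
    Matrix (Fin dx ⊕ (Fin dy ⊕ Fin dy)) (Fin dx ⊕ (Fin dy ⊕ Fin dy)) ℝ :=
  Matrix.of fun i j => ∫ p, noise f gx gy ((1 - θ) / (μy * θ)) θ p.1 p.2 i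
    * noise f gx gy ((1 - θ) / (μy * θ)) θ p.1 p.2 j ∂(π.prod (P.prod Q))

/-- `T₁ = [[-μ_x⁻¹ I, 0, 0], [0, μ_y⁻¹ I, 0]]`. -/
def T₁ (dx dy : ℕ) (μx μy : ℝ) :
    Matrix (Fin dx ⊕ Fin dy) (Fin dx ⊕ (Fin dy ⊕ Fin dy)) ℝ :=
  Matrix.fromBlocks ((-(1 / μx)) • 1) 0 0 (Matrix.fromCols ((1 / μy) • 1) 0)

/-- `T₂ = [[0, 0, 0], [0, μ_y⁻¹ I, -μ_y⁻¹ I]]`. -/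
def T₂ (dx dy : ℕ) (μy : ℝ) :
    Matrix (Fin dx ⊕ Fin dy) (Fin dx ⊕ (Fin dy ⊕ Fin dy)) ℝ :=
  Matrix.fromBlocks 0 0 0 (Matrix.fromCols ((1 / μy) • 1) ((-(1 / μy)) • 1))

/-- `W₁ = T₁ W T₁ᵀ`. -/
def W₁ (μx μy : ℝ) (W : Matrix (Fin dx ⊕ (Fin dy ⊕ Fin dy)) (Fin dx ⊕ (Fin dy ⊕ Fin dy)) ℝ) :
    Matrix (Fin dx ⊕ Fin dy) (Fin dx ⊕ Fin dy) ℝ :=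
  T₁ dx dy μx μy * W * (T₁ dx dy μx μy)ᵀ

/-- `W₂ = T₁ W T₂ᵀ + T₂ W T₁ᵀ`. -/
def W₂ (μx μy : ℝ) (W : Matrix (Fin dx ⊕ (Fin dy ⊕ Fin dy)) (Fin dx ⊕ (Fin dy ⊕ Fin dy)) ℝ) :
    Matrix (Fin dx ⊕ Fin dy) (Fin dx ⊕ Fin dy) ℝ :=
  T₁ dx dy μx μy * W * (T₂ dx dy μy)ᵀ + T₂ dx dy μy * W * (T₁ dx dy μx μy)ᵀ

/-- `W₃ = T₂ W T₂ᵀ`. -/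
def W₃ (μy : ℝ) (W : Matrix (Fin dx ⊕ (Fin dy ⊕ Fin dy)) (Fin dx ⊕ (Fin dy ⊕ Fin dy)) ℝ) :
    Matrix (Fin dx ⊕ Fin dy) (Fin dx ⊕ Fin dy) ℝ :=
  T₂ dx dy μy * W * (T₂ dx dy μy)ᵀ

/-- The standard basis of `ℝ^d`. -/
def e (i : Fin dx ⊕ Fin dy) : ZSpace dx dy := EuclideanSpace.single i 1

/-- The Hessian matrix `∇²f(z)`. -/
def hessian (f : ZSpace dx dy → ℝ) (z : ZSpace dx dy) :
    Matrix (Fin dx ⊕ Fin dy) (Fin dx ⊕ Fin dy) ℝ :=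
  Matrix.of fun i j => iteratedFDeriv ℝ 2 f z ![e i, e j]

/-- The vector `∇³f(z) M`, with components `∑_{i,j} ∂_i ∂_j ∂_l f(z) M_{ij}`. -/
def thirdDeriv (f : ZSpace dx dy → ℝ) (z : ZSpace dx dy)
    (M : Matrix (Fin dx ⊕ Fin dy) (Fin dx ⊕ Fin dy) ℝ) : Fin dx ⊕ Fin dy → ℝ :=
  fun l => ∑ i, ∑ j, iteratedFDeriv ℝ 3 f z ![e i, e j, e l] * M i j

/-- `C₀ = diag(-μ_x⁻¹ I, μ_y⁻¹ I)`. -/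
def C₀ (dx dy : ℕ) (μx μy : ℝ) : Matrix (Fin dx ⊕ Fin dy) (Fin dx ⊕ Fin dy) ℝ :=
  Matrix.fromBlocks ((-(1 / μx)) • 1) 0 0 ((1 / μy) • 1)

/-- The Lyapunov operator `X ↦ A X + X Aᵀ` of a matrix `A`. -/
def lyapunov (A : Matrix (Fin dx ⊕ Fin dy) (Fin dx ⊕ Fin dy) ℝ) :
    Module.End ℝ (Matrix (Fin dx ⊕ Fin dy) (Fin dx ⊕ Fin dy) ℝ) :=
  LinearMap.mulLeft ℝ A + LinearMap.mulRight ℝ Aᵀ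

/-- `Γ`, the inverse of the Lyapunov operator of `C₀ ∇²f(z)`. -/
def Gam (f : ZSpace dx dy → ℝ) (μx μy : ℝ) (z : ZSpace dx dy) :
    Module.End ℝ (Matrix (Fin dx ⊕ Fin dy) (Fin dx ⊕ Fin dy) ℝ) :=
  Ring.inverse (lyapunov (C₀ dx dy μx μy * hessian f z))

/-- `M = ½ Γ(W₁ + W₂ + W₃)`, built from the noise covariance `W` and the saddle point `z`. -/
def biasMatrix (f : ZSpace dx dy → ℝ) (μx μy : ℝ) (z : ZSpace dx dy)
    (W : Matrix (Fin dx ⊕ (Fin dy ⊕ Fin dy)) (Fin dx ⊕ (Fin dy ⊕ Fin dy)) ℝ) :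
    Matrix (Fin dx ⊕ Fin dy) (Fin dx ⊕ Fin dy) ℝ :=
  (1 / 2 : ℝ) • Gam f μx μy z (W₁ μx μy W + W₂ μx μy W + W₃ μy W)

/-- The vector `[∇²f(z)]⁻¹ ∇³f(z) M`. -/
def biasVector (f : ZSpace dx dy → ℝ) (z : ZSpace dx dy)
    (M : Matrix (Fin dx ⊕ Fin dy) (Fin dx ⊕ Fin dy) ℝ) : ZSpace dx dy :=
  WithLp.toLp 2 ((hessian f z)⁻¹ *ᵥ thirdDeriv f z M)

theorem measurable_pair :
    Measurable fun p : XSpace dx × YSpace dy => pair p.1 p.2 := by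
  refine Measurable.comp (WithLp.measurable_toLp 2 _) (measurable_pi_lambda _ ?_)
  rintro (i | j) <;> simp only [Sum.elim_inl, Sum.elim_inr] <;> fun_prop

theorem measurable_xPart : Measurable (xPart : ZSpace dx dy → XSpace dx) := by
  unfold xPart; fun_prop

theorem measurable_yPart : Measurable (yPart : ZSpace dx dy → YSpace dy) := by
  unfold yPart; fun_prop

theorem measurable_nextY {gy : ZSpace dx dy → Ωy → YSpace dy}
    (hgy : Measurable (Function.uncurry gy)) (σ θ : ℝ) :
    Measurable (Function.uncurry (nextY gy σ θ)) := by
  have h1 : Measurable fun p : (ZSpace dx dy × ZSpace dx dy) × Ωy × Ωy => gy p.1.1 p.2.1 :=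
    hgy.comp (f := fun p : (ZSpace dx dy × ZSpace dx dy) × Ωy × Ωy => (p.1.1, p.2.1))
      (by fun_prop)
  have h2 : Measurable fun p : (ZSpace dx dy × ZSpace dx dy) × Ωy × Ωy => gy p.1.2 p.2.2 :=
    hgy.comp (f := fun p : (ZSpace dx dy × ZSpace dx dy) × Ωy × Ωy => (p.1.2, p.2.2))
      (by fun_prop)
  exact (measurable_yPart.comp (by fun_prop)).add
    (((h1.const_smul (1 + θ)).sub (h2.const_smul θ)).const_smul σ)

theorem measurable_step {gx : ZSpace dx dy → Ωx → XSpace dx}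
    {gy : ZSpace dx dy → Ωy → YSpace dy} (hgx : Measurable (Function.uncurry gx))
    (hgy : Measurable (Function.uncurry gy)) (τ σ θ : ℝ) :
    Measurable (Function.uncurry (step gx gy τ σ θ)) := by
  have hy : Measurable fun p : (ZSpace dx dy × ZSpace dx dy) × Ωx × Ωy × Ωy =>
      nextY gy σ θ p.1 p.2.2 :=
    (measurable_nextY hgy σ θ).comp
      (f := fun p : (ZSpace dx dy × ZSpace dx dy) × Ωx × Ωy × Ωy => (p.1, p.2.2)) (by fun_prop)
  have hx : Measurable fun p : (ZSpace dx dy × ZSpace dx dy) × Ωx × Ωy × Ωy =>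
      xPart p.1.1 := measurable_xPart.comp (by fun_prop)
  have hg : Measurable fun p : (ZSpace dx dy × ZSpace dx dy) × Ωx × Ωy × Ωy =>
      gx (pair (xPart p.1.1) (nextY gy σ θ p.1 p.2.2)) p.2.1 :=
    hgx.comp ((measurable_pair.comp (hx.prodMk hy)).prodMk (by fun_prop))
  exact (measurable_pair.comp ((hx.sub (hg.const_smul τ)).prodMk hy)).prodMk (by fun_prop)

/-- From the state `ξ`, the next state has the law of `step ξ ω` for a fresh sample `ω`. -/
theorem transition_apply {gx : ZSpace dx dy → Ωx → XSpace dx}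
    {gy : ZSpace dx dy → Ωy → YSpace dy} (hgx : Measurable (Function.uncurry gx))
    (hgy : Measurable (Function.uncurry gy)) (P : Measure Ωx) (Q : Measure (Ωy × Ωy))
    [IsProbabilityMeasure P] [IsProbabilityMeasure Q] (τ σ θ : ℝ)
    (ξ : ZSpace dx dy × ZSpace dx dy) :
    transition gx gy P Q τ σ θ ξ = (P.prod Q).map (step gx gy τ σ θ ξ) := by
  have hm := measurable_step hgx hgy τ σ θ
  rw [transition, Kernel.map_apply _ hm, Kernel.prod_apply, Kernel.id_apply,
    Kernel.const_apply, Measure.dirac_prod, Measure.map_map hm (by fun_prop)]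
  rfl

end SAPD

end

/-!
# Bias of stochastic accelerated primal-dual iterations with constant step size

With `h = (1 - θ) / θ` the step sizes are `τ = h / μ_x` and `σ = h / μ_y`, and one iteration is a
perturbed explicit Euler step `z⁺ = z + h (C₀ H (z - z_*) + N + R)` for the drift field
`(-μ_x⁻¹ ∇_x f, μ_y⁻¹ ∇_y f)`: the noise `N = (T₁ + θ T₂) w` has conditional mean zero, and the
remainder `R` collects the nonlinearity of the gradient at `z_*`, the lag
`∇_y f(z_k) - ∇_y f(z_{k-1})` and the evaluation of `∇_x f` at `(x_k, y_{k+1})`.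

*Invertibility.* Strong convexity-concavity makes the drift field dissipative for the norm with
weights `μ_x, μ_y` (`IsAdmissibleObjective.dissipative`). Linearized at `z_*` this says that `C₀ H`
has logarithmic norm at most `-1` (`IsAdmissibleObjective.isDissipative`), so `H` and the Lyapunov
operator of `C₀ H` are injective (`isUnit_hessian_of_isDissipative`, `isUnit_lyapunov`).

*Moments and existence.* Let `V` be the weighted squared distance to `z_*` plus `‖z_k - z_{k-1}‖²`.
For small `h` one iteration contracts `V` by the factor `1 - h`, up to a martingale term and a
noise term of order `h²` (`IsAdmissibleObjective.exists_lyap_drift`), and with fourth moments of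
the noise this gives `E[V²] ≤ (1 - h / 2) V² + O(h³)` (`exists_sq_drift`). If the transition density
is continuous, the chain is Feller (`continuous_of_continuousDensity`) and the Krylov–Bogoliubov
argument yields an invariant law (`exists_invariant_of_drift`). For any invariant law the drift,
truncated and integrated, gives `E[V²] = O(h²)` (`lintegral_le_of_drift`): the error `z - z_*` is of
size `√h` in fourth moment, the increments are of size `h` in second moment
(`exists_integral_stepScale_le`).

*Second moments.* In stationarity `E[(z⁺ - z_*)(z⁺ - z_*)ᵀ] = E[(z - z_*)(z - z_*)ᵀ] =: S`. Inserting
the linearized step and dividing by `h` leaves `C₀ H S + S (C₀ H)ᵀ + h E[N Nᵀ] = O(h^{3/2})`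
(`abs_lyapunov_secondMoment_le`, `exists_abs_lyapunov_stepError_le`), and since `E[N Nᵀ]` differs
from `W₁ + W₂ + W₃` by `O(1 - θ)`, `S = -2 h M + O(h^{3/2})` (`exists_abs_secondMoment_add_le`).

*First moments.* In stationarity the increment has mean zero, which forces
`E[∇f(z)] = O(h^{3/2})` (`exists_abs_integral_gradient_le`). Averaging the Taylor expansion
`∇f(z) = H (z - z_*) + ½ ∇³f_* (z - z_*)(z - z_*)ᵀ + O(‖z - z_*‖³)` gives
`H E[z - z_*] + ½ ∇³f_* S = O(h^{3/2})` (`exists_abs_integral_taylor_le`), and substituting `S` yields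
`E[z - z_*] = h H⁻¹ ∇³f_* M + O(h^{3/2})` (`exists_abs_mean_sub_le`, `exists_norm_integral_sub_le`).

*Constant covariances.* The point at which `∇_x f` is estimated depends on the `y`-samples only, so
integrating over the `x`-sample first evaluates `W` (`noiseCov_eq_fromBlocks`).
-/

noncomputable section

set_option linter.unusedSectionVars false

namespace SAPD

/-! ### Markov kernels with a geometric drift -/

section Kernel

open Filter Topology

variable {α : Type*} [MeasurableSpace α]

/-- Foster–Lyapunov bound for an invariant law. No integrability of `U` is assumed beforehand:
the drift inequality is truncated at level `K` and the resulting bound is let `K → ∞`. -/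
theorem lintegral_le_of_drift {κ : Kernel α α} {π : Measure α} [IsProbabilityMeasure π]
    (hπ : κ.Invariant π) [IsMarkovKernel κ] {U : α → ℝ} (hU : Measurable U) (hU0 : ∀ x, 0 ≤ U x)
    {a b : ℝ} (ha0 : 0 < a) (ha1 : a ≤ 1) (hb : 0 ≤ b)
    (hdrift : ∀ x, ∫⁻ y, ENNReal.ofReal (U y) ∂(κ x) ≤ ENNReal.ofReal ((1 - a) * U x + b)) :
    ∫⁻ x, ENNReal.ofReal (U x) ∂π ≤ ENNReal.ofReal (b / a) := by
  -- integrate `E[min (U, K)] ≤ min ((1 - a) U + b, K)`; for `U > K` the right side is at most `K`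
  have key (K : ℕ) : ∫⁻ x in {x | U x ≤ K}, ENNReal.ofReal (a * U x) ∂π ≤ ENNReal.ofReal b := by
    have hS : MeasurableSet {x | U x ≤ K} := measurableSet_le hU measurable_const
    have h1 : ∫⁻ x, ENNReal.ofReal (min (U x) K) ∂π
        ≤ ∫⁻ x, ENNReal.ofReal (min ((1 - a) * U x + b) K) ∂π := by
      conv_lhs => rw [← hπ.def]
      rw [Measure.lintegral_bind κ.measurable.aemeasurable (by fun_prop)]
      refine lintegral_mono fun x => ?_
      rw [ENNReal.ofReal_min]
      refine le_min ((lintegral_mono fun y => ?_).trans (hdrift x)) ?_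
      · exact ENNReal.ofReal_le_ofReal (min_le_left _ _)
      · calc ∫⁻ y, ENNReal.ofReal (min (U y) K) ∂(κ x)
            ≤ ∫⁻ _, ENNReal.ofReal K ∂(κ x) :=
              lintegral_mono fun y => ENNReal.ofReal_le_ofReal (min_le_right _ _)
          _ = ENNReal.ofReal K := by simp
    have hfin : ∫⁻ x, ENNReal.ofReal (min ((1 - a) * U x + b) K) ∂π ≠ ∞ := by
      refine ne_top_of_le_ne_top (b := ENNReal.ofReal K) ENNReal.ofReal_ne_top ?_
      calc _ ≤ ∫⁻ _, ENNReal.ofReal K ∂π :=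
              lintegral_mono fun y => ENNReal.ofReal_le_ofReal (min_le_right _ _)
          _ = ENNReal.ofReal K := by simp
    have h2 : ∫⁻ x, ENNReal.ofReal (min ((1 - a) * U x + b) K) ∂π
          + ∫⁻ x in {x | U x ≤ K}, ENNReal.ofReal (a * U x) ∂π
        ≤ ∫⁻ x, ENNReal.ofReal (min (U x) K) ∂π + ENNReal.ofReal b := by
      rw [← lintegral_indicator hS, ← lintegral_add_left (by fun_prop)]
      calc _ ≤ ∫⁻ x, (ENNReal.ofReal (min (U x) K) + ENNReal.ofReal b) ∂π := by
            refine lintegral_mono fun x => ?_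
            have hx := hU0 x
            have hK : (0 : ℝ) ≤ K := K.cast_nonneg
            have h1a : 0 ≤ (1 - a) * U x := mul_nonneg (by linarith) hx
            by_cases hxK : U x ≤ K
            · simp only [Set.indicator, Set.mem_ofPred_eq, hxK, if_true]
              rw [← ENNReal.ofReal_add (le_min (by linarith) hK) (by positivity),
                ← ENNReal.ofReal_add (le_min hx hK) hb, min_eq_left hxK]
              refine ENNReal.ofReal_le_ofReal ?_
              have := min_le_left ((1 - a) * U x + b) (K : ℝ)
              linarith
            · simp only [Set.indicator, Set.mem_ofPred_eq, hxK, if_false, add_zero]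
              rw [min_eq_right (not_le.1 hxK).le]
              exact (ENNReal.ofReal_le_ofReal (min_le_right _ _)).trans le_self_add
        _ = _ := by rw [lintegral_add_right _ measurable_const]; simp
    have h3 := h2.trans (add_le_add_left h1 _)
    exact (ENNReal.add_le_add_iff_left hfin).1 h3
  have hmono : ∫⁻ x, ENNReal.ofReal (a * U x) ∂π ≤ ENNReal.ofReal b := by
    have hun : ⋃ K : ℕ, {x | U x ≤ K} = Set.univ :=
      Set.eq_univ_of_forall fun x => Set.mem_iUnion.2 (exists_nat_ge (U x))
    have hdir : Directed (· ⊆ ·) fun K : ℕ => {x | U x ≤ K} :=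
      directed_of_isDirected_le fun i j hij x (hx : U x ≤ i) =>
        hx.trans (Nat.cast_le.2 hij)
    rw [← setLIntegral_univ, ← hun, setLIntegral_iUnion_of_directed _ hdir]
    exact iSup_le key
  have h4 : ENNReal.ofReal a * ∫⁻ x, ENNReal.ofReal (U x) ∂π ≤ ENNReal.ofReal b := by
    rw [← lintegral_const_mul _ (by fun_prop)]
    simpa only [ENNReal.ofReal_mul ha0.le] using hmono
  rw [ENNReal.ofReal_div_of_pos ha0, ENNReal.le_div_iff_mul_le
    (Or.inl (ENNReal.ofReal_pos.2 ha0).ne') (Or.inl ENNReal.ofReal_ne_top), mul_comm]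
  exact h4

/-- The transition probabilities of a Markov kernel, in the space of probability measures with the
topology of weak convergence. -/
def kernelLaw (κ : Kernel α α) [IsMarkovKernel κ] (x : α) : ProbabilityMeasure α :=
  ⟨κ x, inferInstance⟩

/-- Krylov–Bogoliubov: a Feller kernel with a coercive drift function has an invariant
probability measure, a limit point of the Cesàro means of the laws of the chain. -/
theorem exists_invariant_of_drift {X : Type*} [NormedAddCommGroup X] [ProperSpace X]
    [MeasurableSpace X] [BorelSpace X] {κ : Kernel X X} [IsMarkovKernel κ]
    (hκ : Continuous (kernelLaw κ))
    {U : X → ℝ} (hU : Measurable U) (hU0 : ∀ x, 0 ≤ U x)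
    {c m₀ : ℝ} (hc : 0 < c) (hcoer : ∀ x, c * ‖x‖ ≤ U x + m₀)
    {a b : ℝ} (ha0 : 0 < a) (ha1 : a ≤ 1) (hb : 0 ≤ b)
    (hdrift : ∀ x, ∫⁻ y, ENNReal.ofReal (U y) ∂(κ x) ≤ ENNReal.ofReal ((1 - a) * U x + b)) :
    ∃ π : Measure X, IsProbabilityMeasure π ∧ κ.Invariant π := by
  set ν : ℕ → Measure X := fun n => Nat.rec (Measure.dirac 0) (fun _ m => m.bind κ) n with hν
  have hν0 : ν 0 = Measure.dirac 0 := rfl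
  have hνs (n : ℕ) : ν (n + 1) = (ν n).bind κ := rfl
  have hνp (n : ℕ) : IsProbabilityMeasure (ν n) := by
    induction n with
    | zero => rw [hν0]; infer_instance
    | succ n ih => rw [hνs]; infer_instance
  set D : ℝ := U 0 + b / a with hD
  have hD0 : 0 ≤ D := add_nonneg (hU0 0) (div_nonneg hb ha0.le)
  -- the moment of the drift function stays bounded along the chain
  have hmom (n : ℕ) : ∫⁻ x, ENNReal.ofReal (U x) ∂(ν n) ≤ ENNReal.ofReal D := by
    induction n with
    | zero =>
      rw [hν0, lintegral_dirac' _ (by fun_prop)]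
      exact ENNReal.ofReal_le_ofReal (by rw [hD]; linarith [div_nonneg hb ha0.le])
    | succ n ih =>
      rw [hνs, Measure.lintegral_bind κ.measurable.aemeasurable (by fun_prop)]
      calc _ ≤ ∫⁻ x, (ENNReal.ofReal (1 - a) * ENNReal.ofReal (U x) + ENNReal.ofReal b) ∂(ν n) := by
            refine lintegral_mono fun x => (hdrift x).trans ?_
            rw [← ENNReal.ofReal_mul (by linarith), ← ENNReal.ofReal_add _ hb]
            exact mul_nonneg (by linarith) (hU0 x)
        _ = ENNReal.ofReal (1 - a) * ∫⁻ x, ENNReal.ofReal (U x) ∂(ν n) + ENNReal.ofReal b := by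
            rw [lintegral_add_right _ measurable_const, lintegral_const_mul _ (by fun_prop)]
            simp
        _ ≤ ENNReal.ofReal (1 - a) * ENNReal.ofReal D + ENNReal.ofReal b := by gcongr
        _ = ENNReal.ofReal ((1 - a) * D + b) := by
            rw [← ENNReal.ofReal_mul (by linarith), ← ENNReal.ofReal_add _ hb]
            exact mul_nonneg (by linarith) hD0
        _ ≤ ENNReal.ofReal D := by
            refine ENNReal.ofReal_le_ofReal ?_
            have h1 : a * (b / a) = b := by field_simp
            have h2 : 0 ≤ a * U 0 := mul_nonneg ha0.le (hU0 0)
            rw [hD]; nlinarith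
  set μ : ℕ → Measure X := fun n => ((n : ℝ≥0∞) + 1)⁻¹ • ∑ k ∈ Finset.range (n + 1), ν k with hμ
  have hn0 (n : ℕ) : ((n : ℝ≥0∞) + 1) ≠ 0 := by simp
  have hnt (n : ℕ) : ((n : ℝ≥0∞) + 1) ≠ ∞ := by simp
  have hμp (n : ℕ) : IsProbabilityMeasure (μ n) := by
    refine ⟨?_⟩
    rw [hμ]
    simp only [Measure.smul_apply, Measure.coe_finsetSum, Finset.sum_apply, measure_univ,
      Finset.sum_const, Finset.card_range, smul_eq_mul, nsmul_eq_mul, mul_one, Nat.cast_add,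
      Nat.cast_one]
    exact ENNReal.inv_mul_cancel (hn0 n) (hnt n)
  have hμmom (n : ℕ) : ∫⁻ x, ENNReal.ofReal (U x) ∂(μ n) ≤ ENNReal.ofReal D := by
    rw [hμ]
    simp only [lintegral_smul_measure, lintegral_finsetSum_measure, smul_eq_mul]
    calc _ ≤ ((n : ℝ≥0∞) + 1)⁻¹ * ∑ k ∈ Finset.range (n + 1), ENNReal.ofReal D := by
          gcongr with k _; exact hmom k
      _ = ENNReal.ofReal D := by
          simp only [Finset.sum_const, Finset.card_range, nsmul_eq_mul, Nat.cast_add, Nat.cast_one]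
          rw [← mul_assoc, ENNReal.inv_mul_cancel (hn0 n) (hnt n), one_mul]
  have htight : IsTightMeasureSet (Set.range μ) := by
    refine isTightMeasureSet_of_tendsto_measure_norm_gt ?_
    simp_rw [iSup_range]
    have hlim : Tendsto (fun r : ℝ => ENNReal.ofReal (D / (c * r - m₀))) atTop (𝓝 0) := by
      rw [← ENNReal.ofReal_zero]
      refine ENNReal.tendsto_ofReal (Tendsto.const_div_atTop ?_ _)
      exact tendsto_atTop_add_const_right _ _ (tendsto_id.const_mul_atTop hc)
    refine tendsto_of_tendsto_of_tendsto_of_le_of_le' tendsto_const_nhds hlim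
      (Eventually.of_forall fun _ => zero_le) ?_
    filter_upwards [eventually_gt_atTop (m₀ / c)] with r hr
    have hr' : 0 < c * r - m₀ := by
      have := (div_lt_iff₀ hc).1 hr; linarith
    refine iSup_le fun n => ?_
    calc μ n {x | r < ‖x‖}
        ≤ μ n {x | ENNReal.ofReal (c * r - m₀) ≤ ENNReal.ofReal (U x)} := by
          refine measure_mono fun x (hx : r < ‖x‖) => ?_
          refine ENNReal.ofReal_le_ofReal ?_
          have := hcoer x
          nlinarith
      _ ≤ (∫⁻ x, ENNReal.ofReal (U x) ∂(μ n)) / ENNReal.ofReal (c * r - m₀) :=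
          meas_ge_le_lintegral_div (by fun_prop) (ENNReal.ofReal_pos.2 hr').ne'
            ENNReal.ofReal_ne_top
      _ ≤ ENNReal.ofReal D / ENNReal.ofReal (c * r - m₀) := by gcongr; exact hμmom n
      _ = ENNReal.ofReal (D / (c * r - m₀)) := (ENNReal.ofReal_div_of_pos hr').symm
  set m : ℕ → ProbabilityMeasure X := fun n => ⟨μ n, hμp n⟩ with hm
  have hcpt : IsCompact (closure (Set.range m)) := by
    refine isCompact_closure_of_isTightMeasureSet (htight.subset ?_)
    rintro _ ⟨_, ⟨n, rfl⟩, rfl⟩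
    exact ⟨n, rfl⟩
  obtain ⟨π, -, hπ⟩ := hcpt.ultrafilter_le_nhds ((hyperfilter ℕ : Ultrafilter ℕ).map m) (by
    rw [le_principal_iff]
    exact Filter.mem_map.2 (Filter.univ_mem' fun n => subset_closure ⟨n, rfl⟩))
  have hπ' : Tendsto m (hyperfilter ℕ : Filter ℕ) (𝓝 π) := hπ
  rw [ProbabilityMeasure.tendsto_iff_forall_integral_tendsto] at hπ'
  refine ⟨π, inferInstance, ?_⟩
  refine ext_of_forall_integral_eq_of_IsFiniteMeasure fun g => ?_
  have hbind {ρ : Measure X} [IsProbabilityMeasure ρ] :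
      ∫ x, g x ∂(ρ.bind κ) = ∫ x, ∫ y, g y ∂(κ x) ∂ρ := by
    have h := Kernel.integral_comp (η := κ) (κ := Kernel.const Unit ρ) (a := ()) (f := g)
      (g.integrable _)
    rwa [Kernel.comp_apply, Kernel.const_apply] at h
  -- the kernel maps a bounded continuous function to a bounded continuous function
  set κg : BoundedContinuousFunction X ℝ := BoundedContinuousFunction.ofNormedAddCommGroup
    (fun x => ∫ y, g y ∂(κ x))
    ((ProbabilityMeasure.continuous_integral_boundedContinuousFunction g).comp hκ) ‖g‖
    (fun x => by
      have h := norm_integral_le_of_norm_le_const (μ := κ x)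
        (Eventually.of_forall fun y => g.norm_coe_le_norm y)
      simpa using h) with hκg
  have hκgx (x : X) : κg x = ∫ y, g y ∂(κ x) := rfl
  have hces (φ : BoundedContinuousFunction X ℝ) (n : ℕ) :
      ∫ x, φ x ∂(μ n) = ((n : ℝ) + 1)⁻¹ * ∑ k ∈ Finset.range (n + 1), ∫ x, φ x ∂(ν k) := by
    rw [hμ]
    simp only
    rw [integral_smul_measure, integral_finsetSum_measure fun k _ => φ.integrable _]
    simp [ENNReal.toReal_add]
  -- the sum telescopes, so Cesàro means are almost invariant
  have hdiff (n : ℕ) : ∫ x, κg x ∂(μ n) - ∫ x, g x ∂(μ n)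
      = ((n : ℝ) + 1)⁻¹ * (∫ x, g x ∂(ν (n + 1)) - ∫ x, g x ∂(ν 0)) := by
    rw [hces, hces, ← mul_sub, ← Finset.sum_sub_distrib]
    congr 1
    refine Eq.trans ?_ (Finset.sum_range_sub (fun k => ∫ x, g x ∂(ν k)) (n + 1))
    refine Finset.sum_congr rfl fun k _ => ?_
    rw [hνs, hbind]
    rfl
  have hlim0 : Tendsto (fun n : ℕ => ∫ x, κg x ∂(μ n) - ∫ x, g x ∂(μ n)) atTop (𝓝 0) := by
    simp_rw [hdiff]
    have hb (ρ : Measure X) [IsProbabilityMeasure ρ] : |∫ x, g x ∂ρ| ≤ ‖g‖ := by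
      have h := norm_integral_le_of_norm_le_const (μ := ρ)
        (Eventually.of_forall fun y => g.norm_coe_le_norm y)
      simpa using h
    refine squeeze_zero_norm (a := fun n : ℕ => ((n : ℝ) + 1)⁻¹ * (2 * ‖g‖)) (fun n => ?_) ?_
    · rw [norm_mul, Real.norm_of_nonneg (by positivity : (0 : ℝ) ≤ ((n : ℝ) + 1)⁻¹),
        Real.norm_eq_abs]
      gcongr
      have h1 := abs_sub (∫ x, g x ∂(ν (n + 1))) (∫ x, g x ∂(ν 0))
      have h2 := hb (ν (n + 1))
      have h3 := @hb (ν 0) (hνp 0)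
      linarith
    · have h := tendsto_one_div_add_atTop_nhds_zero_nat (𝕜 := ℝ)
      simpa using h.mul_const (2 * ‖g‖)
  have hlim1 := (hπ' κg).sub (hπ' g)
  have huniq := tendsto_nhds_unique hlim1 (hlim0.mono_left Nat.hyperfilter_le_atTop)
  rw [hbind]
  exact sub_eq_zero.1 huniq

end Kernel

/-- The chain of a kernel that moves `ξ` to `(u, ξ.1)`, where `u` has a density continuous in `ξ`,
is Feller: by Fatou's lemma the probability of an open set is lower semicontinuous in `ξ`, which
is the criterion of the portmanteau theorem. -/
theorem continuous_of_continuousDensity {dx dy : ℕ}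
    {R : Kernel (ZSpace dx dy × ZSpace dx dy) (ZSpace dx dy × ZSpace dx dy)} [IsMarkovKernel R]
    (hR : HasContinuousDensity R)
    (hsnd : ∀ ξ, R ξ = ((R ξ).map Prod.fst).map fun u => (u, ξ.1)) :
    Continuous (kernelLaw R) := by
  obtain ⟨p, hpm, hp0, hpc, hp⟩ := hR
  have hval (ξ : ZSpace dx dy × ZSpace dx dy) {G : Set (ZSpace dx dy × ZSpace dx dy)}
      (hG : IsOpen G) : R ξ G = ∫⁻ u, G.indicator 1 (u, ξ.1) * ENNReal.ofReal (p ξ u) := by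
    have hm : Measurable fun u : ZSpace dx dy => (u, ξ.1) := by fun_prop
    have hGm := hm hG.measurableSet
    rw [hsnd ξ, Measure.map_apply hm hG.measurableSet, hp, withDensity_apply _ hGm,
      ← lintegral_indicator hGm]
    refine lintegral_congr fun u => ?_
    by_cases hu : (u, ξ.1) ∈ G
    · rw [Set.indicator_of_mem (by exact hu), Set.indicator_of_mem hu]; simp
    · rw [Set.indicator_of_notMem (by exact hu), Set.indicator_of_notMem hu]; simp
  rw [continuous_iff_continuousAt]
  intro ξ
  refine Filter.tendsto_of_seq_tendsto fun s hs =>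
    tendsto_of_forall_isOpen_le_liminf_nat' fun G hG => ?_
  change R ξ G ≤ Filter.liminf (fun n => R (s n) G) Filter.atTop
  rw [hval ξ hG]
  simp_rw [hval _ hG]
  refine le_trans (lintegral_mono fun u => ?_) (lintegral_liminf_le fun n => ?_)
  · by_cases hu : (u, ξ.1) ∈ G
    · have hev : ∀ᶠ n in Filter.atTop, (u, (s n).1) ∈ G := by
        have hc : Continuous fun ζ : ZSpace dx dy × ZSpace dx dy => (u, ζ.1) := by fun_prop
        exact ((hc.tendsto ξ).comp hs).eventually (hG.mem_nhds hu)
      have hlim : Filter.Tendsto (fun n => ENNReal.ofReal (p (s n) u)) Filter.atTop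
          (nhds (ENNReal.ofReal (p ξ u))) :=
        ENNReal.tendsto_ofReal (((hpc u).tendsto ξ).comp hs)
      rw [Set.indicator_of_mem hu, Pi.one_apply, one_mul]
      refine (Filter.Tendsto.liminf_eq (hlim.congr' ?_)).ge
      filter_upwards [hev] with n hn
      rw [Set.indicator_of_mem hn, Pi.one_apply, one_mul]
    · rw [Set.indicator_of_notMem hu, zero_mul]
      exact zero_le
  · exact ((measurable_one.indicator hG.measurableSet).comp (by fun_prop)).mul
      (hpm _).ennreal_ofReal

/-! ### The blocks of a vector -/

section Blocks

variable {dx dy : ℕ}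

@[simp] theorem xPart_apply (z : ZSpace dx dy) (i : Fin dx) : xPart z i = z (Sum.inl i) := rfl

@[simp] theorem yPart_apply (z : ZSpace dx dy) (j : Fin dy) : yPart z j = z (Sum.inr j) := rfl

@[simp] theorem pair_inl (x : XSpace dx) (y : YSpace dy) (i : Fin dx) :
    pair x y (Sum.inl i) = x i := rfl

@[simp] theorem pair_inr (x : XSpace dx) (y : YSpace dy) (j : Fin dy) :
    pair x y (Sum.inr j) = y j := rfl

@[simp] theorem xPart_pair (x : XSpace dx) (y : YSpace dy) : xPart (pair x y) = x := rfl

@[simp] theorem yPart_pair (x : XSpace dx) (y : YSpace dy) : yPart (pair x y) = y := rfl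

@[simp] theorem pair_xPart_yPart (z : ZSpace dx dy) : pair (xPart z) (yPart z) = z := by
  ext (i | j) <;> rfl

@[simp] theorem xPart_sub (z w : ZSpace dx dy) : xPart (z - w) = xPart z - xPart w := rfl

@[simp] theorem yPart_sub (z w : ZSpace dx dy) : yPart (z - w) = yPart z - yPart w := rfl

@[simp] theorem xPart_add (z w : ZSpace dx dy) : xPart (z + w) = xPart z + xPart w := rfl

@[simp] theorem yPart_add (z w : ZSpace dx dy) : yPart (z + w) = yPart z + yPart w := rfl

@[simp] theorem xPart_smul (c : ℝ) (z : ZSpace dx dy) : xPart (c • z) = c • xPart z := rfl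

@[simp] theorem yPart_smul (c : ℝ) (z : ZSpace dx dy) : yPart (c • z) = c • yPart z := rfl

theorem pair_sub_pair (x x' : XSpace dx) (y y' : YSpace dy) :
    pair x y - pair x' y' = pair (x - x') (y - y') := by
  ext (i | j) <;> rfl

theorem inner_eq_add (z w : ZSpace dx dy) :
    inner ℝ z w = inner ℝ (xPart z) (xPart w) + inner ℝ (yPart z) (yPart w) := by
  simp [PiLp.inner_apply, Fintype.sum_sum_type]

theorem norm_sq_eq_add (z : ZSpace dx dy) : ‖z‖ ^ 2 = ‖xPart z‖ ^ 2 + ‖yPart z‖ ^ 2 := by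
  rw [← real_inner_self_eq_norm_sq, ← real_inner_self_eq_norm_sq, ← real_inner_self_eq_norm_sq,
    inner_eq_add]

theorem norm_xPart_le (z : ZSpace dx dy) : ‖xPart z‖ ≤ ‖z‖ := by
  refine le_of_sq_le_sq ?_ (norm_nonneg z)
  nlinarith [norm_sq_eq_add z, sq_nonneg ‖yPart z‖]

theorem norm_yPart_le (z : ZSpace dx dy) : ‖yPart z‖ ≤ ‖z‖ := by
  refine le_of_sq_le_sq ?_ (norm_nonneg z)
  nlinarith [norm_sq_eq_add z, sq_nonneg ‖xPart z‖]

theorem norm_pair_zero_left (y : YSpace dy) : ‖(pair 0 y : ZSpace dx dy)‖ = ‖y‖ := by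
  have h := norm_sq_eq_add (pair 0 y : ZSpace dx dy)
  simp only [xPart_pair, yPart_pair, norm_zero] at h
  exact (sq_eq_sq₀ (norm_nonneg _) (norm_nonneg _)).1 (by linarith)

theorem norm_le_norm_xPart_add_norm_yPart (z : ZSpace dx dy) :
    ‖z‖ ≤ ‖xPart z‖ + ‖yPart z‖ := by
  refine le_of_sq_le_sq ?_ (by positivity)
  nlinarith [norm_sq_eq_add z, norm_nonneg (xPart z), norm_nonneg (yPart z),
    mul_nonneg (norm_nonneg (xPart z)) (norm_nonneg (yPart z))]

end Blocks

/-! ### First-order consequences of strong convexity-concavity -/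

section Convexity

variable {dx dy : ℕ} {f : ZSpace dx dy → ℝ} {μx μy : ℝ}

/-- The tangent-line inequality of a strongly convex function on a segment. -/
theorem add_deriv_le_of_strongly_convex {ψ : ℝ → ℝ} {d c : ℝ} (hd : HasDerivAt ψ d 0)
    (hψ : ∀ t ∈ Set.Ioo (0 : ℝ) 1, ψ t ≤ (1 - t) * ψ 0 + t * ψ 1 - (1 - t) * t * c) :
    ψ 0 + d + c ≤ ψ 1 := by
  have h1 : Filter.Tendsto (slope ψ 0) (nhdsWithin 0 (Set.Ioi 0)) (nhds d) :=
    (hasDerivAt_iff_tendsto_slope.1 hd).mono_left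
      (nhdsWithin_mono _ fun t (ht : 0 < t) => ht.ne')
  have h2 : Filter.Tendsto (fun t : ℝ => ψ 1 - ψ 0 - (1 - t) * c) (nhdsWithin 0 (Set.Ioi 0))
      (nhds (ψ 1 - ψ 0 - (1 - 0) * c)) := by
    have : Continuous fun t : ℝ => ψ 1 - ψ 0 - (1 - t) * c := by fun_prop
    exact (this.tendsto 0).mono_left nhdsWithin_le_nhds
  have h3 := le_of_tendsto_of_tendsto h1 h2 (by
    filter_upwards [Ioo_mem_nhdsGT (zero_lt_one' ℝ)] with t ht
    rw [slope_def_field, sub_zero, div_le_iff₀ ht.1]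
    have := hψ t ht
    nlinarith)
  linarith

theorem hasDerivAt_line (hf : Differentiable ℝ f) (z v : ZSpace dx dy) :
    HasDerivAt (fun t : ℝ => f (z + t • v)) (inner ℝ (gradient f z) v) 0 := by
  have h := (hf z).hasGradientAt.hasFDerivAt.hasLineDerivAt v
  simpa [HasLineDerivAt] using h

theorem IsAdmissibleObjective.differentiable (hf : IsAdmissibleObjective f μx μy) :
    Differentiable ℝ f := hf.contDiff.differentiable (by norm_num)

theorem IsAdmissibleObjective.add_inner_gradX_le (hf : IsAdmissibleObjective f μx μy)
    (z : ZSpace dx dy) (x' : XSpace dx) :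
    f z + inner ℝ (gradX f z) (x' - xPart z) + μx / 2 * ‖x' - xPart z‖ ^ 2
      ≤ f (pair x' (yPart z)) := by
  have hd := hasDerivAt_line hf.differentiable z (pair (x' - xPart z) 0)
  have hline (t : ℝ) : z + t • pair (x' - xPart z) 0
      = pair ((1 - t) • xPart z + t • x') (yPart z) := by
    ext (i | j)
    · simp; ring
    · simp
  have h := add_deriv_le_of_strongly_convex (c := μx / 2 * ‖x' - xPart z‖ ^ 2) hd fun t ht => by
    simp only [hline]
    have h := (hf.convex (yPart z)).2 (Set.mem_univ (xPart z)) (Set.mem_univ x')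
      (sub_nonneg.2 ht.2.le) ht.1.le (sub_add_cancel _ _)
    simp only [smul_eq_mul, norm_sub_rev (xPart z) x'] at h
    simpa using h
  simp only [hline] at h
  rw [inner_eq_add] at h
  simpa [gradX] using h

theorem IsAdmissibleObjective.le_add_inner_gradY (hf : IsAdmissibleObjective f μx μy)
    (z : ZSpace dx dy) (y' : YSpace dy) :
    f (pair (xPart z) y')
      ≤ f z + inner ℝ (gradY f z) (y' - yPart z) - μy / 2 * ‖y' - yPart z‖ ^ 2 := by
  have hd := (hasDerivAt_line hf.differentiable z (pair 0 (y' - yPart z))).neg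
  have hline (t : ℝ) : z + t • pair 0 (y' - yPart z)
      = pair (xPart z) ((1 - t) • yPart z + t • y') := by
    ext (i | j)
    · simp
    · simp; ring
  have h := add_deriv_le_of_strongly_convex (c := μy / 2 * ‖y' - yPart z‖ ^ 2) hd fun t ht => by
    simp only [Pi.neg_apply, hline]
    have h := (hf.concave (xPart z)).2 (Set.mem_univ (yPart z)) (Set.mem_univ y')
      (sub_nonneg.2 ht.2.le) ht.1.le (sub_add_cancel _ _)
    simp only [smul_eq_mul, norm_sub_rev (yPart z) y'] at h
    simp only [sub_zero, one_smul, zero_smul, add_zero, sub_self, zero_add] at h ⊢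
    linarith
  simp only [Pi.neg_apply, hline] at h
  rw [inner_eq_add] at h
  simp only [xPart_pair, inner_zero_right, zero_add, yPart_pair, sub_zero, one_smul, zero_smul,
    add_zero, sub_self, pair_xPart_yPart] at h
  rw [gradY]
  linarith

/-- The gradient vanishes at a saddle point, an extremum along each of the two blocks. -/
theorem gradient_eq_zero_of_isSaddlePoint (hf : Differentiable ℝ f) {zs : ZSpace dx dy}
    (hzs : IsSaddlePoint f zs) : gradient f zs = 0 := by
  have hx (v : XSpace dx) : inner ℝ (gradient f zs) (pair v (0 : YSpace dy)) = 0 := by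
    refine IsLocalMin.hasDerivAt_eq_zero (Filter.Eventually.of_forall fun t => ?_)
      (hasDerivAt_line hf zs (pair v 0))
    have : zs + t • pair v (0 : YSpace dy) = pair (xPart zs + t • v) (yPart zs) := by
      ext (i | j) <;> simp
    simpa [this] using hzs.1 (xPart zs + t • v)
  have hy (v : YSpace dy) : inner ℝ (gradient f zs) (pair (0 : XSpace dx) v) = 0 := by
    refine IsLocalMax.hasDerivAt_eq_zero (Filter.Eventually.of_forall fun t => ?_)
      (hasDerivAt_line hf zs (pair 0 v))
    have : zs + t • pair (0 : XSpace dx) v = pair (xPart zs) (yPart zs + t • v) := by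
      ext (i | j) <;> simp
    simpa [this] using hzs.2 (yPart zs + t • v)
  have h1 := hx (xPart (gradient f zs))
  have h2 := hy (yPart (gradient f zs))
  rw [inner_eq_add] at h1 h2
  simp only [xPart_pair, yPart_pair, inner_zero_right, add_zero, zero_add,
    inner_self_eq_zero] at h1 h2
  rw [← pair_xPart_yPart (gradient f zs), h1, h2]
  ext (i | j) <;> rfl

/-- The drift field `(-∇_x f, ∇_y f)` points towards the saddle point `z_*`. Adding the four
first-order inequalities at `z` and at `z_*`, towards the other point in one block, cancels all
values of `f`. -/
theorem IsAdmissibleObjective.dissipative (hf : IsAdmissibleObjective f μx μy)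
    {zs : ZSpace dx dy} (hzs : IsSaddlePoint f zs) (z : ZSpace dx dy) :
    -inner ℝ (gradX f z) (xPart z - xPart zs) + inner ℝ (gradY f z) (yPart z - yPart zs)
      ≤ -(μx * ‖xPart z - xPart zs‖ ^ 2 + μy * ‖yPart z - yPart zs‖ ^ 2) := by
  have h0 := gradient_eq_zero_of_isSaddlePoint hf.differentiable hzs
  have hgx : gradX f zs = 0 := by rw [gradX, h0]; rfl
  have hgy : gradY f zs = 0 := by rw [gradY, h0]; rfl
  have h1 := hf.add_inner_gradX_le z (xPart zs)
  have h2 := hf.le_add_inner_gradY z (yPart zs)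
  have h3 := hf.add_inner_gradX_le zs (xPart z)
  have h4 := hf.le_add_inner_gradY zs (yPart z)
  rw [hgx, inner_zero_left] at h3
  rw [hgy, inner_zero_left] at h4
  rw [← neg_sub (xPart z), inner_neg_right, norm_neg] at h1
  rw [← neg_sub (yPart z), inner_neg_right, norm_neg] at h2
  linarith

/-- A common Lipschitz constant of the partial gradients. -/
theorem IsAdmissibleObjective.exists_lipschitz (hf : IsAdmissibleObjective f μx μy) :
    ∃ L : ℝ, 0 ≤ L ∧ (∀ z z', ‖gradX f z - gradX f z'‖ ≤ L * ‖z - z'‖) ∧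
      ∀ z z', ‖gradY f z - gradY f z'‖ ≤ L * ‖z - z'‖ := by
  obtain ⟨a, b, hab⟩ := hf.lipschitz_gradX
  obtain ⟨c, d, hcd⟩ := hf.lipschitz_gradY
  have key (p q : ℝ) (z z' : ZSpace dx dy) :
      p * ‖xPart z - xPart z'‖ + q * ‖yPart z - yPart z'‖ ≤ (|p| + |q|) * ‖z - z'‖ := by
    have h1 := norm_xPart_le (z - z')
    have h2 := norm_yPart_le (z - z')
    rw [xPart_sub] at h1
    rw [yPart_sub] at h2
    rw [add_mul]
    gcongr
    · exact le_abs_self p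
    · exact le_abs_self q
  refine ⟨max (|a| + |b|) (|c| + |d|), le_max_of_le_left (by positivity), fun z z' => ?_,
    fun z z' => ?_⟩
  · have h := (hab (xPart z) (xPart z') (yPart z) (yPart z')).trans (key a b z z')
    simp only [pair_xPart_yPart] at h
    exact h.trans (by gcongr; exact le_max_left _ _)
  · have h := (hcd (xPart z) (xPart z') (yPart z) (yPart z')).trans (key c d z z')
    simp only [pair_xPart_yPart] at h
    exact h.trans (by gcongr; exact le_max_right _ _)

end Convexity

/-! ### Taylor expansions of the gradient at the saddle point -/

section Taylor

variable {E F : Type*} [NormedAddCommGroup E] [NormedSpace ℝ E] [NormedAddCommGroup F]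
  [NormedSpace ℝ F]

/-- If `‖Dg - Dg(z)‖` grows at most like `B` times the distance to `z`, then the error of the
linear map `Dg(z)` in the increment of `g` from `a` to `a + v`. -/
theorem norm_increment_sub_fderiv_le {g : E → F} (hg : Differentiable ℝ g) {B : ℝ} (hB : 0 ≤ B)
    {z : E} (hlip : ∀ w, ‖fderiv ℝ g w - fderiv ℝ g z‖ ≤ B * ‖w - z‖) (a v : E) :
    ‖g (a + v) - g a - fderiv ℝ g z v‖ ≤ B * (‖a - z‖ + ‖v‖) * ‖v‖ := by
  have h := (convex_segment a (a + v)).norm_image_sub_le_of_norm_fderiv_le' (𝕜 := ℝ) (f := g)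
    (φ := fderiv ℝ g z) (C := B * (‖a - z‖ + ‖v‖)) (fun w _ => hg w) (fun w hw => ?_)
    (left_mem_segment ℝ a (a + v)) (right_mem_segment ℝ a (a + v))
  · simpa using h
  · refine (hlip w).trans ?_
    gcongr
    rw [segment_eq_image'] at hw
    obtain ⟨t, ht, rfl⟩ := hw
    have h1 : a + t • (a + v - a) - z = (a - z) + t • v := by
      rw [add_sub_cancel_left]; abel
    simp only [h1]
    refine (norm_add_le _ _).trans (by
      gcongr
      rw [norm_smul, Real.norm_of_nonneg ht.1]
      exact mul_le_of_le_one_left (norm_nonneg v) ht.2)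

/-- Second-order Taylor expansion with a cubic remainder. -/
theorem norm_sub_taylor_two_le {g : E → F} (hg : ContDiff ℝ 2 g) {B : ℝ} (hB : 0 ≤ B)
    {z : E} (hlip : ∀ w, ‖fderiv ℝ (fderiv ℝ g) w - fderiv ℝ (fderiv ℝ g) z‖ ≤ B * ‖w - z‖)
    (v : E) :
    ‖g (z + v) - g z - fderiv ℝ g z v - (1 / 2 : ℝ) • fderiv ℝ (fderiv ℝ g) z v v‖
      ≤ B * ‖v‖ ^ 3 := by
  set Q := fderiv ℝ (fderiv ℝ g) z with hQ
  have hsymm (u w : E) : Q u w = Q w u :=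
    (hg.contDiffAt.isSymmSndFDerivAt (by simp)) u w
  have hgd : Differentiable ℝ g := hg.differentiable (by norm_num)
  have hg1 : Differentiable ℝ (fderiv ℝ g) :=
    (hg.fderiv_right (m := 1) (by norm_num)).differentiable (by norm_num)
  set Φ : E → F := fun u => g (z + u) - (1 / 2 : ℝ) • Q u u with hΦ
  have hderiv (u : E) : HasFDerivAt Φ (fderiv ℝ g (z + u) - Q u) u := by
    have h1 : HasFDerivAt (fun u => g (z + u)) (fderiv ℝ g (z + u)) u := by
      exact (hgd (z + u)).hasFDerivAt.comp u ((hasFDerivAt_id u).const_add z)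
    have h2 : HasFDerivAt (fun u => Q u u) (Q u + Q.flip u) u := by
      have := Q.hasFDerivAt (x := u) |>.clm_apply (hasFDerivAt_id u)
      refine this.congr_fderiv ?_
      ext w; simp
    refine (h1.sub (h2.const_smul (1 / 2 : ℝ))).congr_fderiv ?_
    ext w
    simp only [sub_apply, smul_apply,
      add_apply, ContinuousLinearMap.flip_apply, hsymm w u]
    rw [← two_smul ℝ (Q u w), smul_smul]
    norm_num
  have hball := (convex_closedBall (0 : E) ‖v‖).norm_image_sub_le_of_norm_fderiv_le' (𝕜 := ℝ)
    (f := Φ) (φ := fderiv ℝ g z) (C := B * ‖v‖ * ‖v‖)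
    (fun u _ => (hderiv u).differentiableAt) (fun u hu => ?_)
    (x := 0) (y := v) (by simp) (by simp)
  · calc _ = ‖Φ v - Φ 0 - fderiv ℝ g z (v - 0)‖ := by
          congr 1; simp [hΦ]; abel
      _ ≤ _ := hball.trans_eq (by rw [sub_zero]; ring)
  · have hu' : ‖u‖ ≤ ‖v‖ := by simpa using hu
    have h := norm_increment_sub_fderiv_le hg1 hB hlip z u
    rw [sub_self, norm_zero, zero_add, ← hQ] at h
    rw [(hderiv u).fderiv, sub_right_comm]
    exact h.trans (by gcongr)

set_option maxSynthPendingDepth 4 in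
/-- Expansions of the derivative of a `C⁴` function with bounded third and fourth derivatives in
the coordinates `c` of a family `b` of unit vectors. -/
theorem exists_fderiv_expansion {ι : Type*} [Fintype ι] {b : ι → E} (hb : ∀ i, ‖b i‖ = 1)
    {c : E → ι → ℝ} (hc : ∀ v, ∑ i, c v i • b i = v) {f : E → ℝ} (hf : ContDiff ℝ 4 f)
    {B3 B4 : ℝ} (hB3 : ∀ z, ‖iteratedFDeriv ℝ 3 f z‖ ≤ B3)
    (hB4 : ∀ z, ‖iteratedFDeriv ℝ 4 f z‖ ≤ B4) (zs : E) : ∃ K : ℝ, 0 ≤ K ∧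
      (∀ z l, |fderiv ℝ f z (b l) - fderiv ℝ f zs (b l)
        - ∑ i, iteratedFDeriv ℝ 2 f zs ![b l, b i] * c (z - zs) i
        - 1 / 2 * ∑ i, ∑ j, iteratedFDeriv ℝ 3 f zs ![b i, b j, b l] *
          (c (z - zs) i * c (z - zs) j)| ≤ K * ‖z - zs‖ ^ 3) ∧
      ∀ a v l, |fderiv ℝ f (a + v) (b l) - fderiv ℝ f a (b l)
        - ∑ i, iteratedFDeriv ℝ 2 f zs ![b l, b i] * c v i|
        ≤ K * (‖a - zs‖ + ‖v‖) * ‖v‖ := by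
  have hD1 : ContDiff ℝ 3 (fderiv ℝ f) := hf.fderiv_right (by norm_num)
  have hD2 : ContDiff ℝ 2 (fderiv ℝ (fderiv ℝ f)) := hD1.fderiv_right (by norm_num)
  have hD3 : ContDiff ℝ 1 (fderiv ℝ (fderiv ℝ (fderiv ℝ f))) := hD2.fderiv_right (by norm_num)
  set D2 := fderiv ℝ (fderiv ℝ f) with hD2def
  set D3 := fderiv ℝ D2 with hD3def
  have hn3 (z) : ‖D3 z‖ ≤ B3 := by
    refine le_trans (le_of_eq ?_) (hB3 z)
    rw [hD3def, hD2def, ← norm_iteratedFDeriv_one, norm_iteratedFDeriv_fderiv,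
      norm_iteratedFDeriv_fderiv]
  have hn4 (z) : ‖fderiv ℝ D3 z‖ ≤ B4 := by
    refine le_trans (le_of_eq ?_) (hB4 z)
    rw [hD3def, hD2def, ← norm_iteratedFDeriv_one, norm_iteratedFDeriv_fderiv,
      norm_iteratedFDeriv_fderiv, norm_iteratedFDeriv_fderiv]
  have hB30 : 0 ≤ B3 := (norm_nonneg _).trans (hn3 zs)
  have hB40 : 0 ≤ B4 := (norm_nonneg _).trans (hn4 zs)
  have hlip2 (w) : ‖D2 w - D2 zs‖ ≤ B3 * ‖w - zs‖ :=
    convex_univ.norm_image_sub_le_of_norm_fderiv_le (𝕜 := ℝ)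
      (fun u _ => hD2.differentiable (by norm_num) u) (fun u _ => hn3 u) (Set.mem_univ _)
      (Set.mem_univ _)
  have hlip3 (w) : ‖D3 w - D3 zs‖ ≤ B4 * ‖w - zs‖ :=
    convex_univ.norm_image_sub_le_of_norm_fderiv_le (𝕜 := ℝ)
      (fun u _ => hD3.differentiable (by norm_num) u) (fun u _ => hn4 u) (Set.mem_univ _)
      (Set.mem_univ _)
  have hsymm (u w) : D2 zs u w = D2 zs w u :=
    ((hf.of_le (by norm_num : (2 : WithTop ℕ∞) ≤ 4)).contDiffAt.isSymmSndFDerivAt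
      (by simp)) u w
  have hH (l) (v : E) : D2 zs v (b l) = ∑ i, iteratedFDeriv ℝ 2 f zs ![b l, b i] * c v i := by
    rw [hsymm]
    conv_lhs => rw [← hc v]
    rw [map_sum]
    refine Finset.sum_congr rfl fun i _ => ?_
    rw [map_smul, iteratedFDeriv_two_apply, smul_eq_mul, mul_comm]
    rfl
  have hT (l) (v : E) : D3 zs v v (b l)
      = ∑ i, ∑ j, iteratedFDeriv ℝ 3 f zs ![b i, b j, b l] * (c v i * c v j) := by
    have h3 (i j) : iteratedFDeriv ℝ 3 f zs ![b i, b j, b l] = D3 zs (b i) (b j) (b l) := by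
      rw [iteratedFDeriv_succ_apply_right, iteratedFDeriv_two_apply]
      rfl
    have h1 (w : E) : D3 zs w = ∑ i, c w i • D3 zs (b i) := by
      conv_lhs => rw [← hc w]
      simp only [map_sum, map_smul]
    have h2 (i) (w : E) : D3 zs (b i) w = ∑ j, c w j • D3 zs (b i) (b j) := by
      conv_lhs => rw [← hc w]
      simp only [map_sum, map_smul]
    rw [h1]
    simp only [sum_apply, smul_apply, h2 _ v, smul_eq_mul, h3,
      Finset.mul_sum]
    refine Finset.sum_congr rfl fun i _ => Finset.sum_congr rfl fun j _ => by ring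
  refine ⟨max B3 B4, le_max_of_le_left hB30, fun z l => ?_, fun a v l => ?_⟩
  · have h := norm_sub_taylor_two_le (hD1.of_le (by norm_num)) hB40 hlip3 (z - zs)
    have h1 := (ContinuousLinearMap.le_opNorm _ (b l)).trans
      (mul_le_mul_of_nonneg_right h (norm_nonneg (b l)))
    rw [hb, mul_one] at h1
    simp only [sub_apply, smul_apply, Real.norm_eq_abs, smul_eq_mul, add_sub_cancel] at h1
    rw [← hD2def, ← hD3def, hH, hT] at h1
    exact h1.trans (by gcongr; exact le_max_right _ _)
  · have h := norm_increment_sub_fderiv_le (hD1.differentiable (by norm_num)) hB30 hlip2 a v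
    have h1 := (ContinuousLinearMap.le_opNorm _ (b l)).trans
      (mul_le_mul_of_nonneg_right h (norm_nonneg (b l)))
    rw [hb, mul_one] at h1
    simp only [sub_apply, Real.norm_eq_abs] at h1
    rw [← hD2def, hH] at h1
    exact h1.trans (by gcongr; exact le_max_left _ _)

end Taylor

section Objective

variable {dx dy : ℕ} {f : ZSpace dx dy → ℝ} {μx μy : ℝ}

theorem gradient_apply_eq_fderiv (hf : Differentiable ℝ f) (z : ZSpace dx dy)
    (l : Fin dx ⊕ Fin dy) : gradient f z l = fderiv ℝ f z (e l) := by
  rw [(hf z).hasGradientAt.hasFDerivAt.fderiv, InnerProductSpace.toDual_apply_apply, e,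
    EuclideanSpace.inner_single_right]
  simp

theorem sum_smul_e (v : ZSpace dx dy) : ∑ i, v i • (e i : ZSpace dx dy) = v := by
  ext j
  simp only [e, WithLp.ofLp_sum, WithLp.ofLp_smul, Finset.sum_apply, Pi.smul_apply, smul_eq_mul,
    PiLp.single_apply]
  simp

/-- The components of the gradient of `f`, to second order at `zs` and to first order near `zs`,
with remainders uniform in the point. -/
theorem IsAdmissibleObjective.exists_gradient_expansion (hf : IsAdmissibleObjective f μx μy)
    (zs : ZSpace dx dy) : ∃ K : ℝ, 0 ≤ K ∧
      (∀ z l, |gradient f z l - gradient f zs l - ∑ i, hessian f zs l i * (z - zs) i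
        - 1 / 2 * ∑ i, ∑ j, iteratedFDeriv ℝ 3 f zs ![e i, e j, e l] *
          ((z - zs) i * (z - zs) j)| ≤ K * ‖z - zs‖ ^ 3) ∧
      ∀ a v l, |gradient f (a + v) l - gradient f a l - ∑ i, hessian f zs l i * v i|
        ≤ K * (‖a - zs‖ + ‖v‖) * ‖v‖ := by
  obtain ⟨B3, hB3⟩ := hf.bounded_third
  obtain ⟨B4, hB4⟩ := hf.bounded_fourth
  simp only [gradient_apply_eq_fderiv hf.differentiable]
  exact exists_fderiv_expansion (b := fun i : Fin dx ⊕ Fin dy => (e i : ZSpace dx dy))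
    (c := fun v i => v i) (fun i => by simp [e]) sum_smul_e hf.contDiff hB3 hB4 zs

theorem IsAdmissibleObjective.continuous_gradient (hf : IsAdmissibleObjective f μx μy) :
    Continuous (gradient f) := by
  have h : Continuous (fderiv ℝ f) := hf.contDiff.continuous_fderiv (by norm_num)
  exact (LinearIsometryEquiv.continuous _).comp h

end Objective

/-! ### The linearized drift and its Lyapunov operator -/

section LinearAlgebra

variable {dx dy : ℕ} {f : ZSpace dx dy → ℝ} {μx μy : ℝ}

/-- The diagonal weights `(μ_x, μ_y)` for which the drift field is dissipative. -/
def weight (dx dy : ℕ) (μx μy : ℝ) : Fin dx ⊕ Fin dy → ℝ :=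
  Sum.elim (fun _ => μx) (fun _ => μy)

/-- `A` has logarithmic norm at most `-1` in the inner product weighted by `g`. -/
def IsDissipative {ι : Type*} [Fintype ι] (g : ι → ℝ) (A : Matrix ι ι ℝ) : Prop :=
  ∀ v : ι → ℝ, ∑ i, g i * v i * (A *ᵥ v) i ≤ -∑ i, g i * v i ^ 2

theorem C₀_mulVec_inl (v : Fin dx ⊕ Fin dy → ℝ) (i : Fin dx) :
    (C₀ dx dy μx μy *ᵥ v) (Sum.inl i) = -(1 / μx) * v (Sum.inl i) := by
  simp [C₀, Matrix.fromBlocks_mulVec, Matrix.neg_mulVec, Matrix.smul_mulVec]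

theorem C₀_mulVec_inr (v : Fin dx ⊕ Fin dy → ℝ) (j : Fin dy) :
    (C₀ dx dy μx μy *ᵥ v) (Sum.inr j) = 1 / μy * v (Sum.inr j) := by
  simp [C₀, Matrix.fromBlocks_mulVec, Matrix.smul_mulVec]

/-- Dissipativity of the drift field, linearized at the saddle point. -/
theorem IsAdmissibleObjective.isDissipative (hf : IsAdmissibleObjective f μx μy)
    (hμx : 0 < μx) (hμy : 0 < μy) {zs : ZSpace dx dy} (hzs : IsSaddlePoint f zs) :
    IsDissipative (weight dx dy μx μy) (C₀ dx dy μx μy * hessian f zs) := by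
  intro v
  obtain ⟨K, hK0, -, hK⟩ := hf.exists_gradient_expansion zs
  have h0 := gradient_eq_zero_of_isSaddlePoint hf.differentiable hzs
  set w : ZSpace dx dy := WithLp.toLp 2 v with hw
  set Hv : Fin dx ⊕ Fin dy → ℝ := hessian f zs *ᵥ v with hHv
  set N : ℝ := ∑ i, |v i| * (K * (‖w‖ * ‖w‖)) with hN
  set σ : Fin dx ⊕ Fin dy → ℝ := Sum.elim (fun _ => -1) (fun _ => 1) with hσ
  have hlhs : ∑ i, weight dx dy μx μy i * v i * ((C₀ dx dy μx μy * hessian f zs) *ᵥ v) i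
      = ∑ l, σ l * v l * Hv l := by
    simp only [← Matrix.mulVec_mulVec, Fintype.sum_sum_type, C₀_mulVec_inl, C₀_mulVec_inr, weight,
      Sum.elim_inl, Sum.elim_inr, ← hHv, hσ]
    congr 1 <;> refine Finset.sum_congr rfl fun i _ => ?_ <;> field_simp
  have hrhs : ∑ i, weight dx dy μx μy i * v i ^ 2 = μx * ‖xPart w‖ ^ 2 + μy * ‖yPart w‖ ^ 2 := by
    simp [Fintype.sum_sum_type, EuclideanSpace.norm_sq_eq, weight, Finset.mul_sum, hw]
  rw [hlhs, hrhs]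
  -- the nonlinear inequality at `zs + t v`, divided by `t ^ 2`
  have key : ∀ t : ℝ, 0 < t →
      ∑ l, σ l * v l * Hv l
        ≤ -(μx * ‖xPart w‖ ^ 2 + μy * ‖yPart w‖ ^ 2) + t * N := by
    intro t ht
    have hd := hf.dissipative hzs (zs + t • w)
    rw [xPart_add, yPart_add, add_sub_cancel_left, add_sub_cancel_left, xPart_smul, yPart_smul,
      norm_smul, norm_smul, mul_pow, mul_pow, Real.norm_of_nonneg ht.le, PiLp.inner_apply,
      PiLp.inner_apply] at hd
    have hG (l) : |gradient f (zs + t • w) l - t * Hv l| ≤ t ^ 2 * (K * (‖w‖ * ‖w‖)) := by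
      have h := hK zs (t • w) l
      rw [h0, sub_self, norm_zero, zero_add, norm_smul, Real.norm_of_nonneg ht.le] at h
      have h1 : ∑ i, hessian f zs l i * (t • w) i = t * Hv l := by
        rw [hHv, Matrix.mulVec, dotProduct, Finset.mul_sum]
        exact Finset.sum_congr rfl fun i _ => by simp [hw]; ring
      rw [h1] at h
      simp only [PiLp.zero_apply, sub_zero] at h
      exact h.trans_eq (by ring)
    have hd' : ∑ l, σ l * gradient f (zs + t • w) l * (t * v l)
        ≤ -(t ^ 2 * (μx * ‖xPart w‖ ^ 2 + μy * ‖yPart w‖ ^ 2)) := by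
      refine le_trans (le_of_eq ?_) (hd.trans_eq (by ring))
      simp only [Fintype.sum_sum_type, hσ, Sum.elim_inl, Sum.elim_inr, ← Finset.sum_neg_distrib]
      congr 1 <;> refine Finset.sum_congr rfl fun i _ => ?_ <;>
        simp [gradX, gradY, hw, mul_comm]
    have hσ1 (l) : |σ l| = 1 := by rcases l with l | l <;> simp [hσ]
    have herr : ∑ l, σ l * (t * Hv l - gradient f (zs + t • w) l) * (t * v l) ≤ t ^ 3 * N := by
      rw [hN, Finset.mul_sum]
      refine Finset.sum_le_sum fun l _ => (le_abs_self _).trans ?_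
      rw [abs_mul, abs_mul, hσ1, one_mul, abs_mul, abs_of_pos ht, abs_sub_comm]
      calc _ ≤ t ^ 2 * (K * (‖w‖ * ‖w‖)) * (t * |v l|) := by gcongr; exact hG l
        _ = _ := by ring
    have hsum : t ^ 2 * ∑ l, σ l * v l * Hv l
        = ∑ l, σ l * gradient f (zs + t • w) l * (t * v l)
          + ∑ l, σ l * (t * Hv l - gradient f (zs + t • w) l) * (t * v l) := by
      rw [← Finset.sum_add_distrib, Finset.mul_sum]
      exact Finset.sum_congr rfl fun l _ => by ring
    refine le_of_mul_le_mul_left ?_ (by positivity : 0 < t ^ 2)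
    nlinarith
  refine le_of_forall_pos_le_add fun ε hε => ?_
  have hN0 : 0 ≤ N := Finset.sum_nonneg fun i _ => by positivity
  refine (key (ε / (N + 1)) (by positivity)).trans ?_
  gcongr
  rw [div_mul_eq_mul_div, div_le_iff₀ (by positivity)]
  nlinarith

theorem IsDissipative.mulVec_eq_zero {ι : Type*} [Fintype ι] {g : ι → ℝ} (hg : ∀ i, 0 < g i)
    {A : Matrix ι ι ℝ} (hA : IsDissipative g A) {v : ι → ℝ} (hv : A *ᵥ v = 0) : v = 0 := by
  have h := hA v
  simp only [hv, Pi.zero_apply, mul_zero, Finset.sum_const_zero] at h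
  have h0 : ∑ i, g i * v i ^ 2 = 0 :=
    le_antisymm (by linarith) (Finset.sum_nonneg fun i _ => mul_nonneg (hg i).le (sq_nonneg _))
  rw [Finset.sum_eq_zero_iff_of_nonneg fun i _ => mul_nonneg (hg i).le (sq_nonneg _)] at h0
  ext i
  have := h0 i (Finset.mem_univ i)
  simpa [(hg i).ne'] using this

/-- Pairing `A X + X Aᵀ` with `X` in the weighted Frobenius inner product applies the
dissipativity of `A` to the columns and to the rows of `X`. -/
theorem isUnit_lyapunov {g : Fin dx ⊕ Fin dy → ℝ} (hg : ∀ i, 0 < g i)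
    {A : Matrix (Fin dx ⊕ Fin dy) (Fin dx ⊕ Fin dy) ℝ} (hA : IsDissipative g A) :
    IsUnit (lyapunov A) := by
  rw [LinearMap.isUnit_iff_ker_eq_bot, LinearMap.ker_eq_bot']
  intro X hX
  have hX' : A * X + X * Aᵀ = 0 := hX
  have hcol : ∑ j, ∑ i, g j * (g i * X i j * (A * X) i j) ≤ -∑ j, ∑ i, g j * (g i * X i j ^ 2) := by
    rw [← Finset.sum_neg_distrib]
    refine Finset.sum_le_sum fun j _ => ?_
    rw [← Finset.mul_sum, ← Finset.mul_sum, ← mul_neg]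
    exact mul_le_mul_of_nonneg_left (hA fun i => X i j) (hg j).le
  have hrow : ∑ i, ∑ j, g i * (g j * X i j * (X * Aᵀ) i j)
      ≤ -∑ i, ∑ j, g i * (g j * X i j ^ 2) := by
    rw [← Finset.sum_neg_distrib]
    refine Finset.sum_le_sum fun i _ => ?_
    rw [← Finset.mul_sum, ← Finset.mul_sum, ← mul_neg]
    refine mul_le_mul_of_nonneg_left (le_trans (le_of_eq ?_) (hA fun j => X i j)) (hg i).le
    refine Finset.sum_congr rfl fun j _ => ?_
    congr 1
    simp [Matrix.mul_apply, Matrix.mulVec, dotProduct, mul_comm]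
  rw [Finset.sum_comm (γ := Fin dx ⊕ Fin dy)] at hcol
  have hzero : ∑ i, ∑ j, g j * (g i * X i j * (A * X) i j)
      + ∑ i, ∑ j, g i * (g j * X i j * (X * Aᵀ) i j) = 0 := by
    rw [← Finset.sum_add_distrib]
    refine Finset.sum_eq_zero fun i _ => ?_
    rw [← Finset.sum_add_distrib]
    refine Finset.sum_eq_zero fun j _ => ?_
    have := congrFun (congrFun hX' i) j
    simp only [Matrix.add_apply, Matrix.zero_apply] at this
    linear_combination g i * g j * X i j * this
  have hnn (i j) : 0 ≤ g i * (g j * X i j ^ 2) :=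
    mul_nonneg (hg i).le (mul_nonneg (hg j).le (sq_nonneg _))
  have hcol0 : 0 ≤ ∑ j, ∑ i, g j * (g i * X i j ^ 2) :=
    Finset.sum_nonneg fun j _ => Finset.sum_nonneg fun i _ =>
      mul_nonneg (hg j).le (mul_nonneg (hg i).le (sq_nonneg _))
  have hrow0 : ∑ i, ∑ j, g i * (g j * X i j ^ 2) = 0 :=
    le_antisymm (by linarith) (Finset.sum_nonneg fun i _ => Finset.sum_nonneg fun j _ => hnn i j)
  rw [Finset.sum_eq_zero_iff_of_nonneg fun i _ => Finset.sum_nonneg fun j _ => hnn i j] at hrow0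
  ext i j
  have h1 := hrow0 i (Finset.mem_univ i)
  rw [Finset.sum_eq_zero_iff_of_nonneg fun j _ => hnn i j] at h1
  have h2 := h1 j (Finset.mem_univ j)
  simpa [(hg i).ne', (hg j).ne'] using h2

theorem weight_pos (hμx : 0 < μx) (hμy : 0 < μy) (i : Fin dx ⊕ Fin dy) :
    0 < weight dx dy μx μy i := by
  rcases i with i | i
  · exact hμx
  · exact hμy

theorem isUnit_hessian_of_isDissipative (hμx : 0 < μx) (hμy : 0 < μy) {zs : ZSpace dx dy}
    (h : IsDissipative (weight dx dy μx μy) (C₀ dx dy μx μy * hessian f zs)) :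
    IsUnit (hessian f zs) := by
  rw [← Matrix.mulVec_injective_iff_isUnit, ← Matrix.coe_mulVecLin, ← LinearMap.ker_eq_bot,
    LinearMap.ker_eq_bot']
  intro v hv
  refine h.mulVec_eq_zero (weight_pos hμx hμy) ?_
  rw [← Matrix.mulVec_mulVec, show hessian f zs *ᵥ v = 0 from hv, Matrix.mulVec_zero]

/-- Entrywise bound of a linear map on matrices. -/
theorem exists_entry_bound {ι κ : Type*} [Fintype ι] [Fintype κ] [DecidableEq κ]
    (Φ : Matrix κ κ ℝ →ₗ[ℝ] Matrix ι ι ℝ) : ∃ K : ℝ, 0 ≤ K ∧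
      ∀ (X : Matrix κ κ ℝ) (c : ℝ), 0 ≤ c → (∀ i j, |X i j| ≤ c) → ∀ i j, |Φ X i j| ≤ K * c := by
  refine ⟨∑ i, ∑ j, ∑ a, ∑ b, |Φ (Matrix.single a b 1) i j|, by positivity,
    fun X c hc hX i j => ?_⟩
  have hexp : Φ X i j = ∑ a, ∑ b, X a b * Φ (Matrix.single a b 1) i j := by
    conv_lhs => rw [Matrix.matrix_eq_sum_single X]
    simp only [map_sum, Matrix.sum_apply]
    refine Finset.sum_congr rfl fun a _ => Finset.sum_congr rfl fun b _ => ?_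
    rw [show Matrix.single a b (X a b) = X a b • Matrix.single a b (1 : ℝ) by
      rw [Matrix.smul_single, smul_eq_mul, mul_one], map_smul]
    rfl
  calc |Φ X i j| ≤ ∑ a, ∑ b, c * |Φ (Matrix.single a b 1) i j| := by
        rw [hexp]
        refine (Finset.abs_sum_le_sum_abs _ _).trans (Finset.sum_le_sum fun a _ =>
          (Finset.abs_sum_le_sum_abs _ _).trans (Finset.sum_le_sum fun b _ => ?_))
        rw [abs_mul]
        exact mul_le_mul_of_nonneg_right (hX a b) (abs_nonneg _)
    _ = (∑ a, ∑ b, |Φ (Matrix.single a b 1) i j|) * c := by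
        simp only [Finset.sum_mul, mul_comm c]
    _ ≤ _ := by
        refine mul_le_mul_of_nonneg_right ?_ hc
        refine le_trans ?_ (Finset.single_le_sum (f := fun i => ∑ j, ∑ a, ∑ b,
          |Φ (Matrix.single a b 1) i j|) (fun i _ => by positivity) (Finset.mem_univ i))
        exact Finset.single_le_sum (f := fun j => ∑ a, ∑ b, |Φ (Matrix.single a b 1) i j|)
          (fun j _ => by positivity) (Finset.mem_univ j)

end LinearAlgebra

/-! ### One iteration as a perturbed explicit step -/

section Step

variable {dx dy : ℕ} {f : ZSpace dx dy → ℝ} {μx μy : ℝ}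

/-- The updated `y` when the errors of the two estimates of `∇_y f` are `w₁` and `w₂`, with
`σ = h / μ_y`. -/
def nextYOf (f : ZSpace dx dy → ℝ) (μy h θ : ℝ) (ξ : ZSpace dx dy × ZSpace dx dy)
    (w₁ w₂ : YSpace dy) : YSpace dy :=
  yPart ξ.1 + (h / μy) • (gradY f ξ.1 + θ • (gradY f ξ.1 - gradY f ξ.2) + ((1 + θ) • w₁ - θ • w₂))

/-- The point `(x_k, y_{k+1})` at which `∇_x f` is estimated. -/
def midPoint (f : ZSpace dx dy → ℝ) (μy h θ : ℝ) (ξ : ZSpace dx dy × ZSpace dx dy)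
    (w₁ w₂ : YSpace dy) : ZSpace dx dy :=
  pair (xPart ξ.1) (nextYOf f μy h θ ξ w₁ w₂)

/-- The next iterate when the errors of the three gradient estimates are `w₀, w₁, w₂`, with
`τ = h / μ_x` and `σ = h / μ_y`. -/
def nextOf (f : ZSpace dx dy → ℝ) (μx μy h θ : ℝ) (ξ : ZSpace dx dy × ZSpace dx dy)
    (w₀ : XSpace dx) (w₁ w₂ : YSpace dy) : ZSpace dx dy :=
  pair (xPart ξ.1 - (h / μx) • (gradX f (midPoint f μy h θ ξ w₁ w₂) + w₀))
    (nextYOf f μy h θ ξ w₁ w₂)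

/-- The weighted squared distance of the current iterate to `z_*` plus the squared length of the
last increment. -/
def lyap (μx μy : ℝ) (zs : ZSpace dx dy) (ξ : ZSpace dx dy × ZSpace dx dy) : ℝ :=
  μx * ‖xPart ξ.1 - xPart zs‖ ^ 2 + μy * ‖yPart ξ.1 - yPart zs‖ ^ 2 + ‖ξ.1 - ξ.2‖ ^ 2

theorem lyap_nonneg (hμx : 0 < μx) (hμy : 0 < μy) (zs : ZSpace dx dy)
    (ξ : ZSpace dx dy × ZSpace dx dy) : 0 ≤ lyap μx μy zs ξ := by
  unfold lyap; positivity

theorem le_lyap (μx μy : ℝ) (zs : ZSpace dx dy)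
    (ξ : ZSpace dx dy × ZSpace dx dy) :
    min μx μy * ‖ξ.1 - zs‖ ^ 2 + ‖ξ.1 - ξ.2‖ ^ 2 ≤ lyap μx μy zs ξ := by
  rw [lyap, norm_sq_eq_add (ξ.1 - zs), xPart_sub, yPart_sub, mul_add]
  gcongr
  · exact min_le_left _ _
  · exact min_le_right _ _

theorem measurable_lyap (μx μy : ℝ) (zs : ZSpace dx dy) : Measurable (lyap μx μy zs) := by
  unfold lyap
  have h1 : Measurable fun ξ : ZSpace dx dy × ZSpace dx dy => xPart ξ.1 :=
    measurable_xPart.comp measurable_fst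
  have h2 : Measurable fun ξ : ZSpace dx dy × ZSpace dx dy => yPart ξ.1 :=
    measurable_yPart.comp measurable_fst
  fun_prop

/-- The martingale part of the increment of `lyap`. -/
def lyapNoise (θ : ℝ) (zs : ZSpace dx dy) (ξ : ZSpace dx dy × ZSpace dx dy)
    (w₀ : XSpace dx) (w₁ w₂ : YSpace dy) : ℝ :=
  2 * (-inner ℝ (xPart ξ.1 - xPart zs) w₀
    + inner ℝ (yPart ξ.1 - yPart zs) ((1 + θ) • w₁ - θ • w₂))

theorem norm_noiseY_le {θ : ℝ} (hθ : θ ∈ Set.Icc (0 : ℝ) 1) (w₁ w₂ : YSpace dy) :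
    ‖(1 + θ) • w₁ - θ • w₂‖ ≤ 2 * (‖w₁‖ + ‖w₂‖) := by
  refine (norm_sub_le _ _).trans ?_
  rw [norm_smul, norm_smul, Real.norm_of_nonneg hθ.1, Real.norm_of_nonneg (by linarith [hθ.1])]
  nlinarith [mul_le_mul_of_nonneg_right hθ.2 (norm_nonneg w₁),
    mul_le_mul_of_nonneg_right hθ.2 (norm_nonneg w₂), norm_nonneg w₁, norm_nonneg w₂]

theorem abs_lyapNoise_le {θ : ℝ} (hθ : θ ∈ Set.Icc (0 : ℝ) 1) (zs : ZSpace dx dy)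
    (ξ : ZSpace dx dy × ZSpace dx dy) (w₀ : XSpace dx) (w₁ w₂ : YSpace dy) :
    |lyapNoise θ zs ξ w₀ w₁ w₂| ≤ 4 * ‖ξ.1 - zs‖ * (‖w₀‖ + ‖w₁‖ + ‖w₂‖) := by
  have hx := norm_xPart_le (ξ.1 - zs)
  have hy := norm_yPart_le (ξ.1 - zs)
  rw [xPart_sub] at hx
  rw [yPart_sub] at hy
  have h1 := abs_real_inner_le_norm (xPart ξ.1 - xPart zs) w₀
  have h2 := abs_real_inner_le_norm (yPart ξ.1 - yPart zs) ((1 + θ) • w₁ - θ • w₂)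
  have h3 := norm_noiseY_le hθ w₁ w₂
  have h4 : ‖xPart ξ.1 - xPart zs‖ * ‖w₀‖ ≤ ‖ξ.1 - zs‖ * ‖w₀‖ := by gcongr
  have h5 : ‖yPart ξ.1 - yPart zs‖ * ‖(1 + θ) • w₁ - θ • w₂‖
      ≤ ‖ξ.1 - zs‖ * (2 * (‖w₁‖ + ‖w₂‖)) := by gcongr
  rw [lyapNoise, abs_mul, abs_two]
  have h6 := abs_add_le (-inner ℝ (xPart ξ.1 - xPart zs) w₀)
    (inner ℝ (yPart ξ.1 - yPart zs) ((1 + θ) • w₁ - θ • w₂))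
  rw [abs_neg] at h6
  nlinarith [mul_nonneg (norm_nonneg (ξ.1 - zs)) (norm_nonneg w₀)]

/-- One iteration moves the iterate by `O(h)` times the current errors. -/
theorem IsAdmissibleObjective.exists_increment_bound (hf : IsAdmissibleObjective f μx μy)
    (hμx : 0 < μx) (hμy : 0 < μy) {zs : ZSpace dx dy} (hzs : IsSaddlePoint f zs) :
    ∃ K : ℝ, 0 ≤ K ∧ ∀ h ∈ Set.Icc (0 : ℝ) 1, ∀ θ ∈ Set.Icc (0 : ℝ) 1, ∀ ξ w₀ w₁ w₂,
      ‖nextOf f μx μy h θ ξ w₀ w₁ w₂ - ξ.1‖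
        ≤ K * h * (‖ξ.1 - zs‖ + ‖ξ.1 - ξ.2‖ + (‖w₀‖ + ‖w₁‖ + ‖w₂‖)) := by
  obtain ⟨L, hL0, hLx, hLy⟩ := hf.exists_lipschitz
  have h0 := gradient_eq_zero_of_isSaddlePoint hf.differentiable hzs
  have hgx : gradX f zs = 0 := by rw [gradX, h0]; rfl
  have hgy : gradY f zs = 0 := by rw [gradY, h0]; rfl
  set K₁ : ℝ := 1 / μy * (L + 2) with hK₁
  have hK₁0 : 0 ≤ K₁ := by positivity
  refine ⟨1 / μx * (L + 1) * (1 + K₁) + K₁, by positivity, fun h hh θ hθ ξ w₀ w₁ w₂ => ?_⟩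
  set S := ‖ξ.1 - zs‖ + ‖ξ.1 - ξ.2‖ + (‖w₀‖ + ‖w₁‖ + ‖w₂‖) with hS
  have hS0 : 0 ≤ S := by positivity
  have n1 := norm_nonneg (ξ.1 - zs)
  have n2 := norm_nonneg (ξ.1 - ξ.2)
  have n3 := norm_nonneg w₀
  have n4 := norm_nonneg w₁
  have n5 := norm_nonneg w₂
  set y' := nextYOf f μy h θ ξ w₁ w₂ with hy'
  have hyn : ‖y' - yPart ξ.1‖ ≤ K₁ * h * S := by
    have hA : ‖gradY f ξ.1‖ ≤ L * ‖ξ.1 - zs‖ := by simpa [hgy] using hLy ξ.1 zs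
    have hB : ‖θ • (gradY f ξ.1 - gradY f ξ.2)‖ ≤ L * ‖ξ.1 - ξ.2‖ := by
      rw [norm_smul, Real.norm_of_nonneg hθ.1]
      exact (mul_le_of_le_one_left (norm_nonneg _) hθ.2).trans (hLy _ _)
    have hC := norm_noiseY_le hθ w₁ w₂
    rw [hy', nextYOf, add_sub_cancel_left, norm_smul,
      Real.norm_of_nonneg (div_nonneg hh.1 hμy.le)]
    calc _ ≤ h / μy * ((L + 2) * S) := by
          refine mul_le_mul_of_nonneg_left ?_ (div_nonneg hh.1 hμy.le)
          refine (norm_add₃_le).trans ((add_le_add (add_le_add hA hB) hC).trans ?_)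
          rw [hS]
          nlinarith [mul_nonneg hL0 n3, mul_nonneg hL0 n4, mul_nonneg hL0 n5]
      _ = _ := by rw [hK₁]; ring
  have hmid : ‖midPoint f μy h θ ξ w₁ w₂ - ξ.1‖ = ‖y' - yPart ξ.1‖ := by
    conv_lhs => rw [midPoint, ← hy', ← pair_xPart_yPart ξ.1, pair_sub_pair]
    simp [norm_pair_zero_left]
  have hxn : ‖(h / μx) • (gradX f (midPoint f μy h θ ξ w₁ w₂) + w₀)‖
      ≤ 1 / μx * (L + 1) * (1 + K₁) * h * S := by
    have hA : ‖gradX f (midPoint f μy h θ ξ w₁ w₂)‖ ≤ L * (‖y' - yPart ξ.1‖ + ‖ξ.1 - zs‖) := by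
      have := hLx (midPoint f μy h θ ξ w₁ w₂) zs
      rw [hgx, sub_zero] at this
      refine this.trans (mul_le_mul_of_nonneg_left ?_ hL0)
      rw [← hmid]
      exact norm_sub_le_norm_sub_add_norm_sub _ _ _
    have hy1 : ‖y' - yPart ξ.1‖ ≤ K₁ * S := hyn.trans (by
      have : K₁ * h * S = h * (K₁ * S) := by ring
      rw [this]
      exact mul_le_of_le_one_left (by positivity) hh.2)
    rw [norm_smul, Real.norm_of_nonneg (div_nonneg hh.1 hμx.le)]
    calc _ ≤ h / μx * ((L + 1) * (1 + K₁) * S) := by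
          refine mul_le_mul_of_nonneg_left ?_ (div_nonneg hh.1 hμx.le)
          refine (norm_add_le _ _).trans ?_
          have h1 : ‖ξ.1 - zs‖ ≤ S := by rw [hS]; linarith
          have h2 : ‖w₀‖ ≤ S := by rw [hS]; linarith
          have h3 : L * (‖y' - yPart ξ.1‖ + ‖ξ.1 - zs‖) ≤ L * (K₁ * S + S) := by gcongr
          nlinarith [mul_nonneg hK₁0 hS0]
      _ = _ := by ring
  refine (norm_le_norm_xPart_add_norm_yPart _).trans ?_
  rw [xPart_sub, yPart_sub, nextOf, xPart_pair, yPart_pair, ← hy', sub_sub_cancel_left, norm_neg]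
  linarith

/-- One-step contraction of `lyap` up to a martingale part and a noise term of order `h²`. The
drift contracts the squared distance to `z_*` by `1 - 2 h`, and half of this gain pays for the
error terms. Those with the lag `‖z_k - z_{k-1}‖` are absorbed by the second summand of `lyap`:
after the iteration it is the squared length of the increment, of order `h²`. -/
theorem IsAdmissibleObjective.exists_lyap_drift (hf : IsAdmissibleObjective f μx μy)
    (hμx : 0 < μx) (hμy : 0 < μy) {zs : ZSpace dx dy} (hzs : IsSaddlePoint f zs) :
    ∃ h₀ ∈ Set.Ioc (0 : ℝ) 1, ∃ K : ℝ, 0 ≤ K ∧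
      ∀ h ∈ Set.Ioc (0 : ℝ) h₀, ∀ θ ∈ Set.Icc (0 : ℝ) 1, ∀ ξ w₀ w₁ w₂,
      lyap μx μy zs (nextOf f μx μy h θ ξ w₀ w₁ w₂, ξ.1)
        ≤ (1 - h) * lyap μx μy zs ξ + h * lyapNoise θ zs ξ w₀ w₁ w₂
          + h ^ 2 * (K * (‖w₀‖ + ‖w₁‖ + ‖w₂‖) ^ 2) := by
  obtain ⟨L, hL0, hLx, hLy⟩ := hf.exists_lipschitz
  obtain ⟨K₁, hK₁0, hK₁⟩ := hf.exists_increment_bound hμx hμy hzs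
  set μ := min μx μy with hμ
  have hμ0 : 0 < μ := lt_min hμx hμy
  set K₂ : ℝ := 3 * (2 * L * K₁ + (μx + μy + 1) * K₁ ^ 2) with hK₂
  have hK₂0 : 0 ≤ K₂ := by positivity
  set K₃ : ℝ := 2 * L ^ 2 / μ with hK₃
  have hK₃0 : 0 ≤ K₃ := by positivity
  -- the first bound on `h` absorbs the terms in the lag, the second those in the distance to `z_*`
  refine ⟨min (1 / (1 + K₃ + K₂)) (μ / (2 * K₂ + μ)), ⟨by positivity, min_le_of_left_le ?_⟩, K₂,
    hK₂0, fun h hh θ hθ ξ w₀ w₁ w₂ => ?_⟩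
  · rw [div_le_one (by positivity)]; linarith
  have hh0 : 0 < h := hh.1
  have hhA : h * (1 + K₃ + K₂) ≤ 1 := by
    have := hh.2.trans (min_le_left _ _)
    rwa [le_div_iff₀ (by positivity)] at this
  have hhB : h * K₂ ≤ μ / 2 := by
    have := hh.2.trans (min_le_right _ _)
    rw [le_div_iff₀ (by positivity)] at this
    nlinarith
  have hh1 : h ≤ 1 := le_trans (le_mul_of_one_le_right hh0.le (by linarith only [hK₂0, hK₃0])) hhA
  set a := ‖ξ.1 - zs‖ with ha
  set b := ‖ξ.1 - ξ.2‖ with hb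
  set n := ‖w₀‖ + ‖w₁‖ + ‖w₂‖ with hn
  have ha0 : 0 ≤ a := norm_nonneg _
  have hb0 : 0 ≤ b := norm_nonneg _
  have hn0 : 0 ≤ n := by positivity
  set zn := nextOf f μx μy h θ ξ w₀ w₁ w₂ with hzn
  set zm := midPoint f μy h θ ξ w₁ w₂ with hzm
  have hd : ‖zn - ξ.1‖ ≤ K₁ * h * (a + b + n) := hK₁ h ⟨hh0.le, hh1⟩ θ hθ ξ w₀ w₁ w₂
  set X := xPart ξ.1 - xPart zs with hX
  set Y := yPart ξ.1 - yPart zs with hY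
  set Dx := xPart zn - xPart ξ.1 with hDx
  set Dy := yPart zn - yPart ξ.1 with hDy
  have hXa : ‖X‖ ≤ a := norm_xPart_le (ξ.1 - zs)
  have hYa : ‖Y‖ ≤ a := norm_yPart_le (ξ.1 - zs)
  have hDy' : ‖Dy‖ ≤ ‖zn - ξ.1‖ := norm_yPart_le (zn - ξ.1)
  have hDx' : ‖Dx‖ ≤ ‖zn - ξ.1‖ := norm_xPart_le (zn - ξ.1)
  have hDxe : Dx = -((h / μx) • (gradX f zm + w₀)) := by
    rw [hDx, hzn, nextOf, xPart_pair, sub_sub_cancel_left]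
  have hDye : Dy = (h / μy) • (gradY f ξ.1 + θ • (gradY f ξ.1 - gradY f ξ.2)
      + ((1 + θ) • w₁ - θ • w₂)) := by
    rw [hDy, hzn, nextOf, yPart_pair, nextYOf, add_sub_cancel_left]
  have hmid : ‖gradX f zm - gradX f ξ.1‖ ≤ L * (K₁ * h * (a + b + n)) := by
    refine (hLx _ _).trans (mul_le_mul_of_nonneg_left (le_trans (le_of_eq ?_) (hDy'.trans hd)) hL0)
    conv_lhs => rw [hzm, midPoint, ← pair_xPart_yPart ξ.1, pair_sub_pair]
    simp only [xPart_pair, sub_self, norm_pair_zero_left]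
    rfl
  have hlag : ‖gradY f ξ.1 - gradY f ξ.2‖ ≤ L * b := hLy _ _
  -- the two inner products with the increment
  have hinX : μx * inner ℝ X Dx = -(h * (inner ℝ X (gradX f ξ.1)
      + inner ℝ X (gradX f zm - gradX f ξ.1) + inner ℝ X w₀)) := by
    rw [hDxe, inner_neg_right, inner_smul_right, inner_add_right, inner_sub_right]
    field_simp
    ring
  have hinY : μy * inner ℝ Y Dy = h * (inner ℝ Y (gradY f ξ.1)
      + θ * inner ℝ Y (gradY f ξ.1 - gradY f ξ.2)
      + inner ℝ Y ((1 + θ) • w₁ - θ • w₂)) := by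
    rw [hDye, inner_smul_right, inner_add_right, inner_add_right, inner_smul_right]
    field_simp
  have hdiss := hf.dissipative hzs ξ.1
  rw [← hX, ← hY, real_inner_comm X, real_inner_comm Y] at hdiss
  have hI1 : -inner ℝ X (gradX f zm - gradX f ξ.1) ≤ a * (L * (K₁ * h * (a + b + n))) := by
    refine (neg_le_abs _).trans ((abs_real_inner_le_norm _ _).trans ?_)
    gcongr
  have hI2 : θ * inner ℝ Y (gradY f ξ.1 - gradY f ξ.2) ≤ a * (L * b) := by
    have h1 : |inner ℝ Y (gradY f ξ.1 - gradY f ξ.2)| ≤ a * (L * b) :=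
      (abs_real_inner_le_norm _ _).trans (by gcongr)
    calc _ ≤ |θ * inner ℝ Y (gradY f ξ.1 - gradY f ξ.2)| := le_abs_self _
      _ = θ * |inner ℝ Y (gradY f ξ.1 - gradY f ξ.2)| := by rw [abs_mul, abs_of_nonneg hθ.1]
      _ ≤ _ := (mul_le_of_le_one_left (abs_nonneg _) hθ.2).trans h1
  have hexX : ‖xPart zn - xPart zs‖ ^ 2 = ‖X‖ ^ 2 + 2 * inner ℝ X Dx + ‖Dx‖ ^ 2 := by
    rw [← norm_add_sq_real]; congr 2; rw [hX, hDx]; abel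
  have hexY : ‖yPart zn - yPart zs‖ ^ 2 = ‖Y‖ ^ 2 + 2 * inner ℝ Y Dy + ‖Dy‖ ^ 2 := by
    rw [← norm_add_sq_real]; congr 2; rw [hY, hDy]; abel
  have hquad : μx * ‖Dx‖ ^ 2 + μy * ‖Dy‖ ^ 2 + ‖zn - ξ.1‖ ^ 2
      ≤ (μx + μy + 1) * (K₁ * h * (a + b + n)) ^ 2 := by
    have h1 : ‖Dx‖ ^ 2 ≤ (K₁ * h * (a + b + n)) ^ 2 := by gcongr; exact hDx'.trans hd
    have h2 : ‖Dy‖ ^ 2 ≤ (K₁ * h * (a + b + n)) ^ 2 := by gcongr; exact hDy'.trans hd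
    have h3 : ‖zn - ξ.1‖ ^ 2 ≤ (K₁ * h * (a + b + n)) ^ 2 := by gcongr
    have h4 := mul_le_mul_of_nonneg_left h1 hμx.le
    have h5 := mul_le_mul_of_nonneg_left h2 hμy.le
    rw [add_mul, add_mul, one_mul]
    exact add_le_add (add_le_add h4 h5) h3
  have hsq : (a + b + n) ^ 2 ≤ 3 * (a ^ 2 + b ^ 2 + n ^ 2) := by
    linarith only [sq_nonneg (a - b), sq_nonneg (a - n), sq_nonneg (b - n)]
  have hmul : a * (a + b + n) ≤ (a + b + n) ^ 2 := by
    have h1 : 0 ≤ (b + n) * (a + b + n) := by positivity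
    linarith only [h1]
  have hrest : 2 * h * (a * (L * (K₁ * h * (a + b + n))))
      + (μx + μy + 1) * (K₁ * h * (a + b + n)) ^ 2 ≤ h ^ 2 * (K₂ * (a ^ 2 + b ^ 2 + n ^ 2)) := by
    calc _ = h ^ 2 * (2 * L * K₁ * (a * (a + b + n))
            + (μx + μy + 1) * K₁ ^ 2 * (a + b + n) ^ 2) := by ring
      _ ≤ h ^ 2 * (2 * L * K₁ * (3 * (a ^ 2 + b ^ 2 + n ^ 2))
            + (μx + μy + 1) * K₁ ^ 2 * (3 * (a ^ 2 + b ^ 2 + n ^ 2))) := by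
          refine mul_le_mul_of_nonneg_left (add_le_add ?_ ?_) (sq_nonneg h)
          · exact mul_le_mul_of_nonneg_left (hmul.trans hsq) (by positivity)
          · exact mul_le_mul_of_nonneg_left hsq (by positivity)
      _ = _ := by rw [hK₂]; ring
  -- Young's inequality, with half of the contraction spent on the distance to `z_*`
  have hyoung : 2 * (a * (L * b)) ≤ μ / 2 * a ^ 2 + K₃ * b ^ 2 := by
    have h1 : 0 ≤ (μ * a - 2 * L * b) ^ 2 / (2 * μ) := by positivity
    have h2 : (μ * a - 2 * L * b) ^ 2 / (2 * μ)
        = μ / 2 * a ^ 2 + K₃ * b ^ 2 - 2 * (a * (L * b)) := by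
      rw [hK₃]; field_simp; ring
    linarith only [h1, h2]
  have hμa : μ * a ^ 2 ≤ μx * ‖X‖ ^ 2 + μy * ‖Y‖ ^ 2 := by
    have := le_lyap μx μy zs ξ
    rw [lyap] at this
    linarith only [this]
  simp only [lyap, lyapNoise]
  rw [← hX, ← hY, ← hb, hexX, hexY]
  have e1 : h * (2 * (a * (L * b))) ≤ h * (μ / 2 * a ^ 2 + K₃ * b ^ 2) :=
    mul_le_mul_of_nonneg_left hyoung hh0.le
  have e2 : h * (h * K₂) * a ^ 2 ≤ h * (μ / 2) * a ^ 2 := by gcongr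
  have e3 : (h * K₃ + h ^ 2 * K₂ + h) * b ^ 2 ≤ 1 * b ^ 2 := by
    gcongr
    have h1 : h ^ 2 * K₂ ≤ h * K₂ := by
      rw [sq, mul_assoc]
      exact mul_le_of_le_one_left (by positivity) hh1
    linarith only [h1, hhA]
  have e4 := mul_le_mul_of_nonneg_left hdiss hh0.le
  have e5 := mul_le_mul_of_nonneg_left hI1 hh0.le
  have e6 := mul_le_mul_of_nonneg_left hI2 hh0.le
  have e7 := mul_le_mul_of_nonneg_left hμa hh0.le
  linarith only [e1, e2, e3, e4, e5, e6, e7, hquad, hrest, hinX, hinY]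

end Step

/-! ### The gradient errors of one iteration -/

section Noise

variable {dx dy : ℕ} {f : ZSpace dx dy → ℝ} {μx μy : ℝ}
  {Ωx Ωy : Type*} {gx : ZSpace dx dy → Ωx → XSpace dx} {gy : ZSpace dx dy → Ωy → YSpace dy}

/-- The error of the estimate of `∇_x f`, as a function of the state and the sample. -/
def errX (f : ZSpace dx dy → ℝ) (gx : ZSpace dx dy → Ωx → XSpace dx)
    (gy : ZSpace dx dy → Ωy → YSpace dy) (σ θ : ℝ)
    (p : (ZSpace dx dy × ZSpace dx dy) × Ωx × Ωy × Ωy) : XSpace dx :=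
  gx (pair (xPart p.1.1) (nextY gy σ θ p.1 p.2.2)) p.2.1
    - gradX f (pair (xPart p.1.1) (nextY gy σ θ p.1 p.2.2))

/-- The error of the estimate of `∇_y f` at the current iterate. -/
def errY₁ (f : ZSpace dx dy → ℝ) (gy : ZSpace dx dy → Ωy → YSpace dy)
    (p : (ZSpace dx dy × ZSpace dx dy) × Ωx × Ωy × Ωy) : YSpace dy :=
  gy p.1.1 p.2.2.1 - gradY f p.1.1

/-- The error of the estimate of `∇_y f` at the previous iterate. -/
def errY₂ (f : ZSpace dx dy → ℝ) (gy : ZSpace dx dy → Ωy → YSpace dy)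
    (p : (ZSpace dx dy × ZSpace dx dy) × Ωx × Ωy × Ωy) : YSpace dy :=
  gy p.1.2 p.2.2.2 - gradY f p.1.2

/-- The total size of the gradient errors. -/
def errNorm (f : ZSpace dx dy → ℝ) (gx : ZSpace dx dy → Ωx → XSpace dx)
    (gy : ZSpace dx dy → Ωy → YSpace dy) (σ θ : ℝ)
    (p : (ZSpace dx dy × ZSpace dx dy) × Ωx × Ωy × Ωy) : ℝ :=
  ‖errX f gx gy σ θ p‖ + ‖errY₁ f gy p‖ + ‖errY₂ f gy p‖

theorem errNorm_nonneg (σ θ : ℝ) (p : (ZSpace dx dy × ZSpace dx dy) × Ωx × Ωy × Ωy) :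
    0 ≤ errNorm f gx gy σ θ p := by
  unfold errNorm; positivity

theorem nextY_eq_nextYOf (h θ : ℝ) (p : (ZSpace dx dy × ZSpace dx dy) × Ωx × Ωy × Ωy) :
    nextY gy (h / μy) θ p.1 p.2.2 = nextYOf f μy h θ p.1 (errY₁ f gy p) (errY₂ f gy p) := by
  rw [nextY, nextYOf, errY₁, errY₂]
  congr 2
  module

theorem step_eq_nextOf (h θ : ℝ) (p : (ZSpace dx dy × ZSpace dx dy) × Ωx × Ωy × Ωy) :
    step gx gy (h / μx) (h / μy) θ p.1 p.2
      = (nextOf f μx μy h θ p.1 (errX f gx gy (h / μy) θ p) (errY₁ f gy p) (errY₂ f gy p),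
        p.1.1) := by
  rw [step, nextOf, midPoint, ← nextY_eq_nextYOf, errX, add_sub_cancel]

theorem noise_inl (σ θ : ℝ) (p : (ZSpace dx dy × ZSpace dx dy) × Ωx × Ωy × Ωy) (i : Fin dx) :
    noise f gx gy σ θ p.1 p.2 (Sum.inl i) = errX f gx gy σ θ p i := rfl

theorem noise_inr_inl (σ θ : ℝ) (p : (ZSpace dx dy × ZSpace dx dy) × Ωx × Ωy × Ωy)
    (j : Fin dy) : noise f gx gy σ θ p.1 p.2 (Sum.inr (Sum.inl j)) = errY₁ f gy p j := rfl

theorem noise_inr_inr (σ θ : ℝ) (p : (ZSpace dx dy × ZSpace dx dy) × Ωx × Ωy × Ωy)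
    (j : Fin dy) : noise f gx gy σ θ p.1 p.2 (Sum.inr (Sum.inr j)) = errY₂ f gy p j := rfl

theorem abs_noise_le (σ θ : ℝ) (p : (ZSpace dx dy × ZSpace dx dy) × Ωx × Ωy × Ωy)
    (i : Fin dx ⊕ (Fin dy ⊕ Fin dy)) :
    |noise f gx gy σ θ p.1 p.2 i| ≤ errNorm f gx gy σ θ p := by
  have h0 := norm_nonneg (errX f gx gy σ θ p)
  have h1 := norm_nonneg (errY₁ f gy p)
  have h2 := norm_nonneg (errY₂ f gy p)
  rcases i with i | j | j
  · have h := PiLp.norm_apply_le (errX f gx gy σ θ p) i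
    rw [noise_inl, errNorm, ← Real.norm_eq_abs]; linarith
  · have h := PiLp.norm_apply_le (errY₁ f gy p) j
    rw [noise_inr_inl, errNorm, ← Real.norm_eq_abs]; linarith
  · have h := PiLp.norm_apply_le (errY₂ f gy p) j
    rw [noise_inr_inr, errNorm, ← Real.norm_eq_abs]; linarith

variable [MeasurableSpace Ωx] [MeasurableSpace Ωy] {P : Measure Ωx} {Q : Measure (Ωy × Ωy)}

theorem IsAdmissibleObjective.measurable_gradX (hf : IsAdmissibleObjective f μx μy) :
    Measurable (gradX f) := measurable_xPart.comp hf.continuous_gradient.measurable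

theorem IsAdmissibleObjective.measurable_gradY (hf : IsAdmissibleObjective f μx μy) :
    Measurable (gradY f) := measurable_yPart.comp hf.continuous_gradient.measurable

theorem measurable_midPoint (hg : IsAdmissibleOracle f gx gy P Q) (σ θ : ℝ) :
    Measurable fun p : (ZSpace dx dy × ZSpace dx dy) × Ωx × Ωy × Ωy =>
      (pair (xPart p.1.1) (nextY gy σ θ p.1 p.2.2) : ZSpace dx dy) := by
  have hy : Measurable fun p : (ZSpace dx dy × ZSpace dx dy) × Ωx × Ωy × Ωy =>
      nextY gy σ θ p.1 p.2.2 :=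
    (measurable_nextY hg.measurable_gy σ θ).comp
      (f := fun p : (ZSpace dx dy × ZSpace dx dy) × Ωx × Ωy × Ωy => (p.1, p.2.2)) (by fun_prop)
  have hx : Measurable fun p : (ZSpace dx dy × ZSpace dx dy) × Ωx × Ωy × Ωy =>
      xPart p.1.1 := measurable_xPart.comp (by fun_prop)
  exact measurable_pair.comp (hx.prodMk hy)

theorem measurable_errX (hf : IsAdmissibleObjective f μx μy)
    (hg : IsAdmissibleOracle f gx gy P Q) (σ θ : ℝ) : Measurable (errX f gx gy σ θ) :=
  (hg.measurable_gx.comp ((measurable_midPoint hg σ θ).prodMk (by fun_prop))).sub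
    (hf.measurable_gradX.comp (measurable_midPoint hg σ θ))

theorem measurable_errY₁ (hf : IsAdmissibleObjective f μx μy)
    (hg : IsAdmissibleOracle f gx gy P Q) :
    Measurable (errY₁ f gy : (ZSpace dx dy × ZSpace dx dy) × Ωx × Ωy × Ωy → YSpace dy) :=
  (hg.measurable_gy.comp (f := fun p : (ZSpace dx dy × ZSpace dx dy) × Ωx × Ωy × Ωy =>
    (p.1.1, p.2.2.1)) (by fun_prop)).sub (hf.measurable_gradY.comp (by fun_prop))

theorem measurable_errY₂ (hf : IsAdmissibleObjective f μx μy)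
    (hg : IsAdmissibleOracle f gx gy P Q) :
    Measurable (errY₂ f gy : (ZSpace dx dy × ZSpace dx dy) × Ωx × Ωy × Ωy → YSpace dy) :=
  (hg.measurable_gy.comp (f := fun p : (ZSpace dx dy × ZSpace dx dy) × Ωx × Ωy × Ωy =>
    (p.1.2, p.2.2.2)) (by fun_prop)).sub (hf.measurable_gradY.comp (by fun_prop))

theorem measurable_errNorm (hf : IsAdmissibleObjective f μx μy)
    (hg : IsAdmissibleOracle f gx gy P Q) (σ θ : ℝ) : Measurable (errNorm f gx gy σ θ) :=
  ((measurable_errX hf hg σ θ).norm.add (measurable_errY₁ hf hg).norm).add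
    (measurable_errY₂ hf hg).norm

theorem measurable_noise (hf : IsAdmissibleObjective f μx μy)
    (hg : IsAdmissibleOracle f gx gy P Q) (σ θ : ℝ) (i : Fin dx ⊕ (Fin dy ⊕ Fin dy)) :
    Measurable fun p : (ZSpace dx dy × ZSpace dx dy) × Ωx × Ωy × Ωy =>
      noise f gx gy σ θ p.1 p.2 i := by
  have h0 := measurable_errX hf hg σ θ
  have h1 := measurable_errY₁ hf hg
  have h2 := measurable_errY₂ hf hg
  rcases i with i | j | j
  · simp only [noise_inl]; fun_prop
  · simp only [noise_inr_inl]; fun_prop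
  · simp only [noise_inr_inr]; fun_prop

variable [IsProbabilityMeasure P] [IsProbabilityMeasure Q]

theorem lintegral_errX_le (hf : IsAdmissibleObjective f μx μy)
    (hg : IsAdmissibleOracle f gx gy P Q) {δ : ℝ}
    (hδ : ∀ z, ∫⁻ ω, ‖gx z ω - gradX f z‖ₑ ^ 4 ∂P ≤ ENNReal.ofReal (δ ^ 4)) (σ θ : ℝ)
    (ξ : ZSpace dx dy × ZSpace dx dy) :
    ∫⁻ ω, ‖errX f gx gy σ θ (ξ, ω)‖ₑ ^ 4 ∂(P.prod Q) ≤ ENNReal.ofReal (δ ^ 4) := by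
  have hm := measurable_errX hf hg σ θ
  have hm' : Measurable fun ω => ‖errX f gx gy σ θ (ξ, ω)‖ₑ ^ 4 :=
    ((hm.comp measurable_prodMk_left).enorm).pow_const 4
  rw [lintegral_prod_symm _ hm'.aemeasurable]
  refine (lintegral_mono (g := fun _ => ENNReal.ofReal (δ ^ 4)) fun ωy => ?_).trans_eq (by simp)
  exact hδ (pair (xPart ξ.1) (nextY gy σ θ ξ ωy))

theorem lintegral_snd_prod {g : Ωy × Ωy → ℝ≥0∞} (hg : Measurable g) :
    ∫⁻ ω, g ω.2 ∂(P.prod Q) = ∫⁻ ω, g ω ∂Q := by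
  rw [lintegral_prod _ (by fun_prop)]
  simp

/-- The fourth moments of the gradient errors are bounded uniformly in the state and in the
parameters. -/
theorem exists_lintegral_errNorm_le (hf : IsAdmissibleObjective f μx μy)
    (hg : IsAdmissibleOracle f gx gy P Q) : ∃ c : ℝ, 0 ≤ c ∧ ∀ σ θ ξ,
      ∫⁻ ω, ENNReal.ofReal (errNorm f gx gy σ θ (ξ, ω) ^ 4) ∂(P.prod Q) ≤ ENNReal.ofReal c := by
  obtain ⟨δ, hδ⟩ := hg.moment
  refine ⟨27 * (δ ^ 4 + δ ^ 4 + δ ^ 4), by positivity, fun σ θ ξ => ?_⟩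
  have hm0 := measurable_errX hf hg σ θ
  have hm1 := measurable_errY₁ (Ωx := Ωx) hf hg
  have hm2 := measurable_errY₂ (Ωx := Ωx) hf hg
  have hpt (ω : Ωx × Ωy × Ωy) : ENNReal.ofReal (errNorm f gx gy σ θ (ξ, ω) ^ 4)
      ≤ 27 * (‖errX f gx gy σ θ (ξ, ω)‖ₑ ^ 4 + ‖errY₁ f gy (ξ, ω)‖ₑ ^ 4
        + ‖errY₂ f gy (ξ, ω)‖ₑ ^ 4) := by
    simp only [← ofReal_norm]
    rw [← ENNReal.ofReal_pow (norm_nonneg _), ← ENNReal.ofReal_pow (norm_nonneg _),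
      ← ENNReal.ofReal_pow (norm_nonneg _), ← ENNReal.ofReal_add (by positivity) (by positivity),
      ← ENNReal.ofReal_add (by positivity) (by positivity),
      show (27 : ℝ≥0∞) = ENNReal.ofReal 27 by norm_num, ← ENNReal.ofReal_mul (by norm_num)]
    refine ENNReal.ofReal_le_ofReal ?_
    rw [errNorm]
    generalize ‖errX f gx gy σ θ (ξ, ω)‖ = a
    generalize ‖errY₁ f gy (ξ, ω)‖ = b
    generalize ‖errY₂ f gy (ξ, ω)‖ = c
    have h1 : (a + b + c) ^ 2 ≤ 3 * (a ^ 2 + b ^ 2 + c ^ 2) := by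
      nlinarith only [sq_nonneg (a - b), sq_nonneg (a - c), sq_nonneg (b - c)]
    calc (a + b + c) ^ 4 = ((a + b + c) ^ 2) ^ 2 := by ring
      _ ≤ (3 * (a ^ 2 + b ^ 2 + c ^ 2)) ^ 2 := by gcongr
      _ ≤ _ := by
        nlinarith only [sq_nonneg (a ^ 2 - b ^ 2), sq_nonneg (a ^ 2 - c ^ 2),
          sq_nonneg (b ^ 2 - c ^ 2)]
  have hY1 : ∫⁻ ω : Ωx × Ωy × Ωy, ‖errY₁ f gy (ξ, ω)‖ₑ ^ 4 ∂(P.prod Q)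
      ≤ ENNReal.ofReal (δ ^ 4) := by
    have hm : Measurable fun ω : Ωy × Ωy => ‖gy ξ.1 ω.1 - gradY f ξ.1‖ₑ ^ 4 := by
      have := hg.measurable_gy.of_uncurry_left (x := ξ.1)
      fun_prop
    exact (lintegral_snd_prod hm).trans_le (hδ ξ.1).2.1
  have hY2 : ∫⁻ ω : Ωx × Ωy × Ωy, ‖errY₂ f gy (ξ, ω)‖ₑ ^ 4 ∂(P.prod Q)
      ≤ ENNReal.ofReal (δ ^ 4) := by
    have hm : Measurable fun ω : Ωy × Ωy => ‖gy ξ.2 ω.2 - gradY f ξ.2‖ₑ ^ 4 := by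
      have := hg.measurable_gy.of_uncurry_left (x := ξ.2)
      fun_prop
    exact (lintegral_snd_prod hm).trans_le (hδ ξ.2).2.2
  calc _ ≤ ∫⁻ ω, 27 * (‖errX f gx gy σ θ (ξ, ω)‖ₑ ^ 4 + ‖errY₁ f gy (ξ, ω)‖ₑ ^ 4
        + ‖errY₂ f gy (ξ, ω)‖ₑ ^ 4) ∂(P.prod Q) := lintegral_mono hpt
    _ = 27 * (∫⁻ ω, ‖errX f gx gy σ θ (ξ, ω)‖ₑ ^ 4 ∂(P.prod Q)
        + ∫⁻ ω : Ωx × Ωy × Ωy, ‖errY₁ f gy (ξ, ω)‖ₑ ^ 4 ∂(P.prod Q)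
        + ∫⁻ ω : Ωx × Ωy × Ωy, ‖errY₂ f gy (ξ, ω)‖ₑ ^ 4 ∂(P.prod Q)) := by
        rw [lintegral_const_mul _ (by fun_prop), lintegral_add_right _ (by fun_prop),
          lintegral_add_right _ (by fun_prop)]
    _ ≤ 27 * (ENNReal.ofReal (δ ^ 4) + ENNReal.ofReal (δ ^ 4) + ENNReal.ofReal (δ ^ 4)) := by
        gcongr
        exact lintegral_errX_le hf hg (fun z => (hδ z).1) σ θ ξ
    _ = _ := by
        rw [← ENNReal.ofReal_add (by positivity) (by positivity),
          ← ENNReal.ofReal_add (by positivity) (by positivity),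
          show (27 : ℝ≥0∞) = ENNReal.ofReal 27 by norm_num, ← ENNReal.ofReal_mul (by norm_num)]

/-- A nonnegative measurable function with bounded lower integral is integrable. -/
theorem integrable_of_lintegral_le {α : Type*} [MeasurableSpace α] {μ : Measure α} {g : α → ℝ}
    (hg : Measurable g) (h0 : ∀ x, 0 ≤ g x) {c : ℝ} (hc : 0 ≤ c)
    (h : ∫⁻ x, ENNReal.ofReal (g x) ∂μ ≤ ENNReal.ofReal c) :
    Integrable g μ ∧ ∫ x, g x ∂μ ≤ c := by
  constructor
  · refine ⟨hg.aestronglyMeasurable, ?_⟩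
    rw [hasFiniteIntegral_iff_ofReal (Filter.Eventually.of_forall h0)]
    exact h.trans_lt ENNReal.ofReal_lt_top
  · rw [integral_eq_lintegral_of_nonneg_ae (Filter.Eventually.of_forall h0)
      hg.aestronglyMeasurable]
    exact ENNReal.toReal_le_of_le_ofReal hc h

/-- A measurable function with `|g| ≤ 1 + w`, `w` integrable, is integrable. -/
theorem integrable_of_norm_le_one_add {α E : Type*} [MeasurableSpace α] [NormedAddCommGroup E]
    {μ : Measure α} [IsFiniteMeasure μ] {g : α → E} {w : α → ℝ}
    (hg : AEStronglyMeasurable g μ) (hw : Integrable w μ) (h : ∀ x, ‖g x‖ ≤ 1 + w x) :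
    Integrable g μ :=
  ((integrable_const 1).add hw).mono' hg (Filter.Eventually.of_forall h)

theorem le_one_add_pow_four {t : ℝ} : t ≤ 1 + t ^ 4 := by
  nlinarith [sq_nonneg (t ^ 2 - 1 / 2), sq_nonneg (t - 1 / 2)]

theorem sq_le_one_add_pow_four {t : ℝ} : t ^ 2 ≤ 1 + t ^ 4 := by
  nlinarith [sq_nonneg (t ^ 2 - 1 / 2)]

theorem integrable_of_lintegral_enorm_pow_four_le {Ω E : Type*} [MeasurableSpace Ω] {μ : Measure Ω}
    [IsFiniteMeasure μ] [NormedAddCommGroup E]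
    [MeasurableSpace E] [BorelSpace E] [SecondCountableTopology E] {g : Ω → E}
    (hg : Measurable g) {d : ℝ} (hd : 0 ≤ d)
    (h4 : ∫⁻ ω, ‖g ω‖ₑ ^ 4 ∂μ ≤ ENNReal.ofReal d) : Integrable g μ := by
  have h1 : Integrable (fun ω => ‖g ω‖ ^ 4) μ := by
    refine (integrable_of_lintegral_le (by fun_prop) (fun ω => by positivity) hd ?_).1
    simpa only [← ofReal_norm, ENNReal.ofReal_pow (norm_nonneg _)] using h4
  exact integrable_of_norm_le_one_add (by fun_prop) h1 fun ω => le_one_add_pow_four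

/-- An unbiased estimate with finite fourth error moment has an error of mean zero. -/
theorem integral_error_eq_zero {Ω E : Type*} [MeasurableSpace Ω] {μ : Measure Ω}
    [IsProbabilityMeasure μ] [NormedAddCommGroup E] [NormedSpace ℝ E] [CompleteSpace E]
    [MeasurableSpace E] [BorelSpace E] [SecondCountableTopology E] {g : Ω → E}
    (hg : Measurable g) {m : E} (hm : ∫ ω, g ω ∂μ = m) {d : ℝ} (hd : 0 ≤ d)
    (h4 : ∫⁻ ω, ‖g ω - m‖ₑ ^ 4 ∂μ ≤ ENNReal.ofReal d) : ∫ ω, (g ω - m) ∂μ = 0 := by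
  have h2 : Integrable (fun ω => g ω - m) μ :=
    integrable_of_lintegral_enorm_pow_four_le (by fun_prop) hd h4
  have h3 : Integrable g μ :=
    (h2.add (integrable_const m)).congr (Filter.Eventually.of_forall fun ω => by simp)
  rw [integral_sub h3 (integrable_const m), hm]
  simp

theorem integral_gx_sub_eq_zero (hg : IsAdmissibleOracle f gx gy P Q) (z : ZSpace dx dy) :
    ∫ ω, (gx z ω - gradX f z) ∂P = 0 := by
  obtain ⟨δ, hδ⟩ := hg.moment
  exact integral_error_eq_zero hg.measurable_gx.of_uncurry_left (hg.unbiased_x z)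
    (by positivity) (hδ z).1

/-- Moment bound for the gradient errors, at all states and for all parameters. -/
def HasErrorBound (f : ZSpace dx dy → ℝ) (gx : ZSpace dx dy → Ωx → XSpace dx)
    (gy : ZSpace dx dy → Ωy → YSpace dy) (P : Measure Ωx) (Q : Measure (Ωy × Ωy)) (c : ℝ) : Prop :=
  0 ≤ c ∧ ∀ σ θ ξ,
    ∫⁻ ω, ENNReal.ofReal (errNorm f gx gy σ θ (ξ, ω) ^ 4) ∂(P.prod Q) ≤ ENNReal.ofReal c

theorem HasErrorBound.integrable {c : ℝ} (hc : HasErrorBound f gx gy P Q c)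
    (hf : IsAdmissibleObjective f μx μy) (hg : IsAdmissibleOracle f gx gy P Q) (σ θ : ℝ)
    (ξ : ZSpace dx dy × ZSpace dx dy) :
    Integrable (fun ω => errNorm f gx gy σ θ (ξ, ω) ^ 4) (P.prod Q) ∧
      ∫ ω, errNorm f gx gy σ θ (ξ, ω) ^ 4 ∂(P.prod Q) ≤ c :=
  integrable_of_lintegral_le
    (((measurable_errNorm hf hg σ θ).comp measurable_prodMk_left).pow_const 4)
    (fun _ => pow_nonneg (errNorm_nonneg σ θ _) 4) hc.1 (hc.2 σ θ ξ)

theorem norm_errX_le (σ θ : ℝ) (p : (ZSpace dx dy × ZSpace dx dy) × Ωx × Ωy × Ωy) :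
    ‖errX f gx gy σ θ p‖ ≤ errNorm f gx gy σ θ p := by
  have h1 := norm_nonneg (errY₁ f gy p)
  have h2 := norm_nonneg (errY₂ f gy p)
  rw [errNorm]; linarith

theorem norm_errY₁_le (σ θ : ℝ) (p : (ZSpace dx dy × ZSpace dx dy) × Ωx × Ωy × Ωy) :
    ‖errY₁ f gy p‖ ≤ errNorm f gx gy σ θ p := by
  have h1 := norm_nonneg (errX f gx gy σ θ p)
  have h2 := norm_nonneg (errY₂ f gy p)
  rw [errNorm]; linarith

theorem norm_errY₂_le (σ θ : ℝ) (p : (ZSpace dx dy × ZSpace dx dy) × Ωx × Ωy × Ωy) :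
    ‖errY₂ f gy p‖ ≤ errNorm f gx gy σ θ p := by
  have h1 := norm_nonneg (errX f gx gy σ θ p)
  have h2 := norm_nonneg (errY₁ f gy p)
  rw [errNorm]; linarith

section FixedState

variable {c : ℝ}

theorem integrable_errX (hc : HasErrorBound f gx gy P Q c) (hf : IsAdmissibleObjective f μx μy)
    (hg : IsAdmissibleOracle f gx gy P Q) (σ θ : ℝ) (ξ : ZSpace dx dy × ZSpace dx dy) :
    Integrable (fun ω => errX f gx gy σ θ (ξ, ω)) (P.prod Q) :=
  integrable_of_norm_le_one_add
    ((measurable_errX hf hg σ θ).comp measurable_prodMk_left).aestronglyMeasurable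
    (hc.integrable hf hg σ θ ξ).1 fun _ => (norm_errX_le σ θ _).trans le_one_add_pow_four

theorem integrable_errY₁ (hc : HasErrorBound f gx gy P Q c) (hf : IsAdmissibleObjective f μx μy)
    (hg : IsAdmissibleOracle f gx gy P Q) (ξ : ZSpace dx dy × ZSpace dx dy) :
    Integrable (fun ω : Ωx × Ωy × Ωy => errY₁ f gy (ξ, ω)) (P.prod Q) :=
  integrable_of_norm_le_one_add
    ((measurable_errY₁ hf hg).comp measurable_prodMk_left).aestronglyMeasurable
    (hc.integrable hf hg 0 0 ξ).1 fun _ => (norm_errY₁_le 0 0 _).trans le_one_add_pow_four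

theorem integrable_errY₂ (hc : HasErrorBound f gx gy P Q c) (hf : IsAdmissibleObjective f μx μy)
    (hg : IsAdmissibleOracle f gx gy P Q) (ξ : ZSpace dx dy × ZSpace dx dy) :
    Integrable (fun ω : Ωx × Ωy × Ωy => errY₂ f gy (ξ, ω)) (P.prod Q) :=
  integrable_of_norm_le_one_add
    ((measurable_errY₂ hf hg).comp measurable_prodMk_left).aestronglyMeasurable
    (hc.integrable hf hg 0 0 ξ).1 fun _ => (norm_errY₂_le 0 0 _).trans le_one_add_pow_four

/-- Given the `y`-samples, the point at which `∇_x f` is estimated is fixed, and the `x`-sample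
is independent of it. -/
theorem integral_errX_eq_zero (hc : HasErrorBound f gx gy P Q c)
    (hf : IsAdmissibleObjective f μx μy)
    (hg : IsAdmissibleOracle f gx gy P Q) (σ θ : ℝ) (ξ : ZSpace dx dy × ZSpace dx dy) :
    ∫ ω, errX f gx gy σ θ (ξ, ω) ∂(P.prod Q) = 0 := by
  rw [integral_prod_symm _ (integrable_errX hc hf hg σ θ ξ)]
  refine integral_eq_zero_of_ae (Filter.Eventually.of_forall fun ωy => ?_)
  exact integral_gx_sub_eq_zero hg (pair (xPart ξ.1) (nextY gy σ θ ξ ωy))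

theorem integral_errY₁_eq_zero (hg : IsAdmissibleOracle f gx gy P Q)
    (ξ : ZSpace dx dy × ZSpace dx dy) :
    ∫ ω : Ωx × Ωy × Ωy, errY₁ f gy (ξ, ω) ∂(P.prod Q) = 0 := by
  obtain ⟨δ, hδ⟩ := hg.moment
  have h := integral_error_eq_zero (μ := Q) (g := fun ω => gy ξ.1 ω.1)
    (hg.measurable_gy.of_uncurry_left.comp measurable_fst) (hg.unbiased_y₁ ξ.1)
    (by positivity) (hδ ξ.1).2.1
  have h2 := integral_fun_snd (μ := P) (ν := Q) fun ω : Ωy × Ωy => gy ξ.1 ω.1 - gradY f ξ.1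
  simp only [errY₁]
  rw [h2, h, smul_zero]

theorem integral_errY₂_eq_zero (hg : IsAdmissibleOracle f gx gy P Q)
    (ξ : ZSpace dx dy × ZSpace dx dy) :
    ∫ ω : Ωx × Ωy × Ωy, errY₂ f gy (ξ, ω) ∂(P.prod Q) = 0 := by
  obtain ⟨δ, hδ⟩ := hg.moment
  have h := integral_error_eq_zero (μ := Q) (g := fun ω => gy ξ.2 ω.2)
    (hg.measurable_gy.of_uncurry_left.comp measurable_snd) (hg.unbiased_y₂ ξ.2)
    (by positivity) (hδ ξ.2).2.2
  have h2 := integral_fun_snd (μ := P) (ν := Q) fun ω : Ωy × Ωy => gy ξ.2 ω.2 - gradY f ξ.2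
  simp only [errY₂]
  rw [h2, h, smul_zero]

theorem integral_noise_eq_zero (hc : HasErrorBound f gx gy P Q c)
    (hf : IsAdmissibleObjective f μx μy) (hg : IsAdmissibleOracle f gx gy P Q) (σ θ : ℝ)
    (ξ : ZSpace dx dy × ZSpace dx dy) (i : Fin dx ⊕ (Fin dy ⊕ Fin dy)) :
    ∫ ω, noise f gx gy σ θ ξ ω i ∂(P.prod Q) = 0 := by
  rcases i with i | j | j
  · have h := (PiLp.proj (𝕜 := ℝ) 2 (fun _ : Fin dx => ℝ) i).integral_comp_comm
      (integrable_errX hc hf hg σ θ ξ)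
    rw [integral_errX_eq_zero hc hf hg, map_zero] at h
    exact h
  · have h := (PiLp.proj (𝕜 := ℝ) 2 (fun _ : Fin dy => ℝ) j).integral_comp_comm
      (integrable_errY₁ hc hf hg ξ)
    rw [integral_errY₁_eq_zero hg, map_zero] at h
    exact h
  · have h := (PiLp.proj (𝕜 := ℝ) 2 (fun _ : Fin dy => ℝ) j).integral_comp_comm
      (integrable_errY₂ hc hf hg ξ)
    rw [integral_errY₂_eq_zero hg, map_zero] at h
    exact h

/-- The martingale part of the increment of `lyap` has conditional mean zero. -/
theorem integral_lyapNoise_eq_zero (hc : HasErrorBound f gx gy P Q c)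
    (hf : IsAdmissibleObjective f μx μy) (hg : IsAdmissibleOracle f gx gy P Q) (σ θ : ℝ)
    (zs : ZSpace dx dy) (ξ : ZSpace dx dy × ZSpace dx dy) :
    Integrable (fun ω => lyapNoise θ zs ξ (errX f gx gy σ θ (ξ, ω)) (errY₁ f gy (ξ, ω))
      (errY₂ f gy (ξ, ω))) (P.prod Q) ∧
    ∫ ω, lyapNoise θ zs ξ (errX f gx gy σ θ (ξ, ω)) (errY₁ f gy (ξ, ω))
      (errY₂ f gy (ξ, ω)) ∂(P.prod Q) = 0 := by
  have hX := integrable_errX hc hf hg σ θ ξ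
  have hY₁ := (integrable_errY₁ hc hf hg ξ).fun_smul (1 + θ)
  have hY₂ := (integrable_errY₂ hc hf hg ξ).fun_smul θ
  have hY : Integrable (fun ω : Ωx × Ωy × Ωy =>
      (1 + θ) • errY₁ f gy (ξ, ω) - θ • errY₂ f gy (ξ, ω)) (P.prod Q) := hY₁.sub hY₂
  have hX' : Integrable (fun ω => -inner ℝ (xPart ξ.1 - xPart zs) (errX f gx gy σ θ (ξ, ω)))
      (P.prod Q) := (hX.const_inner (𝕜 := ℝ) (xPart ξ.1 - xPart zs)).neg
  have hY' := hY.const_inner (𝕜 := ℝ) (yPart ξ.1 - yPart zs)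
  refine ⟨(hX'.add hY').const_mul 2, ?_⟩
  simp only [lyapNoise]
  rw [integral_const_mul, integral_add hX' hY', integral_neg, integral_inner hX,
    integral_inner hY, integral_errX_eq_zero hc hf hg, integral_sub hY₁ hY₂, integral_smul,
    integral_smul, integral_errY₁_eq_zero hg, integral_errY₂_eq_zero hg]
  simp

end FixedState

/-! ### Drift of the squared Lyapunov function -/

/-- Squaring the one-step inequality of `lyap`. -/
theorem sq_le_of_le_add {V V' h m K n a μ : ℝ} (hV : 0 ≤ V) (hV' : 0 ≤ V')
    (hh : h ∈ Set.Ioc (0 : ℝ) 1) (hK : 0 ≤ K) (hμ : 0 < μ) (ha : μ * a ^ 2 ≤ V)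
    (hm : |m| ≤ 4 * a * n)
    (hle : V' ≤ (1 - h) * V + h * m + h ^ 2 * (K * n ^ 2)) :
    V' ^ 2 ≤ (1 - h) * V ^ 2 + 2 * (1 - h) * V * h * m
      + (2 * K + 32 / μ) * (h ^ 2 * V) * n ^ 2 + 2 * K ^ 2 * h ^ 4 * n ^ 4 := by
  have h0 : 0 < h := hh.1
  have h1 : 0 ≤ 1 - h := by linarith [hh.2]
  have hm2 : m ^ 2 ≤ 16 / μ * V * n ^ 2 := by
    have h2 : m ^ 2 ≤ (4 * a * n) ^ 2 := by
      rw [← sq_abs]; gcongr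
    have h3 : μ * a ^ 2 * n ^ 2 ≤ V * n ^ 2 := by gcongr
    have h4 : (4 * a * n) ^ 2 = 16 / μ * (μ * a ^ 2 * n ^ 2) := by field_simp; ring
    calc m ^ 2 ≤ _ := h2
      _ = 16 / μ * (μ * a ^ 2 * n ^ 2) := h4
      _ ≤ 16 / μ * (V * n ^ 2) := by gcongr
      _ = _ := by ring
  set A := (1 - h) * V with hA
  set C := h ^ 2 * (K * n ^ 2) with hC
  have hA0 : 0 ≤ A := mul_nonneg h1 hV
  have hC0 : 0 ≤ C := by positivity
  have e1 : V' ^ 2 ≤ (A + h * m + C) ^ 2 := by gcongr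
  have e2 : (A + h * m + C) ^ 2
      ≤ A ^ 2 + 2 * A * (h * m) + 2 * A * C + 2 * (h * m) ^ 2 + 2 * C ^ 2 := by
    nlinarith only [sq_nonneg (h * m - C)]
  have e3 : A ^ 2 ≤ (1 - h) * V ^ 2 := by
    have : (1 - h) * (1 - h) ≤ (1 - h) * 1 := by gcongr; linarith
    calc A ^ 2 = (1 - h) * (1 - h) * V ^ 2 := by rw [hA]; ring
      _ ≤ (1 - h) * 1 * V ^ 2 := by gcongr
      _ = _ := by ring
  have e4 : 2 * A * C ≤ 2 * V * C := by
    have : A ≤ V := by rw [hA]; exact mul_le_of_le_one_left hV (by linarith)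
    gcongr
  have e5 : 2 * (h * m) ^ 2 ≤ 2 * h ^ 2 * (16 / μ * V * n ^ 2) := by
    rw [mul_pow, ← mul_assoc]; gcongr
  calc V' ^ 2 ≤ (1 - h) * V ^ 2 + 2 * A * (h * m) + 2 * V * C
        + 2 * h ^ 2 * (16 / μ * V * n ^ 2) + 2 * C ^ 2 := by linarith only [e1, e2, e3, e4, e5]
    _ = _ := by rw [hA, hC]; ring

end Noise

section Moments

variable {dx dy : ℕ} {f : ZSpace dx dy → ℝ} {μx μy : ℝ}
  {Ωx Ωy : Type*} [MeasurableSpace Ωx] [MeasurableSpace Ωy]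
  {gx : ZSpace dx dy → Ωx → XSpace dx} {gy : ZSpace dx dy → Ωy → YSpace dy}
  {P : Measure Ωx} {Q : Measure (Ωy × Ωy)} [IsProbabilityMeasure P] [IsProbabilityMeasure Q]

theorem isMarkovKernel_transition (hg : IsAdmissibleOracle f gx gy P Q) (τ σ θ : ℝ) :
    IsMarkovKernel (transition gx gy P Q τ σ θ) :=
  Kernel.IsMarkovKernel.map _ (measurable_step hg.measurable_gx hg.measurable_gy τ σ θ)

/-- Geometric drift of `lyap ^ 2` for small step sizes: after squaring the one-step inequality the
martingale part integrates to zero, and the terms `h² V n²` are absorbed by Young's inequality. -/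
theorem exists_sq_drift (hf : IsAdmissibleObjective f μx μy)
    (hμx : 0 < μx) (hμy : 0 < μy) {zs : ZSpace dx dy} (hzs : IsSaddlePoint f zs)
    (hg : IsAdmissibleOracle f gx gy P Q) :
    ∃ h₀ ∈ Set.Ioc (0 : ℝ) 1, ∃ K : ℝ, 0 ≤ K ∧
      ∀ h ∈ Set.Ioc (0 : ℝ) h₀, ∀ θ ∈ Set.Icc (0 : ℝ) 1, ∀ ξ,
      ∫⁻ ζ, ENNReal.ofReal (lyap μx μy zs ζ ^ 2) ∂(transition gx gy P Q (h / μx) (h / μy) θ ξ)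
        ≤ ENNReal.ofReal ((1 - h / 2) * lyap μx μy zs ξ ^ 2 + K * h ^ 3) := by
  obtain ⟨h₀, hh₀, K, hK0, hK⟩ := hf.exists_lyap_drift hμx hμy hzs
  obtain ⟨c, hc⟩ := exists_lintegral_errNorm_le hf hg
  replace hc : HasErrorBound f gx gy P Q c := hc
  have hc0 := hc.1
  set μ := min μx μy with hμ
  have hμ0 : 0 < μ := lt_min hμx hμy
  set K₁ : ℝ := 2 * K + 32 / μ with hK₁
  have hK₁0 : 0 ≤ K₁ := by positivity
  refine ⟨h₀, hh₀, (K₁ * (1 + c)) ^ 2 / 2 + 2 * K ^ 2 * c, by positivity,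
    fun h hh θ hθ ξ => ?_⟩
  have hh0 : 0 < h := hh.1
  have hh1 : h ≤ 1 := hh.2.trans hh₀.2
  set σ := h / μy with hσ
  set V := lyap μx μy zs ξ with hV
  have hV0 : 0 ≤ V := lyap_nonneg hμx hμy zs ξ
  set n : Ωx × Ωy × Ωy → ℝ := fun ω => errNorm f gx gy σ θ (ξ, ω) with hn
  set m : Ωx × Ωy × Ωy → ℝ := fun ω => lyapNoise θ zs ξ (errX f gx gy σ θ (ξ, ω))
    (errY₁ f gy (ξ, ω)) (errY₂ f gy (ξ, ω)) with hm
  obtain ⟨hn4, hn4c⟩ := hc.integrable hf hg σ θ ξ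
  obtain ⟨hmi, hm0⟩ := integral_lyapNoise_eq_zero hc hf hg σ θ zs ξ
  change Integrable (fun ω => n ω ^ 4) (P.prod Q) at hn4
  change ∫ ω, n ω ^ 4 ∂(P.prod Q) ≤ c at hn4c
  change Integrable m (P.prod Q) at hmi
  change ∫ ω, m ω ∂(P.prod Q) = 0 at hm0
  have hnm : Measurable n := (measurable_errNorm hf hg σ θ).comp measurable_prodMk_left
  have hn2 : Integrable (fun ω => n ω ^ 2) (P.prod Q) :=
    integrable_of_norm_le_one_add (hnm.pow_const 2).aestronglyMeasurable hn4 fun ω => by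
      rw [Real.norm_of_nonneg (sq_nonneg _)]; exact sq_le_one_add_pow_four
  have hn2c : ∫ ω, n ω ^ 2 ∂(P.prod Q) ≤ 1 + c := by
    calc _ ≤ ∫ ω, (1 + n ω ^ 4) ∂(P.prod Q) :=
          integral_mono hn2 ((integrable_const 1).add hn4) fun ω => sq_le_one_add_pow_four
      _ = 1 + ∫ ω, n ω ^ 4 ∂(P.prod Q) := by rw [integral_add (integrable_const 1) hn4]; simp
      _ ≤ 1 + c := by gcongr
  have hpt (ω : Ωx × Ωy × Ωy) : lyap μx μy zs (step gx gy (h / μx) σ θ ξ ω) ^ 2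
      ≤ (1 - h) * V ^ 2 + 2 * (1 - h) * V * h * m ω + K₁ * (h ^ 2 * V) * n ω ^ 2
        + 2 * K ^ 2 * h ^ 4 * n ω ^ 4 := by
    have hle := hK h hh θ hθ ξ (errX f gx gy σ θ (ξ, ω)) (errY₁ f gy (ξ, ω)) (errY₂ f gy (ξ, ω))
    have hstep := step_eq_nextOf (f := f) (gx := gx) (gy := gy) (μx := μx) (μy := μy) h θ (ξ, ω)
    simp only at hstep
    rw [hσ, hstep]
    refine sq_le_of_le_add hV0 (lyap_nonneg hμx hμy zs _) ⟨hh0, hh1⟩ hK0 hμ0 ?_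
      (abs_lyapNoise_le hθ zs ξ _ _ _) hle
    have := le_lyap μx μy zs ξ
    nlinarith [sq_nonneg ‖ξ.1 - ξ.2‖]
  have hi1 : Integrable (fun ω => (1 - h) * V ^ 2 + 2 * (1 - h) * V * h * m ω) (P.prod Q) :=
    (integrable_const _).add (hmi.const_mul _)
  have hi2 : Integrable (fun ω => (1 - h) * V ^ 2 + 2 * (1 - h) * V * h * m ω
      + K₁ * (h ^ 2 * V) * n ω ^ 2) (P.prod Q) := hi1.add (hn2.const_mul _)
  have hi3 : Integrable (fun ω => 2 * K ^ 2 * h ^ 4 * n ω ^ 4) (P.prod Q) := hn4.const_mul _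
  have hi4 : Integrable (fun ω => (1 - h) * V ^ 2 + 2 * (1 - h) * V * h * m ω
      + K₁ * (h ^ 2 * V) * n ω ^ 2 + 2 * K ^ 2 * h ^ 4 * n ω ^ 4) (P.prod Q) := hi2.add hi3
  have hmeas := measurable_step hg.measurable_gx hg.measurable_gy (h / μx) σ θ
  rw [transition_apply hg.measurable_gx hg.measurable_gy,
    lintegral_map ((measurable_lyap μx μy zs).pow_const 2).ennreal_ofReal
      hmeas.of_uncurry_left]
  refine (lintegral_mono fun ω => ENNReal.ofReal_le_ofReal (hpt ω)).trans ?_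
  rw [← ofReal_integral_eq_lintegral_ofReal hi4
    (Filter.Eventually.of_forall fun ω => (sq_nonneg _).trans (hpt ω))]
  refine ENNReal.ofReal_le_ofReal ?_
  rw [integral_add hi2 hi3, integral_add hi1 (hn2.const_mul _),
    integral_add (integrable_const _) (hmi.const_mul _)]
  simp only [integral_const_mul, hm0, integral_const, probReal_univ, smul_eq_mul, one_mul,
    mul_zero, add_zero]
  have e1 : K₁ * (h ^ 2 * V) * ∫ ω, n ω ^ 2 ∂(P.prod Q) ≤ K₁ * (h ^ 2 * V) * (1 + c) := by
    gcongr
  have e2 : 2 * K ^ 2 * h ^ 4 * ∫ ω, n ω ^ 4 ∂(P.prod Q) ≤ 2 * K ^ 2 * h ^ 3 * c := by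
    have : h ^ 4 ≤ h ^ 3 := pow_le_pow_of_le_one hh0.le hh1 (by norm_num)
    gcongr
  have e3 : K₁ * (h ^ 2 * V) * (1 + c) ≤ h / 2 * V ^ 2 + (K₁ * (1 + c)) ^ 2 / 2 * h ^ 3 := by
    nlinarith only [mul_nonneg hh0.le (sq_nonneg (V - K₁ * (1 + c) * h))]
  linarith only [e1, e2, e3]

/-- The drift of `lyap ^ 2` and continuity of the transition density give an invariant law. -/
theorem exists_invariant_transition {zs : ZSpace dx dy} (hμx : 0 < μx) (hμy : 0 < μy)
    (hg : IsAdmissibleOracle f gx gy P Q) {τ σ θ a b : ℝ} (ha : a ∈ Set.Ioc (0 : ℝ) 1) (hb : 0 ≤ b)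
    (hdrift : ∀ ξ, ∫⁻ ζ, ENNReal.ofReal (lyap μx μy zs ζ ^ 2) ∂(transition gx gy P Q τ σ θ ξ)
      ≤ ENNReal.ofReal ((1 - a) * lyap μx μy zs ξ ^ 2 + b))
    (hdens : HasContinuousDensity (transition gx gy P Q τ σ θ)) :
    ∃ π : Measure (ZSpace dx dy × ZSpace dx dy), IsProbabilityMeasure π ∧
      (transition gx gy P Q τ σ θ).Invariant π := by
  have := isMarkovKernel_transition hg τ σ θ
  have hmeas := measurable_step hg.measurable_gx hg.measurable_gy τ σ θ
  have hcont := continuous_of_continuousDensity hdens fun ξ => by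
    rw [transition_apply hg.measurable_gx hg.measurable_gy,
      Measure.map_map measurable_fst hmeas.of_uncurry_left,
      Measure.map_map (by fun_prop) (measurable_fst.comp hmeas.of_uncurry_left)]
    rfl
  set μ := min μx μy with hμ
  have hμ0 : 0 < μ := lt_min hμx hμy
  refine exists_invariant_of_drift hcont ((measurable_lyap μx μy zs).pow_const 2)
    (fun ξ => sq_nonneg _) (c := min 1 (μ ^ 2)) (m₀ := min 1 (μ ^ 2) * (2 + ‖zs‖)) (by positivity)
    (fun ξ => ?_) ha.1 ha.2 hb hdrift
  set A := ‖ξ.1 - zs‖ with hA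
  set B := ‖ξ.1 - ξ.2‖ with hB
  have hA0 : 0 ≤ A := norm_nonneg _
  have hB0 : 0 ≤ B := norm_nonneg _
  have h1 : ‖ξ‖ ≤ A + B + ‖zs‖ := by
    rw [Prod.norm_def]
    refine max_le ?_ ?_
    · have := norm_le_norm_sub_add ξ.1 zs
      linarith
    · have e1 := norm_le_norm_sub_add ξ.1 zs
      have e2 := norm_le_norm_sub_add ξ.2 ξ.1
      rw [norm_sub_rev] at e2
      linarith
  have h2 : A ≤ 1 + A ^ 4 := le_one_add_pow_four
  have h3 : B ≤ 1 + B ^ 4 := le_one_add_pow_four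
  have h4 : μ ^ 2 * A ^ 4 + B ^ 4 ≤ lyap μx μy zs ξ ^ 2 := by
    have h5 := le_lyap μx μy zs ξ
    calc _ ≤ (μ * A ^ 2 + B ^ 2) ^ 2 := by
          have : 0 ≤ μ * A ^ 2 * B ^ 2 := by positivity
          nlinarith only [this]
      _ ≤ _ := by gcongr
  have h6 : min 1 (μ ^ 2) * A ^ 4 ≤ μ ^ 2 * A ^ 4 := by gcongr; exact min_le_right _ _
  have h7 : min 1 (μ ^ 2) * B ^ 4 ≤ 1 * B ^ 4 := by gcongr; exact min_le_left _ _
  calc min 1 (μ ^ 2) * ‖ξ‖ ≤ min 1 (μ ^ 2) * (1 + A ^ 4 + (1 + B ^ 4) + ‖zs‖) := by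
        gcongr; linarith
    _ ≤ _ := by nlinarith only [h4, h6, h7]

/-- In stationarity, the state after one iteration has the law of the state before it. -/
theorem map_step_of_invariant (hg : IsAdmissibleOracle f gx gy P Q) {τ σ θ : ℝ}
    {π : Measure (ZSpace dx dy × ZSpace dx dy)} [IsProbabilityMeasure π]
    (hπ : (transition gx gy P Q τ σ θ).Invariant π) :
    (π.prod (P.prod Q)).map (fun p => step gx gy τ σ θ p.1 p.2) = π := by
  have hmeas := measurable_step hg.measurable_gx hg.measurable_gy τ σ θ
  have hmeas' : Measurable fun p : (ZSpace dx dy × ZSpace dx dy) × Ωx × Ωy × Ωy =>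
    step gx gy τ σ θ p.1 p.2 := hmeas
  conv_rhs => rw [← hπ.def]
  ext s hs
  rw [Measure.map_apply hmeas' hs, Measure.bind_apply hs (Kernel.aemeasurable _),
    Measure.prod_apply (hmeas' hs)]
  refine lintegral_congr fun ξ => ?_
  rw [transition_apply hg.measurable_gx hg.measurable_gy,
    Measure.map_apply hmeas.of_uncurry_left hs]
  rfl

end Moments

/-! ### Second moments under a small linear step -/

section Scale

/-- The common dominating function of the stationary quantities. In stationarity the error `a` of
the iterate has size `k = √h`, the increments `s` and `d` have size `k²`, and the noise `n` has
size `1`. -/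
def scaleFn (k a s d n : ℝ) : ℝ := 1 + (a / k) ^ 4 + (s / k ^ 2) ^ 2 + (d / k ^ 2) ^ 2 + n ^ 4

theorem scaleFn_nonneg (k a s d n : ℝ) : 0 ≤ scaleFn k a s d n := by
  unfold scaleFn; positivity

/-- Every monomial in `a, s, d, n` that occurs in the expansion is bounded by its size times the
dominating function. -/
theorem le_scaleFn {k a s d n : ℝ} (hk : k ∈ Set.Ioc (0 : ℝ) 1) :
    (a ≤ k * scaleFn k a s d n ∧ a ^ 2 ≤ k ^ 2 * scaleFn k a s d n ∧
      a ^ 3 ≤ k ^ 3 * scaleFn k a s d n) ∧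
    (a * s ≤ k ^ 3 * scaleFn k a s d n ∧ a * d ≤ k ^ 3 * scaleFn k a s d n ∧
      s ^ 2 ≤ k ^ 4 * scaleFn k a s d n ∧ d ^ 2 ≤ k ^ 4 * scaleFn k a s d n) ∧
    (n ≤ scaleFn k a s d n ∧ n ^ 2 ≤ scaleFn k a s d n ∧ n * a ≤ k * scaleFn k a s d n ∧
      n * s ≤ k ^ 2 * scaleFn k a s d n ∧ n * d ≤ k ^ 2 * scaleFn k a s d n) ∧
    (s ≤ k ^ 2 * scaleFn k a s d n ∧ d ≤ k ^ 2 * scaleFn k a s d n) := by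
  have hk0 : 0 < k := hk.1
  obtain ⟨α, hα⟩ : ∃ α, α = a / k := ⟨_, rfl⟩
  obtain ⟨β, hβ⟩ : ∃ β, β = s / k ^ 2 := ⟨_, rfl⟩
  obtain ⟨γ, hγ⟩ : ∃ γ, γ = d / k ^ 2 := ⟨_, rfl⟩
  have ha : a = k * α := by rw [hα]; field_simp
  have hs : s = k ^ 2 * β := by rw [hβ]; field_simp
  have hd : d = k ^ 2 * γ := by rw [hγ]; field_simp
  have hΘ : scaleFn k a s d n = 1 + α ^ 4 + β ^ 2 + γ ^ 2 + n ^ 4 := by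
    rw [scaleFn, hα, hβ, hγ]
  rw [hΘ, ha, hs, hd]
  have p1 : α ≤ 1 + α ^ 4 := le_one_add_pow_four
  have p2 : α ^ 2 ≤ 1 / 2 * (1 + α ^ 4) := by nlinarith only [sq_nonneg (α ^ 2 - 1)]
  have p3 : α ^ 3 ≤ 1 + α ^ 4 := by
    nlinarith only [sq_nonneg (α ^ 2 - α / 2), sq_nonneg (α - 1), sq_nonneg (α ^ 2 - 1),
      sq_nonneg α, p2]
  have q1 : n ≤ 1 + n ^ 4 := le_one_add_pow_four
  have q2 : n ^ 2 ≤ 1 / 2 * (1 + n ^ 4) := by nlinarith only [sq_nonneg (n ^ 2 - 1)]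
  have sβ := sq_nonneg β
  have sγ := sq_nonneg γ
  have sα : 0 ≤ α ^ 4 := by positivity
  have sn : 0 ≤ n ^ 4 := by positivity
  have r1 : α * β ≤ 1 / 2 * (α ^ 2 + β ^ 2) := by nlinarith only [sq_nonneg (α - β)]
  have r2 : α * γ ≤ 1 / 2 * (α ^ 2 + γ ^ 2) := by nlinarith only [sq_nonneg (α - γ)]
  have r3 : n * α ≤ 1 / 2 * (n ^ 2 + α ^ 2) := by nlinarith only [sq_nonneg (n - α)]
  have r4 : n * β ≤ 1 / 2 * (n ^ 2 + β ^ 2) := by nlinarith only [sq_nonneg (n - β)]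
  have r5 : n * γ ≤ 1 / 2 * (n ^ 2 + γ ^ 2) := by nlinarith only [sq_nonneg (n - γ)]
  have t1 : β ≤ 1 / 2 * (1 + β ^ 2) := by nlinarith only [sq_nonneg (β - 1)]
  have t2 : γ ≤ 1 / 2 * (1 + γ ^ 2) := by nlinarith only [sq_nonneg (γ - 1)]
  set T := 1 + α ^ 4 + β ^ 2 + γ ^ 2 + n ^ 4 with hT
  have key {x y c : ℝ} (hc : 0 ≤ c) (hxy : x = c * y) (hy : y ≤ T) : x ≤ c * T := by
    rw [hxy]; gcongr
  refine ⟨⟨?_, ?_, ?_⟩, ⟨?_, ?_, ?_, ?_⟩, ⟨?_, ?_, ?_, ?_, ?_⟩, ⟨?_, ?_⟩⟩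
  · exact key hk0.le (y := α) rfl (by linarith)
  · exact key (by positivity) (y := α ^ 2) (by ring) (by linarith)
  · exact key (by positivity) (y := α ^ 3) (by ring) (by linarith)
  · exact key (by positivity) (y := α * β) (by ring) (by linarith)
  · exact key (by positivity) (y := α * γ) (by ring) (by linarith)
  · exact key (by positivity) (y := β ^ 2) (by ring) (by linarith)
  · exact key (by positivity) (y := γ ^ 2) (by ring) (by linarith)
  · linarith
  · linarith
  · exact key hk0.le (y := n * α) (by ring) (by linarith)
  · exact key (by positivity) (y := n * β) (by ring) (by linarith)
  · exact key (by positivity) (y := n * γ) (by ring) (by linarith)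
  · exact key (by positivity) (y := β) (by ring) (by linarith)
  · exact key (by positivity) (y := γ) (by ring) (by linarith)

variable {Ω : Type*} [MeasurableSpace Ω] {μ : Measure Ω} {Θ : Ω → ℝ} {K₀ : ℝ}

theorem integrable_of_abs_le {X : Ω → ℝ} {C : ℝ} (hX : Measurable X) (hΘ : Integrable Θ μ)
    (h : ∀ ω, |X ω| ≤ C * Θ ω) : Integrable X μ :=
  (hΘ.const_mul C).mono' hX.aestronglyMeasurable (Filter.Eventually.of_forall h)

theorem abs_integral_le_of_abs_le {X : Ω → ℝ} {C : ℝ} (hC : 0 ≤ C) (hΘ : Integrable Θ μ)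
    (hK : ∫ ω, Θ ω ∂μ ≤ K₀) (h : ∀ ω, |X ω| ≤ C * Θ ω) : |∫ ω, X ω ∂μ| ≤ C * K₀ := by
  have h1 := norm_integral_le_of_norm_le (f := X) (hΘ.const_mul C) (Filter.Eventually.of_forall h)
  rw [integral_const_mul] at h1
  exact h1.trans (by gcongr)

/-- Let `E` be a stationary vector with increment `D = k² (A E + N + R)`, with small remainder `R`
and noise `N` uncorrelated with `E`. Then the second moments of `E` solve a Lyapunov equation
up to `O(k³)`. -/
theorem abs_lyapunov_secondMoment_le {ι : Type*} [Fintype ι] {A : Matrix ι ι ℝ} {k K : ℝ}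
    (hk : k ∈ Set.Ioc (0 : ℝ) 1) (hK : 0 ≤ K)
    {a s d n : Ω → ℝ} (ha : ∀ ω, 0 ≤ a ω)
    (hn : ∀ ω, 0 ≤ n ω) (hΘ : Integrable (fun ω => scaleFn k (a ω) (s ω) (d ω) (n ω)) μ)
    (hK₀ : ∫ ω, scaleFn k (a ω) (s ω) (d ω) (n ω) ∂μ ≤ K₀)
    {E D N R : Ω → ι → ℝ} (hE : ∀ i, Measurable fun ω => E ω i)
    (hN : ∀ i, Measurable fun ω => N ω i)
    (hR : ∀ i, Measurable fun ω => R ω i)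
    (hDR : ∀ ω i, D ω i = k ^ 2 * ((A *ᵥ E ω) i + N ω i + R ω i))
    (hEa : ∀ ω i, |E ω i| ≤ a ω) (hNn : ∀ ω i, |N ω i| ≤ K * n ω)
    (hRb : ∀ ω i, |R ω i| ≤ K * (a ω ^ 2 + s ω + d ω))
    (hVb : ∀ ω i, |(A *ᵥ E ω) i + R ω i| ≤ K * (a ω + s ω + d ω))
    (hNE : ∀ i j, ∫ ω, N ω i * E ω j ∂μ = 0)
    (hstat : ∀ i j, ∫ ω, (E ω i + D ω i) * (E ω j + D ω j) ∂μ = ∫ ω, E ω i * E ω j ∂μ) (i j : ι) :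
    |(A * Matrix.of (fun i j => ∫ ω, E ω i * E ω j ∂μ)
        + Matrix.of (fun i j => ∫ ω, E ω i * E ω j ∂μ) * Aᵀ) i j
      + k ^ 2 * ∫ ω, N ω i * N ω j ∂μ| ≤ (6 * K + 15 * K ^ 2) * k ^ 3 * K₀ := by
  have hk0 : 0 < k := hk.1
  set T : Ω → ℝ := fun ω => scaleFn k (a ω) (s ω) (d ω) (n ω) with hT
  have hT0 (ω) : 0 ≤ T ω := scaleFn_nonneg _ _ _ _ _
  have hle (ω) := le_scaleFn (k := k) (a := a ω) (s := s ω) (d := d ω) (n := n ω) hk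
  set V : Ω → ι → ℝ := fun ω i => (A *ᵥ E ω) i + R ω i with hV
  set X : Ω → ℝ := fun ω => R ω i * E ω j + E ω i * R ω j
    + k ^ 2 * (N ω i * V ω j + V ω i * N ω j + V ω i * V ω j) with hX
  have hVm (i) : Measurable fun ω => V ω i := by
    refine Measurable.add ?_ (hR i)
    simp only [Matrix.mulVec, dotProduct]
    exact Finset.measurable_sum _ fun l _ => (hE l).const_mul _
  have hXm : Measurable X :=
    (((hR i).mul (hE j)).add ((hE i).mul (hR j))).add (((((hN i).mul (hVm j)).add
      ((hVm i).mul (hN j))).add ((hVm i).mul (hVm j))).const_mul _)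
  have hXb (ω) : |X ω| ≤ (6 * K + 15 * K ^ 2) * k ^ 3 * T ω := by
    obtain ⟨⟨l1, l2, l3⟩, ⟨l4, l5, l6, l7⟩, ⟨l8, l9, l10, l11, l12⟩, -⟩ := hle ω
    have hRE (i j) : |R ω i * E ω j| ≤ K * (a ω ^ 2 + s ω + d ω) * a ω := by
      rw [abs_mul]
      exact mul_le_mul (hRb ω i) (hEa ω j) (abs_nonneg _) ((abs_nonneg _).trans (hRb ω i))
    have hNV (i j) : |N ω i * V ω j| ≤ K * n ω * (K * (a ω + s ω + d ω)) := by
      rw [abs_mul]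
      exact mul_le_mul (hNn ω i) (hVb ω j) (abs_nonneg _) ((abs_nonneg _).trans (hNn ω i))
    have hVV (i j) : |V ω i * V ω j| ≤ K * (a ω + s ω + d ω) * (K * (a ω + s ω + d ω)) := by
      rw [abs_mul]
      exact mul_le_mul (hVb ω i) (hVb ω j) (abs_nonneg _) ((abs_nonneg _).trans (hVb ω i))
    have h1 : |X ω| ≤ 2 * (K * (a ω ^ 2 + s ω + d ω) * a ω)
        + k ^ 2 * (2 * (K * n ω * (K * (a ω + s ω + d ω)))
          + K * (a ω + s ω + d ω) * (K * (a ω + s ω + d ω))) := by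
      have e1 := hRE i j
      have e2 := hRE j i
      have e3 := hNV i j
      have e4 := hNV j i
      have e5 := hVV i j
      rw [mul_comm] at e2 e4
      refine (abs_add_le _ _).trans (add_le_add ((abs_add_le _ _).trans (by linarith)) ?_)
      rw [abs_mul, abs_of_nonneg (sq_nonneg k)]
      refine mul_le_mul_of_nonneg_left ?_ (sq_nonneg k)
      exact (abs_add_le _ _).trans (add_le_add ((abs_add_le _ _).trans (by linarith)) e5)
    have hkT : k ^ 4 * T ω ≤ k * T ω := by
      have : k ^ 4 ≤ k ^ 1 := pow_le_pow_of_le_one hk0.le hk.2 (by norm_num)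
      rw [pow_one] at this
      exact mul_le_mul_of_nonneg_right this (hT0 ω)
    have hkT2 : k ^ 2 * T ω ≤ k * T ω := by
      have : k ^ 2 ≤ k ^ 1 := pow_le_pow_of_le_one hk0.le hk.2 (by norm_num)
      rw [pow_one] at this
      exact mul_le_mul_of_nonneg_right this (hT0 ω)
    have h2 : (a ω ^ 2 + s ω + d ω) * a ω ≤ 3 * (k ^ 3 * T ω) := by
      calc _ = a ω ^ 3 + a ω * s ω + a ω * d ω := by ring
        _ ≤ _ := by linarith
    have h3 : n ω * (a ω + s ω + d ω) ≤ 3 * (k * T ω) := by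
      calc _ = n ω * a ω + n ω * s ω + n ω * d ω := by ring
        _ ≤ _ := by linarith
    have h4 : (a ω + s ω + d ω) * (a ω + s ω + d ω) ≤ 9 * (k * T ω) := by
      have : (a ω + s ω + d ω) * (a ω + s ω + d ω) ≤ 3 * (a ω ^ 2 + s ω ^ 2 + d ω ^ 2) := by
        nlinarith only [sq_nonneg (a ω - s ω), sq_nonneg (a ω - d ω), sq_nonneg (s ω - d ω)]
      linarith
    calc |X ω| ≤ _ := h1
      _ = 2 * K * ((a ω ^ 2 + s ω + d ω) * a ω) + k ^ 2 * (2 * K ^ 2 * (n ω * (a ω + s ω + d ω))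
          + K ^ 2 * ((a ω + s ω + d ω) * (a ω + s ω + d ω))) := by ring
      _ ≤ 2 * K * (3 * (k ^ 3 * T ω)) + k ^ 2 * (2 * K ^ 2 * (3 * (k * T ω))
          + K ^ 2 * (9 * (k * T ω))) := by gcongr
      _ = _ := by ring
  have hEE (i j) : Integrable (fun ω => E ω i * E ω j) μ :=
    integrable_of_abs_le (C := k ^ 2) ((hE i).mul (hE j)) hΘ fun ω => by
      rw [abs_mul]
      refine (mul_le_mul (hEa ω i) (hEa ω j) (abs_nonneg _) (ha ω)).trans ?_
      rw [← sq]; exact (hle ω).1.2.1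
  have hNEi (i j) : Integrable (fun ω => N ω i * E ω j) μ :=
    integrable_of_abs_le (C := K * k) ((hN i).mul (hE j)) hΘ fun ω => by
      rw [abs_mul]
      refine (mul_le_mul (hNn ω i) (hEa ω j) (abs_nonneg _) (mul_nonneg hK (hn ω))).trans ?_
      rw [mul_assoc, mul_assoc]
      exact mul_le_mul_of_nonneg_left (hle ω).2.2.1.2.2.1 hK
  have hNN (i j) : Integrable (fun ω => N ω i * N ω j) μ :=
    integrable_of_abs_le (C := K ^ 2) ((hN i).mul (hN j)) hΘ fun ω => by
      rw [abs_mul]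
      refine (mul_le_mul (hNn ω i) (hNn ω j) (abs_nonneg _) (mul_nonneg hK (hn ω))).trans ?_
      calc _ = K ^ 2 * n ω ^ 2 := by ring
        _ ≤ _ := by gcongr; exact (hle ω).2.2.1.2.1
  have hXi : Integrable X μ := integrable_of_abs_le hXm hΘ hXb
  have hpt (ω) : (E ω i + D ω i) * (E ω j + D ω j) = E ω i * E ω j
      + k ^ 2 * (((∑ l, A i l * (E ω l * E ω j) + ∑ l, A j l * (E ω i * E ω l))
        + k ^ 2 * (N ω i * N ω j)) + (N ω i * E ω j + N ω j * E ω i) + X ω) := by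
    have e1 : ∑ l, A i l * (E ω l * E ω j) = (A *ᵥ E ω) i * E ω j := by
      simp only [Matrix.mulVec, dotProduct, Finset.sum_mul, mul_assoc]
    have e2 : ∑ l, A j l * (E ω i * E ω l) = E ω i * (A *ᵥ E ω) j := by
      simp only [Matrix.mulVec, dotProduct, Finset.mul_sum]
      exact Finset.sum_congr rfl fun l _ => by ring
    rw [e1, e2, hDR, hDR]
    simp only [hX, hV]
    ring
  have hs1 : Integrable (fun ω => ∑ l, A i l * (E ω l * E ω j)) μ :=
    integrable_finsetSum _ fun l _ => (hEE l j).const_mul _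
  have hs2 : Integrable (fun ω => ∑ l, A j l * (E ω i * E ω l)) μ :=
    integrable_finsetSum _ fun l _ => (hEE i l).const_mul _
  have hs3 : Integrable (fun ω => (∑ l, A i l * (E ω l * E ω j) + ∑ l, A j l * (E ω i * E ω l))
        + k ^ 2 * (N ω i * N ω j)) μ := (hs1.add hs2).add ((hNN i j).const_mul _)
  have hs4 : Integrable (fun ω => N ω i * E ω j + N ω j * E ω i) μ := (hNEi i j).add (hNEi j i)
  have hs5 : Integrable (fun ω => ((∑ l, A i l * (E ω l * E ω j) + ∑ l, A j l * (E ω i * E ω l))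
        + k ^ 2 * (N ω i * N ω j)) + (N ω i * E ω j + N ω j * E ω i) + X ω) μ :=
    (hs3.add hs4).add hXi
  have hs12 : Integrable (fun ω => ∑ l, A i l * (E ω l * E ω j)
      + ∑ l, A j l * (E ω i * E ω l)) μ := hs1.add hs2
  have hs34 : Integrable (fun ω => ((∑ l, A i l * (E ω l * E ω j)
      + ∑ l, A j l * (E ω i * E ω l)) + k ^ 2 * (N ω i * N ω j))
      + (N ω i * E ω j + N ω j * E ω i)) μ := hs3.add hs4
  have hzero := hstat i j
  simp only [hpt] at hzero
  rw [integral_add (hEE i j) (hs5.const_mul _), integral_const_mul, add_eq_left,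
    mul_eq_zero, or_iff_right (by positivity), integral_add hs34 hXi,
    integral_add hs3 hs4, integral_add (hNEi i j) (hNEi j i), hNE, hNE,
    integral_add hs12 ((hNN i j).const_mul _), integral_add hs1 hs2,
    integral_const_mul, integral_finsetSum _ fun l _ => (hEE l j).const_mul _,
    integral_finsetSum _ fun l _ => (hEE i l).const_mul _] at hzero
  have hX0 := abs_integral_le_of_abs_le (by positivity) hΘ hK₀ hXb
  have hval : (A * Matrix.of (fun i j => ∫ ω, E ω i * E ω j ∂μ)
        + Matrix.of (fun i j => ∫ ω, E ω i * E ω j ∂μ) * Aᵀ) i j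
      + k ^ 2 * ∫ ω, N ω i * N ω j ∂μ = -∫ ω, X ω ∂μ := by
    simp only [Matrix.add_apply, Matrix.mul_apply, Matrix.of_apply, Matrix.transpose_apply]
    simp only [integral_const_mul] at hzero
    have e2 : ∑ l, (∫ ω, E ω i * E ω l ∂μ) * A j l = ∑ l, A j l * ∫ ω, E ω i * E ω l ∂μ :=
      Finset.sum_congr rfl fun l _ => mul_comm _ _
    rw [e2]
    linarith
  rw [hval, abs_neg]
  exact hX0

end Scale

/-! ### Moments of the stationary law -/

section StationaryMoments

variable {dx dy : ℕ} {f : ZSpace dx dy → ℝ} {μx μy : ℝ}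
  {Ωx Ωy : Type*} [MeasurableSpace Ωx] [MeasurableSpace Ωy]
  {gx : ZSpace dx dy → Ωx → XSpace dx} {gy : ZSpace dx dy → Ωy → YSpace dy}
  {P : Measure Ωx} {Q : Measure (Ωy × Ωy)} [IsProbabilityMeasure P] [IsProbabilityMeasure Q]

/-- The dominating function `scaleFn` at one SAPD iteration with `τ = h / μ_x`, `σ = h / μ_y`. -/
def stepScale (f : ZSpace dx dy → ℝ) (gx : ZSpace dx dy → Ωx → XSpace dx)
    (gy : ZSpace dx dy → Ωy → YSpace dy) (μx μy : ℝ) (zs : ZSpace dx dy) (h θ : ℝ)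
    (p : (ZSpace dx dy × ZSpace dx dy) × Ωx × Ωy × Ωy) : ℝ :=
  scaleFn (√h) ‖p.1.1 - zs‖ ‖p.1.1 - p.1.2‖
    ‖(step gx gy (h / μx) (h / μy) θ p.1 p.2).1 - p.1.1‖ (errNorm f gx gy (h / μy) θ p)

/-- Integrals over the current state are integrals over the next state. -/
theorem integral_comp_step (hg : IsAdmissibleOracle f gx gy P Q) {τ σ θ : ℝ}
    {π : Measure (ZSpace dx dy × ZSpace dx dy)} [IsProbabilityMeasure π]
    (hπ : (transition gx gy P Q τ σ θ).Invariant π) {E : Type*} [NormedAddCommGroup E]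
    [NormedSpace ℝ E] [MeasurableSpace E] [BorelSpace E] [SecondCountableTopology E]
    {g : ZSpace dx dy × ZSpace dx dy → E}
    (hgm : Measurable g) :
    ∫ p, g (step gx gy τ σ θ p.1 p.2) ∂(π.prod (P.prod Q)) = ∫ p, g p.1 ∂(π.prod (P.prod Q)) := by
  have hmeas : Measurable fun p : (ZSpace dx dy × ZSpace dx dy) × Ωx × Ωy × Ωy =>
    step gx gy τ σ θ p.1 p.2 := measurable_step hg.measurable_gx hg.measurable_gy τ σ θ
  have h1 := integral_map (μ := π.prod (P.prod Q)) hmeas.aemeasurable (f := g)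
    hgm.aestronglyMeasurable
  have h2 := integral_fun_fst (μ := π) (ν := P.prod Q) g
  rw [map_step_of_invariant hg hπ] at h1
  rw [← h1, h2]
  simp

theorem integrable_comp_step_iff (hg : IsAdmissibleOracle f gx gy P Q) {τ σ θ : ℝ}
    {π : Measure (ZSpace dx dy × ZSpace dx dy)} [IsProbabilityMeasure π]
    (hπ : (transition gx gy P Q τ σ θ).Invariant π) {E : Type*} [NormedAddCommGroup E]
    [NormedSpace ℝ E] [MeasurableSpace E] [BorelSpace E] [SecondCountableTopology E]
    {g : ZSpace dx dy × ZSpace dx dy → E}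
    (hgm : Measurable g) :
    Integrable (fun p => g (step gx gy τ σ θ p.1 p.2)) (π.prod (P.prod Q)) ↔ Integrable g π := by
  have hmeas : Measurable fun p : (ZSpace dx dy × ZSpace dx dy) × Ωx × Ωy × Ωy =>
    step gx gy τ σ θ p.1 p.2 := measurable_step hg.measurable_gx hg.measurable_gy τ σ θ
  have h1 := integrable_map_measure (μ := π.prod (P.prod Q))
    (f := fun p => step gx gy τ σ θ p.1 p.2)
    (g := g) hgm.aestronglyMeasurable hmeas.aemeasurable
  rw [map_step_of_invariant hg hπ] at h1
  exact h1.symm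

theorem HasErrorBound.integrable_prod {c : ℝ} (hc : HasErrorBound f gx gy P Q c)
    (hf : IsAdmissibleObjective f μx μy) (hg : IsAdmissibleOracle f gx gy P Q) (σ θ : ℝ)
    (π : Measure (ZSpace dx dy × ZSpace dx dy)) [IsProbabilityMeasure π] :
    Integrable (fun p => errNorm f gx gy σ θ p ^ 4) (π.prod (P.prod Q)) ∧
      ∫ p, errNorm f gx gy σ θ p ^ 4 ∂(π.prod (P.prod Q)) ≤ c := by
  have hm := (measurable_errNorm hf hg σ θ).pow_const 4
  refine integrable_of_lintegral_le hm (fun _ => pow_nonneg (errNorm_nonneg σ θ _) 4) hc.1 ?_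
  rw [lintegral_prod _ hm.ennreal_ofReal.aemeasurable]
  exact (lintegral_mono (g := fun _ => ENNReal.ofReal c) fun ξ => hc.2 σ θ ξ).trans_eq (by simp)

theorem measurable_scaleFn {Ω : Type*} [MeasurableSpace Ω] {k : ℝ} {a s d n : Ω → ℝ}
    (ha : Measurable a) (hs : Measurable s) (hd : Measurable d) (hn : Measurable n) :
    Measurable fun ω => scaleFn k (a ω) (s ω) (d ω) (n ω) := by
  unfold scaleFn; fun_prop

theorem measurable_stepScale (hf : IsAdmissibleObjective f μx μy)
    (hg : IsAdmissibleOracle f gx gy P Q) (zs : ZSpace dx dy) (h θ : ℝ) :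
    Measurable (stepScale f gx gy μx μy zs h θ) := by
  have hmeas : Measurable fun p : (ZSpace dx dy × ZSpace dx dy) × Ωx × Ωy × Ωy =>
    step gx gy (h / μx) (h / μy) θ p.1 p.2 :=
      measurable_step hg.measurable_gx hg.measurable_gy _ _ θ
  exact measurable_scaleFn (by fun_prop) (by fun_prop)
    ((measurable_fst.comp hmeas).sub (measurable_fst.comp measurable_fst)).norm
    (measurable_errNorm hf hg (h / μy) θ)

/-- Stationary moments: up to constants, `‖z - z_*‖ ~ √h`, the increments are of size `h`, and the
errors of size `1`. -/
theorem exists_integral_stepScale_le (hf : IsAdmissibleObjective f μx μy)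
    (hμx : 0 < μx) (hμy : 0 < μy) {zs : ZSpace dx dy} (hzs : IsSaddlePoint f zs)
    (hg : IsAdmissibleOracle f gx gy P Q) :
    ∃ h₀ ∈ Set.Ioc (0 : ℝ) 1, ∃ K₀ : ℝ, 0 ≤ K₀ ∧
      ∀ h ∈ Set.Ioc (0 : ℝ) h₀, ∀ θ ∈ Set.Icc (0 : ℝ) 1,
      ∀ π : Measure (ZSpace dx dy × ZSpace dx dy), IsProbabilityMeasure π →
      (transition gx gy P Q (h / μx) (h / μy) θ).Invariant π →
      Integrable (stepScale f gx gy μx μy zs h θ) (π.prod (P.prod Q)) ∧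
      ∫ p, stepScale f gx gy μx μy zs h θ p ∂(π.prod (P.prod Q)) ≤ K₀ := by
  obtain ⟨h₀, hh₀, K, hK0, hK⟩ := exists_sq_drift hf hμx hμy hzs hg
  obtain ⟨K₁, hK₁0, hK₁⟩ := hf.exists_increment_bound hμx hμy hzs
  obtain ⟨c, hc⟩ := exists_lintegral_errNorm_le hf hg
  replace hc : HasErrorBound f gx gy P Q c := hc
  have hc0 := hc.1
  set μ := min μx μy with hμ
  have hμ0 : 0 < μ := lt_min hμx hμy
  set D : ℝ := 3 * K₁ ^ 2 * ((1 / μ + 1) * (1 + 2 * K) + (1 + c)) with hD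
  have hD0 : 0 ≤ D := by positivity
  refine ⟨h₀, hh₀, 1 + 2 * K / μ ^ 2 + D + D + c, by positivity, fun h hh θ hθ π _ hπ => ?_⟩
  have hh0 : 0 < h := hh.1
  have hh1 : h ≤ 1 := hh.2.trans hh₀.2
  have := isMarkovKernel_transition hg (h / μx) (h / μy) θ
  have hmeas : Measurable fun p : (ZSpace dx dy × ZSpace dx dy) × Ωx × Ωy × Ωy =>
    step gx gy (h / μx) (h / μy) θ p.1 p.2 :=
      measurable_step hg.measurable_gx hg.measurable_gy _ _ θ
  set ν := π.prod (P.prod Q) with hν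
  set V : (ZSpace dx dy × ZSpace dx dy) → ℝ := fun ξ => lyap μx μy zs ξ ^ 2 with hV
  have hVm : Measurable V := (measurable_lyap μx μy zs).pow_const 2
  have hVπ : Integrable V π ∧ ∫ ξ, V ξ ∂π ≤ 2 * K * h ^ 2 := by
    refine integrable_of_lintegral_le hVm (fun ξ => sq_nonneg _) (by positivity) ?_
    refine (lintegral_le_of_drift hπ hVm (fun ξ => sq_nonneg _) (a := h / 2) (by positivity)
      (by linarith) (b := K * h ^ 3) (by positivity) (hK h hh θ hθ)).trans_eq ?_
    congr 1; field_simp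
  have hVν : Integrable (fun p : (ZSpace dx dy × ZSpace dx dy) × Ωx × Ωy × Ωy => V p.1) ν :=
    hVπ.1.comp_fst _
  have hVν' : ∫ p, V p.1 ∂ν ≤ 2 * K * h ^ 2 := by
    have h2 := integral_fun_fst (μ := π) (ν := P.prod Q) V
    rw [h2]; simpa using hVπ.2
  obtain ⟨hn4, hn4c⟩ := hc.integrable_prod hf hg (h / μy) θ π
  rw [← hν] at hn4 hn4c
  -- the length of the increment
  set d : (ZSpace dx dy × ZSpace dx dy) × Ωx × Ωy × Ωy → ℝ :=
    fun p => ‖(step gx gy (h / μx) (h / μy) θ p.1 p.2).1 - p.1.1‖ with hd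
  have hdm : Measurable d :=
    ((measurable_fst.comp hmeas).sub (measurable_fst.comp measurable_fst)).norm
  have hdle (p) : d p ^ 2 ≤ 3 * K₁ ^ 2 * h ^ 2 * ((1 / μ + 1) * (1 + V p.1)
      + (1 + errNorm f gx gy (h / μy) θ p ^ 4)) := by
    have h1 := hK₁ h ⟨hh0.le, hh1⟩ θ hθ p.1 (errX f gx gy (h / μy) θ p) (errY₁ f gy p)
      (errY₂ f gy p)
    have h2 : d p = ‖nextOf f μx μy h θ p.1 (errX f gx gy (h / μy) θ p) (errY₁ f gy p)
        (errY₂ f gy p) - p.1.1‖ := by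
      rw [hd]; simp only [step_eq_nextOf (f := f)]
    rw [← h2] at h1
    change d p ≤ K₁ * h * (‖p.1.1 - zs‖ + ‖p.1.1 - p.1.2‖ + errNorm f gx gy (h / μy) θ p) at h1
    set a := ‖p.1.1 - zs‖
    set s := ‖p.1.1 - p.1.2‖
    set n := errNorm f gx gy (h / μy) θ p
    have h3 : μ * a ^ 2 + s ^ 2 ≤ lyap μx μy zs p.1 := le_lyap μx μy zs p.1
    have h4 : lyap μx μy zs p.1 ≤ 1 + V p.1 := by
      rw [hV]; nlinarith only [sq_nonneg (lyap μx μy zs p.1 - 1 / 2)]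
    have h5 : a ^ 2 + s ^ 2 ≤ (1 / μ + 1) * (1 + V p.1) := by
      have e1 : μ * a ^ 2 ≤ 1 + V p.1 := by linarith [sq_nonneg s]
      have e2 : s ^ 2 ≤ 1 + V p.1 := by linarith [mul_nonneg hμ0.le (sq_nonneg a)]
      have e3 : a ^ 2 ≤ 1 / μ * (1 + V p.1) := by
        rw [one_div, ← div_eq_inv_mul, le_div_iff₀ hμ0]; linarith
      linarith
    have h6 : n ^ 2 ≤ 1 + n ^ 4 := sq_le_one_add_pow_four
    calc d p ^ 2 ≤ (K₁ * h * (a + s + n)) ^ 2 := by gcongr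
      _ = K₁ ^ 2 * h ^ 2 * (a + s + n) ^ 2 := by ring
      _ ≤ K₁ ^ 2 * h ^ 2 * (3 * (a ^ 2 + s ^ 2 + n ^ 2)) := by
        gcongr
        nlinarith only [sq_nonneg (a - s), sq_nonneg (a - n), sq_nonneg (s - n)]
      _ ≤ K₁ ^ 2 * h ^ 2 * (3 * ((1 / μ + 1) * (1 + V p.1) + (1 + n ^ 4))) := by gcongr
      _ = _ := by ring
  have hbi : Integrable (fun p : (ZSpace dx dy × ZSpace dx dy) × Ωx × Ωy × Ωy =>
      (1 / μ + 1) * (1 + V p.1)) ν := ((integrable_const 1).add hVν).const_mul _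
  have hbi' : Integrable (fun p : (ZSpace dx dy × ZSpace dx dy) × Ωx × Ωy × Ωy =>
      1 + errNorm f gx gy (h / μy) θ p ^ 4) ν := (integrable_const 1).add hn4
  have hbi2 : Integrable (fun p => 3 * K₁ ^ 2 * h ^ 2 * ((1 / μ + 1) * (1 + V p.1)
      + (1 + errNorm f gx gy (h / μy) θ p ^ 4))) ν := (hbi.add hbi').const_mul _
  have hd2 : Integrable (fun p => d p ^ 2) ν :=
    hbi2.mono' (hdm.pow_const 2).aestronglyMeasurable (Filter.Eventually.of_forall fun p => by
      rw [Real.norm_of_nonneg (sq_nonneg _)]; exact hdle p)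
  have hd2c : ∫ p, d p ^ 2 ∂ν ≤ D * h ^ 2 := by
    refine (integral_mono hd2 hbi2 hdle).trans ?_
    rw [integral_const_mul, integral_add hbi hbi', integral_const_mul,
      integral_add (integrable_const 1) hVν, integral_add (integrable_const 1) hn4]
    simp only [integral_const, probReal_univ, smul_eq_mul, one_mul]
    have h2K : 2 * K * h ^ 2 ≤ 2 * K := mul_le_of_le_one_right (by positivity) (by nlinarith)
    calc _ ≤ 3 * K₁ ^ 2 * h ^ 2 * ((1 / μ + 1) * (1 + 2 * K) + (1 + c)) := by
          gcongr; exact hVν'.trans h2K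
      _ = _ := by rw [hD]; ring
  -- the previous increment has the same law
  have hsm : Measurable fun ξ : ZSpace dx dy × ZSpace dx dy => ‖ξ.1 - ξ.2‖ ^ 2 := by fun_prop
  have hs2 : Integrable (fun p : (ZSpace dx dy × ZSpace dx dy) × Ωx × Ωy × Ωy =>
      ‖p.1.1 - p.1.2‖ ^ 2) ν :=
    ((integrable_comp_step_iff hg hπ hsm).1 hd2).comp_fst _
  have hs2c : ∫ p, ‖p.1.1 - p.1.2‖ ^ 2 ∂ν ≤ D * h ^ 2 :=
    (integral_comp_step hg hπ hsm).symm.trans_le hd2c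
  -- sum up
  have hle (p) : stepScale f gx gy μx μy zs h θ p ≤ (((1 + (1 / (μ ^ 2 * h ^ 2)) * V p.1)
      + (1 / h ^ 2) * ‖p.1.1 - p.1.2‖ ^ 2) + (1 / h ^ 2) * d p ^ 2)
      + errNorm f gx gy (h / μy) θ p ^ 4 := by
    have hsq : √h ^ 2 = h := Real.sq_sqrt hh0.le
    have hsq4 : √h ^ 4 = h ^ 2 := by
      rw [show √h ^ 4 = (√h ^ 2) ^ 2 by ring, hsq]
    rw [stepScale, scaleFn, div_pow, div_pow, div_pow, hsq4, hsq]
    have e1 : μ * ‖p.1.1 - zs‖ ^ 2 ≤ lyap μx μy zs p.1 := by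
      linarith [le_lyap μx μy zs p.1, sq_nonneg ‖p.1.1 - p.1.2‖]
    have e2 : (μ * ‖p.1.1 - zs‖ ^ 2) ^ 2 ≤ V p.1 := pow_le_pow_left₀ (by positivity) e1 2
    have e3 : ‖p.1.1 - zs‖ ^ 4 / h ^ 2 ≤ (1 / (μ ^ 2 * h ^ 2)) * V p.1 := by
      calc _ = (1 / (μ ^ 2 * h ^ 2)) * (μ * ‖p.1.1 - zs‖ ^ 2) ^ 2 := by field_simp
        _ ≤ _ := by gcongr
    have e4 : ‖(step gx gy (h / μx) (h / μy) θ p.1 p.2).1 - p.1.1‖ ^ 2 / h ^ 2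
      = (1 / h ^ 2) * d p ^ 2 := by rw [hd]; ring
    have e5 : ‖p.1.1 - p.1.2‖ ^ 2 / h ^ 2 = 1 / h ^ 2 * ‖p.1.1 - p.1.2‖ ^ 2 := by ring
    linarith
  have i1 : Integrable (fun p : (ZSpace dx dy × ZSpace dx dy) × Ωx × Ωy × Ωy =>
      1 + (1 / (μ ^ 2 * h ^ 2)) * V p.1) ν := (integrable_const 1).add (hVν.const_mul _)
  have i2 : Integrable (fun p : (ZSpace dx dy × ZSpace dx dy) × Ωx × Ωy × Ωy =>
      (1 + (1 / (μ ^ 2 * h ^ 2)) * V p.1) + (1 / h ^ 2) * ‖p.1.1 - p.1.2‖ ^ 2) ν :=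
    i1.add (hs2.const_mul _)
  have i3 : Integrable (fun p => ((1 + (1 / (μ ^ 2 * h ^ 2)) * V p.1)
      + (1 / h ^ 2) * ‖p.1.1 - p.1.2‖ ^ 2) + (1 / h ^ 2) * d p ^ 2) ν := i2.add (hd2.const_mul _)
  have i4 : Integrable (fun p => (((1 + (1 / (μ ^ 2 * h ^ 2)) * V p.1)
      + (1 / h ^ 2) * ‖p.1.1 - p.1.2‖ ^ 2) + (1 / h ^ 2) * d p ^ 2)
      + errNorm f gx gy (h / μy) θ p ^ 4) ν := i3.add hn4
  have hint : Integrable (stepScale f gx gy μx μy zs h θ) ν :=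
    i4.mono' (measurable_stepScale hf hg zs h θ).aestronglyMeasurable
      (Filter.Eventually.of_forall fun p => by
        exact (Real.norm_of_nonneg (scaleFn_nonneg _ _ _ _ _)).trans_le (hle p))
  refine ⟨hint, (integral_mono hint i4 hle).trans ?_⟩
  rw [integral_add i3 hn4, integral_add i2 (hd2.const_mul _), integral_add i1 (hs2.const_mul _),
    integral_add (integrable_const 1) (hVν.const_mul _)]
  simp only [integral_const_mul, integral_const, probReal_univ, smul_eq_mul, one_mul]
  have j1 : 1 / (μ ^ 2 * h ^ 2) * ∫ p, V p.1 ∂ν ≤ 2 * K / μ ^ 2 := by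
    calc _ ≤ 1 / (μ ^ 2 * h ^ 2) * (2 * K * h ^ 2) := by gcongr
      _ = _ := by field_simp
  have j2 : 1 / h ^ 2 * ∫ p, ‖p.1.1 - p.1.2‖ ^ 2 ∂ν ≤ D := by
    calc _ ≤ 1 / h ^ 2 * (D * h ^ 2) := by gcongr
      _ = _ := by field_simp
  have j3 : 1 / h ^ 2 * ∫ p, d p ^ 2 ∂ν ≤ D := by
    calc _ ≤ 1 / h ^ 2 * (D * h ^ 2) := by gcongr
      _ = _ := by field_simp
  linarith

end StationaryMoments

/-! ### The linearized increment -/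

section Expansion

variable {dx dy : ℕ} {f : ZSpace dx dy → ℝ} {μx μy : ℝ}
  {Ωx Ωy : Type*}
  {gx : ZSpace dx dy → Ωx → XSpace dx} {gy : ZSpace dx dy → Ωy → YSpace dy}

/-- The noise `(T₁ + θ T₂) w` that enters the increment of the iterate. -/
def stepNoise (f : ZSpace dx dy → ℝ) (gx : ZSpace dx dy → Ωx → XSpace dx)
    (gy : ZSpace dx dy → Ωy → YSpace dy) (μx μy σ θ : ℝ)
    (p : (ZSpace dx dy × ZSpace dx dy) × Ωx × Ωy × Ωy) : Fin dx ⊕ Fin dy → ℝ :=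
  (T₁ dx dy μx μy + θ • T₂ dx dy μy) *ᵥ noise f gx gy σ θ p.1 p.2

/-- The error of the current iterate. -/
def stepError (zs : ZSpace dx dy) (p : (ZSpace dx dy × ZSpace dx dy) × Ωx × Ωy × Ωy) :
    Fin dx ⊕ Fin dy → ℝ := fun i => (p.1.1 - zs) i

/-- The increment of the iterate. -/
def stepIncr (gx : ZSpace dx dy → Ωx → XSpace dx)
    (gy : ZSpace dx dy → Ωy → YSpace dy) (μx μy h θ : ℝ)
    (p : (ZSpace dx dy × ZSpace dx dy) × Ωx × Ωy × Ωy) : Fin dx ⊕ Fin dy → ℝ :=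
  fun i => ((step gx gy (h / μx) (h / μy) θ p.1 p.2).1 - p.1.1) i

/-- The remainder of the linearization `D = h (C₀ H E + N)` of the increment `D`. -/
def stepRem (f : ZSpace dx dy → ℝ) (gx : ZSpace dx dy → Ωx → XSpace dx)
    (gy : ZSpace dx dy → Ωy → YSpace dy) (μx μy : ℝ) (zs : ZSpace dx dy) (h θ : ℝ)
    (p : (ZSpace dx dy × ZSpace dx dy) × Ωx × Ωy × Ωy) : Fin dx ⊕ Fin dy → ℝ :=
  fun i => stepIncr gx gy μx μy h θ p i / h
    - ((C₀ dx dy μx μy * hessian f zs) *ᵥ stepError zs p) i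
    - stepNoise f gx gy μx μy (h / μy) θ p i

theorem stepNoise_inl (σ θ : ℝ) (p : (ZSpace dx dy × ZSpace dx dy) × Ωx × Ωy × Ωy) (i : Fin dx) :
    stepNoise f gx gy μx μy σ θ p (Sum.inl i) = -(1 / μx) * errX f gx gy σ θ p i := by
  rw [← noise_inl]
  simp [stepNoise, T₁, T₂, Matrix.add_mulVec, Matrix.smul_mulVec, Matrix.fromBlocks_mulVec,
    Matrix.neg_mulVec]

theorem stepNoise_inr (σ θ : ℝ) (p : (ZSpace dx dy × ZSpace dx dy) × Ωx × Ωy × Ωy) (j : Fin dy) :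
    stepNoise f gx gy μx μy σ θ p (Sum.inr j)
      = 1 / μy * ((1 + θ) * errY₁ f gy p j - θ * errY₂ f gy p j) := by
  rw [← noise_inr_inl (gx := gx) σ θ, ← noise_inr_inr (gx := gx) σ θ]
  simp [stepNoise, T₁, T₂, Matrix.add_mulVec, Matrix.smul_mulVec, Matrix.fromBlocks_mulVec,
    Matrix.neg_mulVec, Matrix.fromCols_mulVec]
  ring

theorem stepIncr_inl (h θ : ℝ) (p : (ZSpace dx dy × ZSpace dx dy) × Ωx × Ωy × Ωy) (i : Fin dx) :
    stepIncr gx gy μx μy h θ p (Sum.inl i) = -(h / μx) *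
      (gradient f (pair (xPart p.1.1) (nextY gy (h / μy) θ p.1 p.2.2)) (Sum.inl i)
        + errX f gx gy (h / μy) θ p i) := by
  simp [stepIncr, step, errX, gradX, xPart_apply]

theorem stepIncr_inr (h θ : ℝ) (p : (ZSpace dx dy × ZSpace dx dy) × Ωx × Ωy × Ωy) (j : Fin dy) :
    stepIncr gx gy μx μy h θ p (Sum.inr j) = h / μy *
      (gradient f p.1.1 (Sum.inr j)
        + θ * (gradient f p.1.1 (Sum.inr j) - gradient f p.1.2 (Sum.inr j))
        + ((1 + θ) * errY₁ f gy p j - θ * errY₂ f gy p j)) := by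
  simp [stepIncr, step, nextY, errY₁, errY₂, gradY]
  left; ring

theorem norm_midPoint_sub_le (τ σ θ : ℝ) (p : (ZSpace dx dy × ZSpace dx dy) × Ωx × Ωy × Ωy) :
    ‖pair (xPart p.1.1) (nextY gy σ θ p.1 p.2.2) - p.1.1‖
      ≤ ‖(step gx gy τ σ θ p.1 p.2).1 - p.1.1‖ := by
  refine (sq_le_sq₀ (norm_nonneg _) (norm_nonneg _)).1 ?_
  rw [norm_sq_eq_add, norm_sq_eq_add ((step gx gy τ σ θ p.1 p.2).1 - p.1.1), step]
  simp only [xPart_sub, yPart_sub, xPart_pair, yPart_pair]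
  simp

theorem abs_sum_mul_le {ι : Type*} [Fintype ι] (a v : ι → ℝ) {c : ℝ} (h : ∀ i, |v i| ≤ c) :
    |∑ i, a i * v i| ≤ (∑ i, |a i|) * c := by
  rw [Finset.sum_mul]
  refine (Finset.abs_sum_le_sum_abs _ _).trans (Finset.sum_le_sum fun i _ => ?_)
  rw [abs_mul]
  exact mul_le_mul_of_nonneg_left (h i) (abs_nonneg _)

/-- Bounds for the noise `N`, for the remainder `R` and for the drift `C₀ H E + R` of the increment.
The remainder is quadratic in the error of the current iterate and linear in the lag and in the
length of the increment, which in stationarity are of the order of the squared error. -/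
theorem IsAdmissibleObjective.exists_step_expansion [MeasurableSpace Ωx] [MeasurableSpace Ωy]
    (hf : IsAdmissibleObjective f μx μy)
    (hμx : 0 < μx) (hμy : 0 < μy) {zs : ZSpace dx dy} (hzs : IsSaddlePoint f zs)
    (gx : ZSpace dx dy → Ωx → XSpace dx) (gy : ZSpace dx dy → Ωy → YSpace dy) :
    ∃ K : ℝ, 0 ≤ K ∧ ∀ h : ℝ, 0 < h → ∀ θ ∈ Set.Icc (0 : ℝ) 1, ∀ p i,
      |stepNoise f gx gy μx μy (h / μy) θ p i| ≤ K * errNorm f gx gy (h / μy) θ p ∧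
      |stepRem f gx gy μx μy zs h θ p i| ≤ K * (‖p.1.1 - zs‖ ^ 2 + ‖p.1.1 - p.1.2‖
        + ‖(step gx gy (h / μx) (h / μy) θ p.1 p.2).1 - p.1.1‖) ∧
      |((C₀ dx dy μx μy * hessian f zs) *ᵥ stepError zs p) i + stepRem f gx gy μx μy zs h θ p i|
        ≤ K * (‖p.1.1 - zs‖ + ‖p.1.1 - p.1.2‖
        + ‖(step gx gy (h / μx) (h / μy) θ p.1 p.2).1 - p.1.1‖) := by
  obtain ⟨K, hK0, -, hK⟩ := hf.exists_gradient_expansion zs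
  obtain ⟨L, hL0, hLx, hLy⟩ := hf.exists_lipschitz
  have h0 := gradient_eq_zero_of_isSaddlePoint hf.differentiable hzs
  have hLx' (z z' : ZSpace dx dy) (i : Fin dx) :
      |gradient f z (Sum.inl i) - gradient f z' (Sum.inl i)| ≤ L * ‖z - z'‖ :=
    (PiLp.norm_apply_le (gradX f z - gradX f z') i).trans (hLx z z')
  have hLy' (z z' : ZSpace dx dy) (j : Fin dy) :
      |gradient f z (Sum.inr j) - gradient f z' (Sum.inr j)| ≤ L * ‖z - z'‖ :=
    (PiLp.norm_apply_le (gradY f z - gradY f z') j).trans (hLy z z')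
  have hq (z : ZSpace dx dy) (l) :
      |gradient f z l - (hessian f zs *ᵥ fun i => (z - zs) i) l| ≤ K * ‖z - zs‖ ^ 2 := by
    have h1 := hK zs (z - zs) l
    rw [add_sub_cancel, h0, sub_self, norm_zero, zero_add, mul_assoc, ← sq] at h1
    simpa [Matrix.mulVec, dotProduct] using h1
  set c := 1 / μx + 1 / μy with hc
  have hx0 : 0 < 1 / μx := by positivity
  have hy0 : 0 < 1 / μy := by positivity
  have hcx : 1 / μx ≤ c := by linarith
  have hcy : 1 / μy ≤ c := by linarith
  refine ⟨c * (K + L + 3), by positivity, fun h hh θ hθ p i => ?_⟩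
  have hn := errNorm_nonneg (f := f) (gx := gx) (gy := gy) (h / μy) θ p
  set d := ‖(step gx gy (h / μx) (h / μy) θ p.1 p.2).1 - p.1.1‖ with hd
  set n := errNorm f gx gy (h / μy) θ p with hn'
  set a := ‖p.1.1 - zs‖ with ha
  set s := ‖p.1.1 - p.1.2‖ with hs
  have ha0 : 0 ≤ a := norm_nonneg _
  have hs0 : 0 ≤ s := norm_nonneg _
  have hd0 : 0 ≤ d := norm_nonneg _
  have hKL : 0 ≤ K * a ^ 2 := by positivity
  have hsum {b u : ℝ} (hb : 0 < b) (hbc : b ≤ c) {y : ℝ} (hy : |y| ≤ (K + L + 3) * u) :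
      |b * y| ≤ c * (K + L + 3) * u := by
    rw [abs_mul, abs_of_pos hb, mul_assoc]
    exact mul_le_mul hbc hy (abs_nonneg _) (hb.le.trans hbc)
  have hprod {u v : ℝ} : 0 ≤ u → 0 ≤ v → 0 ≤ u * v := mul_nonneg
  rcases i with i | j
  · have hm := norm_midPoint_sub_le (gx := gx) (gy := gy) (h / μx) (h / μy) θ p
    rw [← hd] at hm
    set m := pair (xPart p.1.1) (nextY gy (h / μy) θ p.1 p.2.2) with hm'
    have e1 : |gradient f m (Sum.inl i) - gradient f p.1.1 (Sum.inl i)| ≤ L * d :=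
      (hLx' m p.1.1 i).trans (by gcongr)
    have e2 : |gradient f p.1.1 (Sum.inl i)| ≤ L * a := by
      have := hLx' p.1.1 zs i
      rwa [h0, PiLp.zero_apply, sub_zero] at this
    have e3 := hq p.1.1 (Sum.inl i)
    have hR : stepRem f gx gy μx μy zs h θ p (Sum.inl i) = 1 / μx *
        -(gradient f m (Sum.inl i) - (hessian f zs *ᵥ stepError zs p) (Sum.inl i)) := by
      rw [stepRem, stepIncr_inl (f := f), stepNoise_inl, ← Matrix.mulVec_mulVec, C₀_mulVec_inl,
        ← hm']
      field_simp
      ring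
    refine ⟨?_, ?_, ?_⟩
    · rw [stepNoise_inl, neg_mul, abs_neg]
      refine hsum hx0 hcx ?_
      have := (PiLp.norm_apply_le (errX f gx gy (h / μy) θ p) i).trans (norm_errX_le _ _ _)
      rw [Real.norm_eq_abs] at this
      nlinarith [hprod hK0 hn, hprod hL0 hn]
    · rw [hR]
      refine hsum hx0 hcx ?_
      rw [abs_neg]
      have := abs_sub_le (gradient f m (Sum.inl i)) (gradient f p.1.1 (Sum.inl i))
        ((hessian f zs *ᵥ stepError zs p) (Sum.inl i))
      change |gradient f p.1.1 (Sum.inl i) - (hessian f zs *ᵥ stepError zs p) (Sum.inl i)|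
        ≤ K * a ^ 2 at e3
      nlinarith [hprod hK0 hs0, hprod hK0 hd0, hprod hL0 (sq_nonneg a), hprod hL0 hs0, sq_nonneg a]
    · rw [hR, ← Matrix.mulVec_mulVec, C₀_mulVec_inl,
        show -(1 / μx) * (hessian f zs *ᵥ stepError zs p) (Sum.inl i) + 1 / μx *
          -(gradient f m (Sum.inl i) - (hessian f zs *ᵥ stepError zs p) (Sum.inl i))
          = 1 / μx * -gradient f m (Sum.inl i) by ring]
      refine hsum hx0 hcx ?_
      rw [abs_neg]
      have := abs_sub_abs_le_abs_sub (gradient f m (Sum.inl i)) (gradient f p.1.1 (Sum.inl i))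
      nlinarith [hprod hK0 hs0, hprod hK0 hd0, hprod hK0 ha0, hprod hL0 hs0]
  · have e1 : |θ * (gradient f p.1.1 (Sum.inr j) - gradient f p.1.2 (Sum.inr j))| ≤ L * s := by
      rw [abs_mul, abs_of_nonneg hθ.1]
      exact (mul_le_of_le_one_left (abs_nonneg _) hθ.2).trans (hLy' p.1.1 p.1.2 j)
    have e2 : |gradient f p.1.1 (Sum.inr j)| ≤ L * a := by
      have := hLy' p.1.1 zs j
      rwa [h0, PiLp.zero_apply, sub_zero] at this
    have e3 := hq p.1.1 (Sum.inr j)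
    have hR : stepRem f gx gy μx μy zs h θ p (Sum.inr j) = 1 / μy *
        (gradient f p.1.1 (Sum.inr j) - (hessian f zs *ᵥ stepError zs p) (Sum.inr j)
          + θ * (gradient f p.1.1 (Sum.inr j) - gradient f p.1.2 (Sum.inr j))) := by
      rw [stepRem, stepIncr_inr (f := f), stepNoise_inr, ← Matrix.mulVec_mulVec, C₀_mulVec_inr]
      field_simp
      ring
    refine ⟨?_, ?_, ?_⟩
    · rw [stepNoise_inr]
      refine hsum hy0 hcy ?_
      have h1 := PiLp.norm_apply_le (errY₁ f gy p) j
      have h2 := PiLp.norm_apply_le (errY₂ f gy p) j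
      rw [Real.norm_eq_abs] at h1 h2
      have h3 : |(1 + θ) * errY₁ f gy p j - θ * errY₂ f gy p j|
          ≤ 2 * |errY₁ f gy p j| + |errY₂ f gy p j| := by
        refine (abs_sub _ _).trans ?_
        rw [abs_mul, abs_mul, abs_of_nonneg hθ.1, abs_of_nonneg (by linarith [hθ.1])]
        have := hθ.2
        gcongr
        · linarith
        · exact mul_le_of_le_one_left (abs_nonneg _) hθ.2
      have h4 := norm_errY₁_le (f := f) (gx := gx) (gy := gy) (h / μy) θ p
      have h5 := norm_errY₂_le (f := f) (gx := gx) (gy := gy) (h / μy) θ p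
      calc _ ≤ 2 * n + n := by linarith
        _ ≤ _ := by linarith [hprod hK0 hn, hprod hL0 hn]
    · rw [hR]
      refine hsum hy0 hcy ?_
      change |gradient f p.1.1 (Sum.inr j) - (hessian f zs *ᵥ stepError zs p) (Sum.inr j)|
        ≤ K * a ^ 2 at e3
      refine (abs_add_le _ _).trans ((add_le_add e3 e1).trans ?_)
      nlinarith [hprod hK0 hs0, hprod hK0 hd0, hprod hL0 (sq_nonneg a), hprod hL0 hd0, sq_nonneg a]
    · rw [hR, ← Matrix.mulVec_mulVec, C₀_mulVec_inr, ← mul_add,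
        show ∀ u v w : ℝ, u + (v - u + w) = v + w by intros; ring]
      refine hsum hy0 hcy ?_
      refine (abs_add_le _ _).trans ((add_le_add e2 e1).trans ?_)
      nlinarith [hprod hK0 hs0, hprod hK0 hd0, hprod hK0 ha0, hprod hL0 hd0]

end Expansion

/-! ### The Lyapunov equation of the stationary second moments -/

section SecondMoment

variable {dx dy : ℕ} {f : ZSpace dx dy → ℝ} {μx μy : ℝ}
  {Ωx Ωy : Type*} [MeasurableSpace Ωx] [MeasurableSpace Ωy]
  {gx : ZSpace dx dy → Ωx → XSpace dx} {gy : ZSpace dx dy → Ωy → YSpace dy}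
  {P : Measure Ωx} {Q : Measure (Ωy × Ωy)}

theorem measurable_stepNoise (hf : IsAdmissibleObjective f μx μy)
    (hg : IsAdmissibleOracle f gx gy P Q) (σ θ : ℝ) (i : Fin dx ⊕ Fin dy) :
    Measurable fun p => stepNoise f gx gy μx μy σ θ p i := by
  simp only [stepNoise, Matrix.mulVec, dotProduct]
  exact Finset.measurable_sum _ fun l _ => (measurable_noise hf hg σ θ l).const_mul _

theorem measurable_stepError (zs : ZSpace dx dy) (i : Fin dx ⊕ Fin dy) :
    Measurable fun p : (ZSpace dx dy × ZSpace dx dy) × Ωx × Ωy × Ωy => stepError zs p i := by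
  unfold stepError; fun_prop

theorem measurable_step_fst (hg : IsAdmissibleOracle f gx gy P Q) (τ σ θ : ℝ) :
    Measurable fun p : (ZSpace dx dy × ZSpace dx dy) × Ωx × Ωy × Ωy =>
      (step gx gy τ σ θ p.1 p.2).1 :=
  measurable_fst.comp (measurable_step hg.measurable_gx hg.measurable_gy τ σ θ)

theorem measurable_stepIncr (hg : IsAdmissibleOracle f gx gy P Q) (h θ : ℝ)
    (i : Fin dx ⊕ Fin dy) : Measurable fun p => stepIncr gx gy μx μy h θ p i := by
  have h1 := (measurable_step_fst hg (h / μx) (h / μy) θ).sub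
    (measurable_fst.comp (measurable_fst (α := ZSpace dx dy × ZSpace dx dy) (β := Ωx × Ωy × Ωy)))
  exact (EuclideanSpace.proj (𝕜 := ℝ) i).measurable.comp h1

theorem measurable_stepRem (hf : IsAdmissibleObjective f μx μy)
    (hg : IsAdmissibleOracle f gx gy P Q) (zs : ZSpace dx dy) (h θ : ℝ) (i : Fin dx ⊕ Fin dy) :
    Measurable fun p => stepRem f gx gy μx μy zs h θ p i := by
  refine (((measurable_stepIncr hg h θ i).div_const h).sub ?_).sub
    (measurable_stepNoise hf hg (h / μy) θ i)
  simp only [Matrix.mulVec, dotProduct]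
  exact Finset.measurable_sum _ fun l _ => (measurable_stepError zs l).const_mul _

variable [IsProbabilityMeasure P] [IsProbabilityMeasure Q] {c : ℝ}

theorem integrable_noise (hc : HasErrorBound f gx gy P Q c)
    (hf : IsAdmissibleObjective f μx μy) (hg : IsAdmissibleOracle f gx gy P Q) (σ θ : ℝ)
    (ξ : ZSpace dx dy × ZSpace dx dy) (i : Fin dx ⊕ (Fin dy ⊕ Fin dy)) :
    Integrable (fun ω => noise f gx gy σ θ ξ ω i) (P.prod Q) :=
  integrable_of_norm_le_one_add
    ((measurable_noise hf hg σ θ i).comp measurable_prodMk_left).aestronglyMeasurable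
    (hc.integrable hf hg σ θ ξ).1 fun ω => (abs_noise_le σ θ (ξ, ω) i).trans le_one_add_pow_four

theorem integral_stepNoise_eq_zero (hc : HasErrorBound f gx gy P Q c)
    (hf : IsAdmissibleObjective f μx μy) (hg : IsAdmissibleOracle f gx gy P Q) (σ θ : ℝ)
    (ξ : ZSpace dx dy × ZSpace dx dy) (i : Fin dx ⊕ Fin dy) :
    ∫ ω, stepNoise f gx gy μx μy σ θ (ξ, ω) i ∂(P.prod Q) = 0 := by
  simp only [stepNoise, Matrix.mulVec, dotProduct]
  rw [integral_finsetSum _ fun l _ => (integrable_noise hc hf hg σ θ ξ l).const_mul _]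
  exact Finset.sum_eq_zero fun l _ => by
    rw [integral_const_mul, integral_noise_eq_zero hc hf hg, mul_zero]

/-- The noise has conditional mean zero, so that it is uncorrelated with functions of the state. -/
theorem integral_stepNoise_mul_eq_zero (hc : HasErrorBound f gx gy P Q c)
    (hf : IsAdmissibleObjective f μx μy) (hg : IsAdmissibleOracle f gx gy P Q) {σ θ : ℝ}
    {π : Measure (ZSpace dx dy × ZSpace dx dy)} [IsProbabilityMeasure π] {i : Fin dx ⊕ Fin dy}
    {u : ZSpace dx dy × ZSpace dx dy → ℝ}
    (hu : Integrable (fun p => stepNoise f gx gy μx μy σ θ p i * u p.1) (π.prod (P.prod Q))) :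
    ∫ p, stepNoise f gx gy μx μy σ θ p i * u p.1 ∂(π.prod (P.prod Q)) = 0 := by
  rw [integral_prod _ hu]
  simp only [integral_mul_const, integral_stepNoise_eq_zero hc hf hg, zero_mul, integral_zero]

theorem integrable_noise_mul_noise (hc : HasErrorBound f gx gy P Q c)
    (hf : IsAdmissibleObjective f μx μy) (hg : IsAdmissibleOracle f gx gy P Q) (σ θ : ℝ)
    (π : Measure (ZSpace dx dy × ZSpace dx dy)) [IsProbabilityMeasure π]
    (i j : Fin dx ⊕ (Fin dy ⊕ Fin dy)) :
    Integrable (fun p => noise f gx gy σ θ p.1 p.2 i * noise f gx gy σ θ p.1 p.2 j)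
      (π.prod (P.prod Q)) ∧
    |∫ p, noise f gx gy σ θ p.1 p.2 i * noise f gx gy σ θ p.1 p.2 j ∂(π.prod (P.prod Q))|
      ≤ 1 + c := by
  obtain ⟨h1, h2⟩ := hc.integrable_prod hf hg σ θ π
  have hle (p : (ZSpace dx dy × ZSpace dx dy) × Ωx × Ωy × Ωy) :
      ‖noise f gx gy σ θ p.1 p.2 i * noise f gx gy σ θ p.1 p.2 j‖
        ≤ 1 + errNorm f gx gy σ θ p ^ 4 := by
    rw [Real.norm_eq_abs, abs_mul]
    refine (mul_le_mul (abs_noise_le σ θ p i) (abs_noise_le σ θ p j) (abs_nonneg _)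
      (errNorm_nonneg σ θ p)).trans ?_
    rw [← sq]; exact sq_le_one_add_pow_four
  refine ⟨integrable_of_norm_le_one_add ((measurable_noise hf hg σ θ i).mul
    (measurable_noise hf hg σ θ j)).aestronglyMeasurable h1 hle, ?_⟩
  refine (norm_integral_le_of_norm_le ((integrable_const 1).add h1)
    (Filter.Eventually.of_forall hle)).trans ?_
  rw [integral_add' (integrable_const 1) h1]
  simpa using h2

/-- The second moments of a linear image. -/
theorem integral_mulVec_mul_mulVec {Ω ι κ : Type*} [MeasurableSpace Ω] {μ : Measure Ω}
    [Fintype κ] (T : Matrix ι κ ℝ) {w : Ω → κ → ℝ}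
    (hw : ∀ a b, Integrable (fun ω => w ω a * w ω b) μ) (i j : ι) :
    ∫ ω, (T *ᵥ w ω) i * (T *ᵥ w ω) j ∂μ
      = (T * Matrix.of (fun a b => ∫ ω, w ω a * w ω b ∂μ) * Tᵀ) i j := by
  have hpt (ω) : (T *ᵥ w ω) i * (T *ᵥ w ω) j = ∑ b, ∑ a, T i a * T j b * (w ω a * w ω b) := by
    simp only [Matrix.mulVec, dotProduct]
    rw [Finset.sum_mul_sum, Finset.sum_comm]
    exact Finset.sum_congr rfl fun b _ => Finset.sum_congr rfl fun a _ => by ring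
  simp only [hpt]
  rw [integral_finsetSum _ fun b _ => integrable_finsetSum _ fun a _ => (hw a b).const_mul _]
  simp only [Matrix.mul_apply, Matrix.of_apply, Matrix.transpose_apply]
  refine Finset.sum_congr rfl fun b _ => ?_
  rw [integral_finsetSum _ fun a _ => (hw a b).const_mul _, Finset.sum_mul]
  refine Finset.sum_congr rfl fun a _ => ?_
  rw [integral_const_mul]; ring

/-- The stationary second moments `S` of `z - z_*` satisfy
`C₀ H S + S (C₀ H)ᵀ + h E[N Nᵀ] = O(h^{3/2})`. -/
theorem exists_abs_lyapunov_stepError_le (hf : IsAdmissibleObjective f μx μy)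
    (hμx : 0 < μx) (hμy : 0 < μy) {zs : ZSpace dx dy} (hzs : IsSaddlePoint f zs)
    (hg : IsAdmissibleOracle f gx gy P Q) :
    ∃ K : ℝ, 0 ≤ K ∧ ∀ h ∈ Set.Ioc (0 : ℝ) 1, ∀ θ ∈ Set.Icc (0 : ℝ) 1,
      ∀ π : Measure (ZSpace dx dy × ZSpace dx dy), IsProbabilityMeasure π →
      (transition gx gy P Q (h / μx) (h / μy) θ).Invariant π → ∀ K₀ : ℝ,
      Integrable (stepScale f gx gy μx μy zs h θ) (π.prod (P.prod Q)) →
      ∫ p, stepScale f gx gy μx μy zs h θ p ∂(π.prod (P.prod Q)) ≤ K₀ → ∀ i j,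
      |lyapunov (C₀ dx dy μx μy * hessian f zs) (Matrix.of fun i j =>
          ∫ p, stepError zs p i * stepError zs p j ∂(π.prod (P.prod Q))) i j
        + h * ∫ p, stepNoise f gx gy μx μy (h / μy) θ p i
          * stepNoise f gx gy μx μy (h / μy) θ p j ∂(π.prod (P.prod Q))|
        ≤ K * √h ^ 3 * K₀ := by
  obtain ⟨c, hc⟩ := exists_lintegral_errNorm_le hf hg
  replace hc : HasErrorBound f gx gy P Q c := hc
  obtain ⟨K, hK0, hK⟩ := hf.exists_step_expansion hμx hμy hzs gx gy
  refine ⟨6 * K + 15 * K ^ 2, by positivity, fun h hh θ hθ π _ hπ K₀ hi hK₀ i j => ?_⟩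
  have hsq : √h ^ 2 = h := Real.sq_sqrt hh.1.le
  have hk : √h ∈ Set.Ioc (0 : ℝ) 1 := ⟨Real.sqrt_pos.2 hh.1, Real.sqrt_le_one.2 hh.2⟩
  have hEa (p : (ZSpace dx dy × ZSpace dx dy) × Ωx × Ωy × Ωy) (i) :
      |stepError zs p i| ≤ ‖p.1.1 - zs‖ := PiLp.norm_apply_le (p.1.1 - zs) i
  have hNEi (i j) : Integrable (fun p => stepNoise f gx gy μx μy (h / μy) θ p i
      * stepError zs p j) (π.prod (P.prod Q)) :=
    integrable_of_abs_le (C := K * √h) ((measurable_stepNoise hf hg _ θ i).mul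
      (measurable_stepError zs j)) hi fun p => by
      rw [abs_mul]
      refine (mul_le_mul (hK h hh.1 θ hθ p i).1 (hEa p j) (abs_nonneg _)
        (mul_nonneg hK0 (errNorm_nonneg _ _ _))).trans ?_
      rw [mul_assoc, mul_assoc]
      exact mul_le_mul_of_nonneg_left (le_scaleFn hk).2.2.1.2.2.1 hK0
  have key := abs_lyapunov_secondMoment_le (μ := π.prod (P.prod Q)) (K₀ := K₀)
    (A := C₀ dx dy μx μy * hessian f zs) hk hK0
    (a := fun p => ‖p.1.1 - zs‖) (s := fun p => ‖p.1.1 - p.1.2‖)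
    (d := fun p => ‖(step gx gy (h / μx) (h / μy) θ p.1 p.2).1 - p.1.1‖)
    (n := errNorm f gx gy (h / μy) θ) (fun p => norm_nonneg _) (errNorm_nonneg _ _) hi hK₀
    (E := stepError zs) (D := stepIncr gx gy μx μy h θ)
    (N := stepNoise f gx gy μx μy (h / μy) θ) (R := stepRem f gx gy μx μy zs h θ)
    (measurable_stepError zs) (measurable_stepNoise hf hg _ θ) (measurable_stepRem hf hg zs h θ)
    (fun p i => by
      have := hh.1.ne'
      rw [hsq, stepRem]; field_simp; ring) hEa (fun p i => (hK h hh.1 θ hθ p i).1)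
    (fun p i => (hK h hh.1 θ hθ p i).2.1) (fun p i => (hK h hh.1 θ hθ p i).2.2)
    (fun i j => integral_stepNoise_mul_eq_zero hc hf hg (u := fun ξ => (ξ.1 - zs) j) (hNEi i j))
    (fun i j => by
      have hm : Measurable fun ξ : ZSpace dx dy × ZSpace dx dy =>
        (ξ.1 - zs) i * (ξ.1 - zs) j := by fun_prop
      refine (integral_congr_ae (Filter.Eventually.of_forall fun p => ?_)).trans
        (integral_comp_step hg hπ hm)
      simp [stepError, stepIncr]) i j
  rw [hsq] at key
  exact key

end SecondMoment

/-! ### Second moments and the matrix `M` -/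

section BiasMatrix

theorem exists_abs_mul_mul_transpose_le {ι κ : Type*} [Fintype ι] [Fintype κ] [DecidableEq κ]
    (T S : Matrix ι κ ℝ) : ∃ K : ℝ, 0 ≤ K ∧ ∀ (W : Matrix κ κ ℝ) (c : ℝ), 0 ≤ c →
      (∀ i j, |W i j| ≤ c) → ∀ i j, |(T * W * Sᵀ) i j| ≤ K * c :=
  exists_entry_bound (ι := ι) (κ := κ)
    { toFun := fun W : Matrix κ κ ℝ => T * W * Sᵀ
      map_add' := fun _ _ => by rw [Matrix.mul_add, Matrix.add_mul]
      map_smul' := fun _ _ => by rw [Matrix.mul_smul, Matrix.smul_mul, RingHom.id_apply] }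

variable {dx dy : ℕ} {f : ZSpace dx dy → ℝ} {μx μy : ℝ}
  {Ωx Ωy : Type*} [MeasurableSpace Ωx] [MeasurableSpace Ωy]
  {gx : ZSpace dx dy → Ωx → XSpace dx} {gy : ZSpace dx dy → Ωy → YSpace dy}
  {P : Measure Ωx} {Q : Measure (Ωy × Ωy)} [IsProbabilityMeasure P] [IsProbabilityMeasure Q]

theorem W₁_add_W₂_add_W₃ (W : Matrix (Fin dx ⊕ (Fin dy ⊕ Fin dy)) (Fin dx ⊕ (Fin dy ⊕ Fin dy)) ℝ) :
    W₁ μx μy W + W₂ μx μy W + W₃ μy W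
      = (T₁ dx dy μx μy + T₂ dx dy μy) * W * (T₁ dx dy μx μy + T₂ dx dy μy)ᵀ := by
  simp only [W₁, W₂, W₃, Matrix.transpose_add, Matrix.add_mul, Matrix.mul_add]
  abel

theorem abs_noiseCov_le {c : ℝ} (hc : HasErrorBound f gx gy P Q c)
    (hf : IsAdmissibleObjective f μx μy) (hg : IsAdmissibleOracle f gx gy P Q) (θ : ℝ)
    (π : Measure (ZSpace dx dy × ZSpace dx dy)) [IsProbabilityMeasure π]
    (i j : Fin dx ⊕ (Fin dy ⊕ Fin dy)) : |noiseCov f gx gy P Q μy θ π i j| ≤ 1 + c :=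
  (integrable_noise_mul_noise hc hf hg _ θ π i j).2

theorem exists_abs_biasMatrix_le (hf : IsAdmissibleObjective f μx μy) (zs : ZSpace dx dy)
    (hg : IsAdmissibleOracle f gx gy P Q) : ∃ C : ℝ, 0 ≤ C ∧
      ∀ (θ : ℝ) (π : Measure (ZSpace dx dy × ZSpace dx dy)), IsProbabilityMeasure π → ∀ i j,
        |biasMatrix f μx μy zs (noiseCov f gx gy P Q μy θ π) i j| ≤ C := by
  obtain ⟨c, hc⟩ := exists_lintegral_errNorm_le hf hg
  replace hc : HasErrorBound f gx gy P Q c := hc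
  have hc0 := hc.1
  obtain ⟨K₁, hK₁0, hK₁⟩ := exists_abs_mul_mul_transpose_le
    (T₁ dx dy μx μy + T₂ dx dy μy) (T₁ dx dy μx μy + T₂ dx dy μy)
  obtain ⟨K₂, hK₂0, hK₂⟩ := exists_entry_bound (Gam f μx μy zs)
  refine ⟨1 / 2 * (K₂ * (K₁ * (1 + c))), by positivity, fun θ π _ i j => ?_⟩
  rw [biasMatrix, W₁_add_W₂_add_W₃, Matrix.smul_apply, smul_eq_mul, abs_mul,
    abs_of_pos (by norm_num : (0 : ℝ) < 1 / 2)]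
  refine mul_le_mul_of_nonneg_left (hK₂ _ _ (by positivity) (fun i j => ?_) i j) (by norm_num)
  exact hK₁ _ _ (by positivity) (fun i j => abs_noiseCov_le hc hf hg θ π i j) i j

/-- Replacing `T₁ + θ T₂` by `T₁ + T₂` in the covariance of the noise costs `O(1 - θ)`. -/
theorem exists_abs_covariance_sub_le (dx dy : ℕ) (μx μy : ℝ) : ∃ K : ℝ, 0 ≤ K ∧
    ∀ (W : Matrix (Fin dx ⊕ (Fin dy ⊕ Fin dy)) (Fin dx ⊕ (Fin dy ⊕ Fin dy)) ℝ) (c : ℝ), 0 ≤ c →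
      (∀ i j, |W i j| ≤ c) → ∀ θ ∈ Set.Icc (0 : ℝ) 1, ∀ i j,
      |(W₁ μx μy W + W₂ μx μy W + W₃ μy W) i j
        - ((T₁ dx dy μx μy + θ • T₂ dx dy μy) * W * (T₁ dx dy μx μy + θ • T₂ dx dy μy)ᵀ) i j|
        ≤ K * c * (1 - θ) := by
  obtain ⟨K₁, hK₁0, hK₁⟩ := exists_abs_mul_mul_transpose_le (T₁ dx dy μx μy) (T₂ dx dy μy)
  obtain ⟨K₂, hK₂0, hK₂⟩ := exists_abs_mul_mul_transpose_le (T₂ dx dy μy) (T₁ dx dy μx μy)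
  obtain ⟨K₃, hK₃0, hK₃⟩ := exists_abs_mul_mul_transpose_le (T₂ dx dy μy) (T₂ dx dy μy)
  refine ⟨K₁ + K₂ + 2 * K₃, by positivity, fun W c hc hW θ hθ i j => ?_⟩
  have h1 := hK₁ W c hc hW i j
  have h2 := hK₂ W c hc hW i j
  have h3 := hK₃ W c hc hW i j
  have heq : (W₁ μx μy W + W₂ μx μy W + W₃ μy W) i j
        - ((T₁ dx dy μx μy + θ • T₂ dx dy μy) * W * (T₁ dx dy μx μy + θ • T₂ dx dy μy)ᵀ) i j
      = ((T₁ dx dy μx μy * W * (T₂ dx dy μy)ᵀ) i j + (T₂ dx dy μy * W * (T₁ dx dy μx μy)ᵀ) i j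
        + (1 + θ) * (T₂ dx dy μy * W * (T₂ dx dy μy)ᵀ) i j) * (1 - θ) := by
    simp only [W₁, W₂, W₃, Matrix.transpose_add, Matrix.transpose_smul, Matrix.add_mul,
      Matrix.mul_add, Matrix.smul_mul, Matrix.mul_smul, Matrix.add_apply, Matrix.smul_apply,
      smul_eq_mul]
    ring
  have hθ1 : 0 ≤ 1 - θ := by linarith [hθ.2]
  rw [heq, abs_mul, abs_of_nonneg hθ1]
  refine mul_le_mul_of_nonneg_right ?_ hθ1
  refine (abs_add_le _ _).trans ((add_le_add (abs_add_le _ _) le_rfl).trans ?_)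
  have h4 : |(1 + θ) * (T₂ dx dy μy * W * (T₂ dx dy μy)ᵀ) i j| ≤ 2 * (K₃ * c) := by
    rw [abs_mul, abs_of_nonneg (by linarith [hθ.1])]
    exact mul_le_mul (by linarith [hθ.2]) h3 (abs_nonneg _) (by norm_num)
  linarith

/-- The stationary second moments of `z - z_*` are `-2 h M + O(h^{3/2})`. -/
theorem exists_abs_secondMoment_add_le (hf : IsAdmissibleObjective f μx μy)
    (hμx : 0 < μx) (hμy : 0 < μy) {zs : ZSpace dx dy} (hzs : IsSaddlePoint f zs)
    (hg : IsAdmissibleOracle f gx gy P Q) :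
    ∃ K : ℝ, 0 ≤ K ∧ ∀ h ∈ Set.Ioc (0 : ℝ) 1, ∀ θ ∈ Set.Icc (0 : ℝ) 1, 1 - θ ≤ h →
      (1 - θ) / (μy * θ) = h / μy →
      ∀ π : Measure (ZSpace dx dy × ZSpace dx dy), IsProbabilityMeasure π →
      (transition gx gy P Q (h / μx) (h / μy) θ).Invariant π → ∀ K₀ : ℝ, 0 ≤ K₀ →
      Integrable (stepScale f gx gy μx μy zs h θ) (π.prod (P.prod Q)) →
      ∫ p, stepScale f gx gy μx μy zs h θ p ∂(π.prod (P.prod Q)) ≤ K₀ → ∀ i j,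
      |∫ p, stepError zs p i * stepError zs p j ∂(π.prod (P.prod Q))
        + 2 * h * biasMatrix f μx μy zs (noiseCov f gx gy P Q μy θ π) i j|
        ≤ K * √h ^ 3 * (K₀ + 1) := by
  obtain ⟨c, hc⟩ := exists_lintegral_errNorm_le hf hg
  replace hc : HasErrorBound f gx gy P Q c := hc
  have hc0 := hc.1
  obtain ⟨K₁, hK₁0, hK₁⟩ := exists_abs_lyapunov_stepError_le hf hμx hμy hzs hg
  obtain ⟨K₂, hK₂0, hK₂⟩ := exists_abs_covariance_sub_le dx dy μx μy
  obtain ⟨K₃, hK₃0, hK₃⟩ := exists_entry_bound (Gam f μx μy zs)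
  have hunit := isUnit_lyapunov (weight_pos hμx hμy) (hf.isDissipative hμx hμy hzs)
  refine ⟨K₃ * (K₁ + K₂ * (1 + c)), by positivity,
    fun h hh θ hθ hθh hσ π _ hπ K₀ hK₀0 hi hK₀ i j => ?_⟩
  set W := noiseCov f gx gy P Q μy θ π with hW
  set S : Matrix (Fin dx ⊕ Fin dy) (Fin dx ⊕ Fin dy) ℝ := Matrix.of fun i j =>
    ∫ p, stepError zs p i * stepError zs p j ∂(π.prod (P.prod Q)) with hS
  set 𝓛 := lyapunov (C₀ dx dy μx μy * hessian f zs) with hL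
  have hk0 : 0 ≤ √h := Real.sqrt_nonneg h
  have hh2 : h * h ≤ √h ^ 3 := by
    have hsq : √h ^ 2 = h := Real.sq_sqrt hh.1.le
    calc h * h = √h ^ 4 := by rw [← sq]; nth_rewrite 1 [← hsq]; ring
      _ ≤ √h ^ 3 := pow_le_pow_of_le_one hk0 (Real.sqrt_le_one.2 hh.2) (by norm_num)
  have hErr (i j) : |(𝓛 S + h • (W₁ μx μy W + W₂ μx μy W + W₃ μy W)) i j|
      ≤ (K₁ + K₂ * (1 + c)) * √h ^ 3 * (K₀ + 1) := by
    have h1 := hK₁ h hh θ hθ π ‹_› hπ K₀ hi hK₀ i j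
    have h2 := hK₂ W (1 + c) (by positivity) (abs_noiseCov_le hc hf hg θ π) θ hθ i j
    have h3 : ∫ p, stepNoise f gx gy μx μy (h / μy) θ p i
        * stepNoise f gx gy μx μy (h / μy) θ p j ∂(π.prod (P.prod Q))
        = ((T₁ dx dy μx μy + θ • T₂ dx dy μy) * W * (T₁ dx dy μx μy + θ • T₂ dx dy μy)ᵀ) i j := by
      rw [hW, noiseCov, hσ]
      exact integral_mulVec_mul_mulVec _
        (fun a b => (integrable_noise_mul_noise hc hf hg (h / μy) θ π a b).1) i j
    rw [h3] at h1
    have h4 : (𝓛 S + h • (W₁ μx μy W + W₂ μx μy W + W₃ μy W)) i j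
        = (𝓛 S i j + h * ((T₁ dx dy μx μy + θ • T₂ dx dy μy) * W
            * (T₁ dx dy μx μy + θ • T₂ dx dy μy)ᵀ) i j)
          + h * ((W₁ μx μy W + W₂ μx μy W + W₃ μy W) i j
            - ((T₁ dx dy μx μy + θ • T₂ dx dy μy) * W
              * (T₁ dx dy μx μy + θ • T₂ dx dy μy)ᵀ) i j) := by
      rw [Matrix.add_apply, Matrix.smul_apply, smul_eq_mul]; ring
    rw [h4]
    refine (abs_add_le _ _).trans ((add_le_add h1 (d := K₂ * (1 + c) * (√h ^ 3)) ?_).trans ?_)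
    · rw [abs_mul, abs_of_pos hh.1]
      calc _ ≤ h * (K₂ * (1 + c) * (1 - θ)) := mul_le_mul_of_nonneg_left h2 hh.1.le
        _ ≤ h * (K₂ * (1 + c) * h) := by
          have := hh.1.le
          gcongr
        _ = K₂ * (1 + c) * (h * h) := by ring
        _ ≤ _ := by gcongr
    · have e1 : 0 ≤ K₁ * √h ^ 3 := by positivity
      have e2 : 0 ≤ K₂ * (1 + c) * √h ^ 3 * K₀ := by positivity
      linarith
  have hG : S + (2 * h) • biasMatrix f μx μy zs W
      = Gam f μx μy zs (𝓛 S + h • (W₁ μx μy W + W₂ μx μy W + W₃ μy W)) := by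
    have h1 : Gam f μx μy zs (𝓛 S) = S := by
      have := Ring.inverse_mul_cancel _ hunit
      exact LinearMap.congr_fun this S
    rw [map_add, map_smul, h1, biasMatrix, smul_smul]
    congr 2; ring
  have hfin := hK₃ _ _ (by positivity) hErr i j
  rw [← hG] at hfin
  calc _ = |(S + (2 * h) • biasMatrix f μx μy zs W) i j| := rfl
    _ ≤ _ := hfin
    _ = _ := by ring

end BiasMatrix

/-! ### Expansion of the stationary mean -/

section Mean

variable {dx dy : ℕ} {f : ZSpace dx dy → ℝ} {μx μy : ℝ}

/-- Solving the averaged Taylor expansion of the gradient for the mean error `m`. -/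
theorem exists_abs_mean_sub_le {zs : ZSpace dx dy} (hH : IsUnit (hessian f zs)) :
    ∃ K : ℝ, 0 ≤ K ∧ ∀ (m G : Fin dx ⊕ Fin dy → ℝ)
      (S M : Matrix (Fin dx ⊕ Fin dy) (Fin dx ⊕ Fin dy) ℝ) (h ε : ℝ), (∀ l, |G l| ≤ ε) →
      (∀ l, |G l - (hessian f zs *ᵥ m) l - 1 / 2 * thirdDeriv f zs S l| ≤ ε) →
      (∀ i j, |S i j + 2 * h * M i j| ≤ ε) → ∀ l,
      |m l - h * ((hessian f zs)⁻¹ *ᵥ thirdDeriv f zs M) l| ≤ K * ε := by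
  set B : Fin dx ⊕ Fin dy → ℝ := fun l => ∑ i, ∑ j, |iteratedFDeriv ℝ 3 f zs ![e i, e j, e l]|
    with hB
  have hB0 (l) : 0 ≤ B l := by positivity
  set Bs : ℝ := ∑ l, B l with hBs
  have hinv : (hessian f zs)⁻¹ * hessian f zs = 1 :=
    Matrix.nonsing_inv_mul _ ((Matrix.isUnit_iff_isUnit_det _).1 hH)
  generalize (hessian f zs)⁻¹ = A at hinv ⊢
  set Q : Fin dx ⊕ Fin dy → ℝ := fun l => ∑ i, |A l i| with hQ
  have hQ0 (l) : 0 ≤ Q l := by positivity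
  have hBs0 : 0 ≤ Bs := Finset.sum_nonneg fun l _ => hB0 l
  have hc0 : 0 ≤ 2 + 1 / 2 * Bs := by linarith
  refine ⟨(∑ l, Q l) * (2 + 1 / 2 * Bs),
    mul_nonneg (Finset.sum_nonneg fun l _ => hQ0 l) hc0, fun m G S M h ε hG hT hS l => ?_⟩
  have hε : 0 ≤ ε := (abs_nonneg _).trans (hG l)
  have h1 (l) : |(hessian f zs *ᵥ m) l - h * thirdDeriv f zs M l| ≤ (2 + 1 / 2 * Bs) * ε := by
    have e1 : |1 / 2 * thirdDeriv f zs S l + h * thirdDeriv f zs M l| ≤ 1 / 2 * Bs * ε := by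
      have e2 : 1 / 2 * thirdDeriv f zs S l + h * thirdDeriv f zs M l
          = 1 / 2 * ∑ i, ∑ j, iteratedFDeriv ℝ 3 f zs ![e i, e j, e l] *
            (S i j + 2 * h * M i j) := by
        simp only [thirdDeriv, mul_add, Finset.sum_add_distrib, Finset.mul_sum]
        congr 1
        exact Finset.sum_congr rfl fun i _ => Finset.sum_congr rfl fun j _ => by ring
      rw [e2, abs_mul, abs_of_pos (by norm_num : (0 : ℝ) < 1 / 2), mul_assoc]
      refine mul_le_mul_of_nonneg_left ?_ (by norm_num)
      calc _ ≤ B l * ε := by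
            rw [hB, Finset.sum_mul]
            exact (Finset.abs_sum_le_sum_abs _ _).trans (Finset.sum_le_sum fun i _ =>
              abs_sum_mul_le _ _ (hS i))
        _ ≤ Bs * ε := by
            gcongr
            exact Finset.single_le_sum (fun l _ => hB0 l) (Finset.mem_univ l)
    have e3 : (hessian f zs *ᵥ m) l - h * thirdDeriv f zs M l
        = G l - (G l - (hessian f zs *ᵥ m) l - 1 / 2 * thirdDeriv f zs S l)
          - (1 / 2 * thirdDeriv f zs S l + h * thirdDeriv f zs M l) := by ring
    rw [e3]
    refine (abs_sub _ _).trans ((add_le_add (abs_sub _ _) e1).trans ?_)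
    have := hG l
    have := hT l
    linarith
  have h2 : m l - h * (A *ᵥ thirdDeriv f zs M) l
      = ∑ i, A l i * ((hessian f zs *ᵥ m) i - h * thirdDeriv f zs M i) := by
    have e1 : A *ᵥ (hessian f zs *ᵥ m) = m := by
      rw [Matrix.mulVec_mulVec, hinv, Matrix.one_mulVec]
    conv_lhs => rw [← e1]
    generalize hessian f zs *ᵥ m = v
    simp only [Matrix.mulVec, dotProduct, mul_sub, Finset.sum_sub_distrib, Finset.mul_sum]
    congr 1
    exact Finset.sum_congr rfl fun i _ => by ring
  have h3 : Q l ≤ ∑ l, Q l := Finset.single_le_sum (fun l _ => hQ0 l) (Finset.mem_univ l)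
  rw [h2, mul_assoc]
  exact (abs_sum_mul_le (A l) _ h1).trans (mul_le_mul_of_nonneg_right h3 (mul_nonneg hc0 hε))

variable {Ωx Ωy : Type*} [MeasurableSpace Ωx] [MeasurableSpace Ωy]
  {gx : ZSpace dx dy → Ωx → XSpace dx} {gy : ZSpace dx dy → Ωy → YSpace dy}
  {P : Measure Ωx} {Q : Measure (Ωy × Ωy)} [IsProbabilityMeasure P] [IsProbabilityMeasure Q]

theorem abs_stepError_le (zs : ZSpace dx dy) (p : (ZSpace dx dy × ZSpace dx dy) × Ωx × Ωy × Ωy)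
    (i : Fin dx ⊕ Fin dy) : |stepError zs p i| ≤ ‖p.1.1 - zs‖ :=
  PiLp.norm_apply_le (p.1.1 - zs) i

theorem sqrt_mem_Ioc {h : ℝ} (hh : h ∈ Set.Ioc (0 : ℝ) 1) : √h ∈ Set.Ioc (0 : ℝ) 1 :=
  ⟨Real.sqrt_pos.2 hh.1, Real.sqrt_le_one.2 hh.2⟩

theorem integrable_stepError {h θ : ℝ} (hh : h ∈ Set.Ioc (0 : ℝ) 1) {zs : ZSpace dx dy}
    {ν : Measure ((ZSpace dx dy × ZSpace dx dy) × Ωx × Ωy × Ωy)}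
    (hi : Integrable (stepScale f gx gy μx μy zs h θ) ν) (i : Fin dx ⊕ Fin dy) :
    Integrable (fun p => stepError zs p i) ν :=
  integrable_of_abs_le (C := √h) (measurable_stepError zs i) hi fun p =>
    (abs_stepError_le zs p i).trans (le_scaleFn (sqrt_mem_Ioc hh)).1.1

theorem integrable_stepError_mul {h θ : ℝ} (hh : h ∈ Set.Ioc (0 : ℝ) 1) {zs : ZSpace dx dy}
    {ν : Measure ((ZSpace dx dy × ZSpace dx dy) × Ωx × Ωy × Ωy)}
    (hi : Integrable (stepScale f gx gy μx μy zs h θ) ν) (i j : Fin dx ⊕ Fin dy) :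
    Integrable (fun p => stepError zs p i * stepError zs p j) ν :=
  integrable_of_abs_le (C := √h ^ 2) ((measurable_stepError zs i).mul (measurable_stepError zs j))
    hi fun p => by
      rw [abs_mul]
      refine (mul_le_mul (abs_stepError_le zs p i) (abs_stepError_le zs p j) (abs_nonneg _)
        (norm_nonneg _)).trans ?_
      rw [← sq]
      exact (le_scaleFn (sqrt_mem_Ioc hh)).1.2.1

theorem integrable_stepIncr (hg : IsAdmissibleOracle f gx gy P Q) {h θ : ℝ}
    (hh : h ∈ Set.Ioc (0 : ℝ) 1) {zs : ZSpace dx dy}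
    {ν : Measure ((ZSpace dx dy × ZSpace dx dy) × Ωx × Ωy × Ωy)}
    (hi : Integrable (stepScale f gx gy μx μy zs h θ) ν) (i : Fin dx ⊕ Fin dy) :
    Integrable (fun p => stepIncr gx gy μx μy h θ p i) ν :=
  integrable_of_abs_le (C := √h ^ 2) (measurable_stepIncr hg h θ i) hi fun p =>
    (PiLp.norm_apply_le ((step gx gy (h / μx) (h / μy) θ p.1 p.2).1 - p.1.1) i).trans
      (le_scaleFn (sqrt_mem_Ioc hh)).2.2.2.2

theorem integral_stepIncr_eq_zero (hg : IsAdmissibleOracle f gx gy P Q) {h θ : ℝ}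
    (hh : h ∈ Set.Ioc (0 : ℝ) 1) {zs : ZSpace dx dy}
    {π : Measure (ZSpace dx dy × ZSpace dx dy)} [IsProbabilityMeasure π]
    (hπ : (transition gx gy P Q (h / μx) (h / μy) θ).Invariant π)
    (hi : Integrable (stepScale f gx gy μx μy zs h θ) (π.prod (P.prod Q))) (i : Fin dx ⊕ Fin dy) :
    ∫ p, stepIncr gx gy μx μy h θ p i ∂(π.prod (P.prod Q)) = 0 := by
  have hm : Measurable fun ξ : ZSpace dx dy × ZSpace dx dy => (ξ.1 - zs) i := by fun_prop
  have h1 := integral_comp_step hg hπ hm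
  have h2 (p : (ZSpace dx dy × ZSpace dx dy) × Ωx × Ωy × Ωy) :
      ((step gx gy (h / μx) (h / μy) θ p.1 p.2).1 - zs) i
        = stepError zs p i + stepIncr gx gy μx μy h θ p i := by simp [stepError, stepIncr]
  simp only [h2] at h1
  rw [integral_add (integrable_stepError hh hi i) (integrable_stepIncr hg hh hi i)] at h1
  exact left_eq_add.1 h1.symm

theorem integrable_stepNoise (hf : IsAdmissibleObjective f μx μy)
    (hμx : 0 < μx) (hμy : 0 < μy) {zs : ZSpace dx dy} (hzs : IsSaddlePoint f zs)
    (hg : IsAdmissibleOracle f gx gy P Q) {h θ : ℝ}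
    (hh : h ∈ Set.Ioc (0 : ℝ) 1) (hθ : θ ∈ Set.Icc (0 : ℝ) 1)
    {ν : Measure ((ZSpace dx dy × ZSpace dx dy) × Ωx × Ωy × Ωy)}
    (hi : Integrable (stepScale f gx gy μx μy zs h θ) ν) (i : Fin dx ⊕ Fin dy) :
    Integrable (fun p => stepNoise f gx gy μx μy (h / μy) θ p i) ν := by
  obtain ⟨K, hK0, hK⟩ := hf.exists_step_expansion hμx hμy hzs gx gy
  exact integrable_of_abs_le (C := K) (measurable_stepNoise hf hg _ θ i) hi fun p =>
    ((hK h hh.1 θ hθ p i).1).trans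
      (mul_le_mul_of_nonneg_left (le_scaleFn (sqrt_mem_Ioc hh)).2.2.1.1 hK0)

/-- In stationarity, the gradient of `f` at the current iterate has mean `O(h^{3/2})`. Since the
increment has mean zero, so has `∇_y f(z_k) + θ (∇_y f(z_k) - ∇_y f(z_{k-1}))`, in which the lag
has mean zero, and so has `∇_x f(x_k, y_{k+1})`, which differs from `∇_x f(z_k)` by `∂_y ∇_x f(z_*)`
applied to the increment, up to second-order terms. -/
theorem exists_abs_integral_gradient_le (hf : IsAdmissibleObjective f μx μy)
    (hμx : 0 < μx) (hμy : 0 < μy) {zs : ZSpace dx dy} (hzs : IsSaddlePoint f zs)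
    (hg : IsAdmissibleOracle f gx gy P Q) :
    ∃ K : ℝ, 0 ≤ K ∧ ∀ h ∈ Set.Ioc (0 : ℝ) 1, ∀ θ ∈ Set.Icc (0 : ℝ) 1,
      ∀ π : Measure (ZSpace dx dy × ZSpace dx dy), IsProbabilityMeasure π →
      (transition gx gy P Q (h / μx) (h / μy) θ).Invariant π → ∀ K₀ : ℝ, 0 ≤ K₀ →
      Integrable (stepScale f gx gy μx μy zs h θ) (π.prod (P.prod Q)) →
      ∫ p, stepScale f gx gy μx μy zs h θ p ∂(π.prod (P.prod Q)) ≤ K₀ → ∀ l,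
      Integrable (fun p : (ZSpace dx dy × ZSpace dx dy) × Ωx × Ωy × Ωy => gradient f p.1.1 l)
        (π.prod (P.prod Q)) ∧
      |∫ p, gradient f p.1.1 l ∂(π.prod (P.prod Q))| ≤ K * √h ^ 3 * K₀ := by
  obtain ⟨c, hc⟩ := exists_lintegral_errNorm_le hf hg
  replace hc : HasErrorBound f gx gy P Q c := hc
  obtain ⟨K, hK0, -, hK⟩ := hf.exists_gradient_expansion zs
  obtain ⟨L, hL0, hLx, hLy⟩ := hf.exists_lipschitz
  have h0 := gradient_eq_zero_of_isSaddlePoint hf.differentiable hzs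
  have hL (z : ZSpace dx dy) (l) : |gradient f z l| ≤ L * ‖z - zs‖ := by
    rcases l with i | j
    · have := (PiLp.norm_apply_le (gradX f z - gradX f zs) i).trans (hLx z zs)
      change |gradient f z (Sum.inl i) - gradient f zs (Sum.inl i)| ≤ _ at this
      rwa [h0, PiLp.zero_apply, sub_zero] at this
    · have := (PiLp.norm_apply_le (gradY f z - gradY f zs) j).trans (hLy z zs)
      change |gradient f z (Sum.inr j) - gradient f zs (Sum.inr j)| ≤ _ at this
      rwa [h0, PiLp.zero_apply, sub_zero] at this
  have hGm (l) : Measurable fun z : ZSpace dx dy => gradient f z l :=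
    (EuclideanSpace.proj (𝕜 := ℝ) l).measurable.comp hf.continuous_gradient.measurable
  refine ⟨2 * K, by positivity, fun h hh θ hθ π _ hπ K₀ hK₀0 hi hK₀ l => ?_⟩
  have hk := sqrt_mem_Ioc hh
  have hk0 := hk.1
  have hhne := hh.1.ne'
  set ν := π.prod (P.prod Q) with hν
  have hG1 (l) : Integrable (fun p : (ZSpace dx dy × ZSpace dx dy) × Ωx × Ωy × Ωy =>
      gradient f p.1.1 l) ν :=
    integrable_of_abs_le (C := L * √h) ((hGm l).comp (measurable_fst.comp measurable_fst)) hi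
      fun p => (hL p.1.1 l).trans (by
        rw [mul_assoc]; exact mul_le_mul_of_nonneg_left (le_scaleFn hk).1.1 hL0)
  have hNi := integrable_stepNoise hf hμx hμy hzs hg hh hθ hi
  have hN0 (l) : ∫ p, stepNoise f gx gy μx μy (h / μy) θ p l ∂ν = 0 := by
    have := integral_stepNoise_mul_eq_zero (P := P) (Q := Q) (μx := μx) (π := π) hc hf hg
      (σ := h / μy) (θ := θ) (i := l) (u := fun _ => 1) (by simpa using hNi l)
    simpa using this
  have hD0 := integral_stepIncr_eq_zero (gx := gx) (gy := gy) (f := f) hg hh hπ hi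
  refine ⟨hG1 l, ?_⟩
  rcases l with i | j
  · have hDi := hD0 (Sum.inl i)
    set m : (ZSpace dx dy × ZSpace dx dy) × Ωx × Ωy × Ωy → ZSpace dx dy :=
      fun p => pair (xPart p.1.1) (nextY gy (h / μy) θ p.1 p.2.2) with hm
    have hmm : Measurable m := measurable_midPoint hg (h / μy) θ
    have hmd (p) : ‖m p - p.1.1‖ ≤ ‖(step gx gy (h / μx) (h / μy) θ p.1 p.2).1 - p.1.1‖ :=
      norm_midPoint_sub_le _ _ _ p
    have hGm1 : Integrable (fun p => gradient f (m p) (Sum.inl i)) ν :=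
      integrable_of_abs_le (C := L * (√h + √h ^ 2)) ((hGm _).comp hmm) hi
        fun p => (hL (m p) _).trans (by
          rw [mul_assoc]
          refine mul_le_mul_of_nonneg_left ?_ hL0
          have e1 := norm_sub_le_norm_sub_add_norm_sub (m p) p.1.1 zs
          have e2 := hmd p
          obtain ⟨⟨e3, -⟩, -, -, -, e4⟩ := le_scaleFn (a := ‖p.1.1 - zs‖) (s := ‖p.1.1 - p.1.2‖)
            (d := ‖(step gx gy (h / μx) (h / μy) θ p.1 p.2).1 - p.1.1‖)
            (n := errNorm f gx gy (h / μy) θ p) hk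
          calc _ ≤ _ := e1
            _ ≤ √h ^ 2 * stepScale f gx gy μx μy zs h θ p
              + √h * stepScale f gx gy μx μy zs h θ p := add_le_add (e2.trans e4) e3
            _ = _ := by ring)
    have hpt (p) : stepIncr gx gy μx μy h θ p (Sum.inl i) = -(h / μx) *
        (gradient f (m p) (Sum.inl i)
          + -μx * stepNoise f gx gy μx μy (h / μy) θ p (Sum.inl i)) := by
      rw [stepIncr_inl (f := f), stepNoise_inl]
      simp only [hm]
      field_simp
    simp only [hpt] at hDi
    rw [integral_const_mul, integral_add hGm1 ((hNi _).const_mul _), integral_const_mul, hN0,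
      mul_zero, add_zero, mul_eq_zero, or_iff_right (neg_ne_zero.2 (by positivity))] at hDi
    -- the first-order effect of evaluating `∇_x f` at `(x_k, y_{k+1})` has mean zero
    set Z : (ZSpace dx dy × ZSpace dx dy) × Ωx × Ωy × Ωy → ℝ := fun p =>
      ∑ l, hessian f zs (Sum.inl i) (Sum.inr l) * stepIncr gx gy μx μy h θ p (Sum.inr l) with hZ
    have hZm : Integrable Z ν :=
      integrable_finsetSum _ fun l _ => (integrable_stepIncr hg hh hi _).const_mul _
    have hZ0 : ∫ p, Z p ∂ν = 0 := by
      rw [hZ, integral_finsetSum _ fun l _ => (integrable_stepIncr hg hh hi _).const_mul _]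
      exact Finset.sum_eq_zero fun l _ => by rw [integral_const_mul, hD0, mul_zero]
    have hb (p) : |gradient f (m p) (Sum.inl i) - gradient f p.1.1 (Sum.inl i) - Z p|
        ≤ 2 * K * √h ^ 3 * stepScale f gx gy μx μy zs h θ p := by
      have e1 := hK p.1.1 (m p - p.1.1) (Sum.inl i)
      have e2 : ∑ l, hessian f zs (Sum.inl i) l * (m p - p.1.1) l = Z p := by
        rw [Fintype.sum_sum_type]
        simp [hZ, hm, stepIncr, step]
      rw [add_sub_cancel, e2] at e1
      obtain ⟨-, ⟨-, e3, -, e4⟩, -⟩ := le_scaleFn (a := ‖p.1.1 - zs‖) (s := ‖p.1.1 - p.1.2‖)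
        (d := ‖(step gx gy (h / μx) (h / μy) θ p.1 p.2).1 - p.1.1‖)
        (n := errNorm f gx gy (h / μy) θ p) hk
      set d := ‖(step gx gy (h / μx) (h / μy) θ p.1 p.2).1 - p.1.1‖ with hd
      set T := scaleFn √h ‖p.1.1 - zs‖ ‖p.1.1 - p.1.2‖ d (errNorm f gx gy (h / μy) θ p) with hT
      have hT0 : 0 ≤ T := scaleFn_nonneg _ _ _ _ _
      have e5 : √h ^ 4 * T ≤ √h ^ 3 * T := by
        have : √h ^ 4 ≤ √h ^ 3 := pow_le_pow_of_le_one hk0.le hk.2 (by norm_num)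
        gcongr
      calc _ ≤ _ := e1
        _ ≤ K * (‖p.1.1 - zs‖ + d) * d := by have := hmd p; gcongr
        _ = K * (‖p.1.1 - zs‖ * d + d ^ 2) := by ring
        _ ≤ K * (2 * (√h ^ 3 * T)) := by gcongr; linarith
        _ = 2 * K * √h ^ 3 * T := by ring
    have hfin := abs_integral_le_of_abs_le (by positivity) hi hK₀ hb
    have hGd : Integrable
        (fun p => gradient f (m p) (Sum.inl i) - gradient f p.1.1 (Sum.inl i)) ν := hGm1.sub (hG1 _)
    rw [integral_sub hGd hZm, integral_sub hGm1 (hG1 _), hDi, hZ0, sub_zero, zero_sub,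
      abs_neg] at hfin
    exact hfin
  · have hDj := hD0 (Sum.inr j)
    have hG2m : Measurable fun ξ : ZSpace dx dy × ZSpace dx dy => gradient f ξ.2 (Sum.inr j) :=
      (hGm _).comp measurable_snd
    have hG2 : Integrable (fun p : (ZSpace dx dy × ZSpace dx dy) × Ωx × Ωy × Ωy =>
        gradient f p.1.2 (Sum.inr j)) ν :=
      ((integrable_comp_step_iff hg hπ hG2m).1 (hG1 (Sum.inr j))).comp_fst _
    have hG12 := integral_comp_step hg hπ hG2m
    change ∫ p, gradient f p.1.1 (Sum.inr j) ∂ν = ∫ p, gradient f p.1.2 (Sum.inr j) ∂ν at hG12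
    have hpt (p : (ZSpace dx dy × ZSpace dx dy) × Ωx × Ωy × Ωy) :
        stepIncr gx gy μx μy h θ p (Sum.inr j) = h / μy *
        ((gradient f p.1.1 (Sum.inr j)
          + θ * (gradient f p.1.1 (Sum.inr j) - gradient f p.1.2 (Sum.inr j)))
          + μy * stepNoise f gx gy μx μy (h / μy) θ p (Sum.inr j)) := by
      rw [stepIncr_inr (f := f), stepNoise_inr]
      field_simp
    have hi1 : Integrable (fun p : (ZSpace dx dy × ZSpace dx dy) × Ωx × Ωy × Ωy =>
        gradient f p.1.1 (Sum.inr j) - gradient f p.1.2 (Sum.inr j)) ν := (hG1 _).sub hG2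
    have hi2 : Integrable (fun p : (ZSpace dx dy × ZSpace dx dy) × Ωx × Ωy × Ωy =>
        gradient f p.1.1 (Sum.inr j)
          + θ * (gradient f p.1.1 (Sum.inr j) - gradient f p.1.2 (Sum.inr j))) ν :=
      (hG1 _).add (hi1.const_mul θ)
    simp only [hpt] at hDj
    rw [integral_const_mul, integral_add hi2 ((hNi _).const_mul _), integral_const_mul, hN0,
      mul_zero, add_zero, integral_add (hG1 _) (hi1.const_mul θ), integral_const_mul,
      integral_sub (hG1 _) hG2, ← hG12, sub_self, mul_zero, add_zero, mul_eq_zero,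
      or_iff_right (by positivity)] at hDj
    rw [hDj, abs_zero]
    positivity

/-- The averaged second-order Taylor expansion of the gradient at the saddle point. -/
theorem exists_abs_integral_taylor_le (hf : IsAdmissibleObjective f μx μy)
    {zs : ZSpace dx dy} (hzs : IsSaddlePoint f zs) (gx : ZSpace dx dy → Ωx → XSpace dx)
    (gy : ZSpace dx dy → Ωy → YSpace dy) :
    ∃ K : ℝ, 0 ≤ K ∧ ∀ h ∈ Set.Ioc (0 : ℝ) 1, ∀ θ : ℝ,
      ∀ ν : Measure ((ZSpace dx dy × ZSpace dx dy) × Ωx × Ωy × Ωy), ∀ K₀ : ℝ,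
      Integrable (stepScale f gx gy μx μy zs h θ) ν →
      ∫ p, stepScale f gx gy μx μy zs h θ p ∂ν ≤ K₀ → ∀ l,
      Integrable (fun p : (ZSpace dx dy × ZSpace dx dy) × Ωx × Ωy × Ωy => gradient f p.1.1 l) ν →
      |∫ p, gradient f p.1.1 l ∂ν - (hessian f zs *ᵥ fun i => ∫ p, stepError zs p i ∂ν) l
        - 1 / 2 * thirdDeriv f zs
          (Matrix.of fun i j => ∫ p, stepError zs p i * stepError zs p j ∂ν) l|
        ≤ K * √h ^ 3 * K₀ := by
  obtain ⟨K, hK0, hK, -⟩ := hf.exists_gradient_expansion zs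
  have h0 := gradient_eq_zero_of_isSaddlePoint hf.differentiable hzs
  refine ⟨K, hK0, fun h hh θ ν K₀ hi hK₀ l hG => ?_⟩
  have hk0 := (sqrt_mem_Ioc hh).1
  have hE1 := integrable_stepError hh hi
  have hE2 := integrable_stepError_mul hh hi
  set b : (Fin dx ⊕ Fin dy) → (Fin dx ⊕ Fin dy) → ℝ :=
    fun i j => iteratedFDeriv ℝ 3 f zs ![e i, e j, e l] with hb
  have i1 : Integrable (fun p => ∑ i, hessian f zs l i * stepError zs p i) ν :=
    integrable_finsetSum _ fun i _ => (hE1 i).const_mul _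
  have i2 : Integrable (fun p => ∑ i, ∑ j, b i j * (stepError zs p i * stepError zs p j)) ν :=
    integrable_finsetSum _ fun i _ => integrable_finsetSum _ fun j _ => (hE2 i j).const_mul _
  have hpt (p : (ZSpace dx dy × ZSpace dx dy) × Ωx × Ωy × Ωy) :
      |gradient f p.1.1 l - ∑ i, hessian f zs l i * stepError zs p i
        - 1 / 2 * ∑ i, ∑ j, b i j * (stepError zs p i * stepError zs p j)|
        ≤ K * √h ^ 3 * stepScale f gx gy μx μy zs h θ p := by
    have e1 := hK p.1.1 l
    rw [h0, PiLp.zero_apply, sub_zero] at e1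
    refine e1.trans ?_
    rw [mul_assoc]
    exact mul_le_mul_of_nonneg_left (le_scaleFn (sqrt_mem_Ioc hh)).1.2.2 hK0
  have hfin := abs_integral_le_of_abs_le (by positivity) hi hK₀ hpt
  have i3 : Integrable (fun p : (ZSpace dx dy × ZSpace dx dy) × Ωx × Ωy × Ωy =>
      gradient f p.1.1 l - ∑ i, hessian f zs l i * stepError zs p i) ν := hG.sub i1
  rw [integral_sub i3 (i2.const_mul _), integral_sub hG i1, integral_const_mul,
    integral_finsetSum _ fun i _ => (hE1 i).const_mul _,
    integral_finsetSum _ fun i _ => integrable_finsetSum _ fun j _ => (hE2 i j).const_mul _] at hfin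
  simp only [integral_const_mul, integral_finsetSum _ fun j _ => (hE2 _ j).const_mul _] at hfin
  exact hfin

end Mean

section MeanExpansion

variable {dx dy : ℕ} {f : ZSpace dx dy → ℝ} {μx μy : ℝ}
  {Ωx Ωy : Type*} [MeasurableSpace Ωx] [MeasurableSpace Ωy]
  {gx : ZSpace dx dy → Ωx → XSpace dx} {gy : ZSpace dx dy → Ωy → YSpace dy}
  {P : Measure Ωx} {Q : Measure (Ωy × Ωy)}

theorem chain_eq_transition (μx μy θ : ℝ) :
    chain gx gy P Q μx μy θ = transition gx gy P Q ((1 - θ) / θ / μx) ((1 - θ) / θ / μy) θ := by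
  rw [chain, div_div, div_div, mul_comm θ, mul_comm θ]

/-- For `θ` close to `1`, the step size `h = (1 - θ) / θ` is small and comparable to `1 - θ`. -/
theorem stepSize_mem {h₀ θ : ℝ} (hh₀ : h₀ ∈ Set.Ioc (0 : ℝ) 1) (hθ : θ ∈ Set.Ico (1 / (1 + h₀)) 1) :
    θ ∈ Set.Ico (1 / 2 : ℝ) 1 ∧ (1 - θ) / θ ∈ Set.Ioc 0 h₀ := by
  obtain ⟨h1, h2⟩ := hθ
  have hh0 := hh₀.1
  have h3 : 1 / 2 ≤ 1 / (1 + h₀) := by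
    apply one_div_le_one_div_of_le <;> linarith [hh₀.2]
  have h4 : 0 < θ := by linarith
  have h5 : 1 / 2 ≤ θ := h3.trans h1
  rw [div_le_iff₀ (by linarith)] at h1
  refine ⟨⟨h5, h2⟩, div_pos (by linarith) h4, ?_⟩
  rw [div_le_iff₀ h4]
  linarith

theorem norm_le_of_abs_apply_le {ι : Type*} [Fintype ι] {z : EuclideanSpace ℝ ι} {c : ℝ}
    (hc : 0 ≤ c) (h : ∀ i, |z i| ≤ c) : ‖z‖ ≤ √(Fintype.card ι) * c := by
  rw [EuclideanSpace.norm_eq, Real.sqrt_le_left (by positivity), mul_pow,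
    Real.sq_sqrt (by positivity)]
  refine (Finset.sum_le_sum fun i _ => pow_le_pow_left₀ (norm_nonneg _) (h i) 2).trans_eq ?_
  simp

variable [IsProbabilityMeasure P] [IsProbabilityMeasure Q]

/-- The mean of the stationary law has two equal blocks, with entries `z_* + E[z - z_*]`. -/
theorem integral_eq_of_invariant (hg : IsAdmissibleOracle f gx gy P Q) {h θ : ℝ}
    (hh : h ∈ Set.Ioc (0 : ℝ) 1) {zs : ZSpace dx dy}
    {π : Measure (ZSpace dx dy × ZSpace dx dy)} [IsProbabilityMeasure π]
    (hπ : (transition gx gy P Q (h / μx) (h / μy) θ).Invariant π)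
    (hi : Integrable (stepScale f gx gy μx μy zs h θ) (π.prod (P.prod Q))) :
    Integrable (fun ξ => ξ) π ∧ ∃ m : ZSpace dx dy, ∫ ξ, ξ ∂π = (m, m) ∧
      ∀ l, m l - zs l = ∫ p, stepError zs p l ∂(π.prod (P.prod Q)) := by
  have h1 : Integrable (fun p : (ZSpace dx dy × ZSpace dx dy) × Ωx × Ωy × Ωy => p.1.1 - zs)
      (π.prod (P.prod Q)) :=
    (hi.const_mul (√h)).mono' (by fun_prop) (Filter.Eventually.of_forall fun p =>
      (le_scaleFn (sqrt_mem_Ioc hh)).1.1)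
  have h2 : Integrable (fun p : (ZSpace dx dy × ZSpace dx dy) × Ωx × Ωy × Ωy => p.1.1)
      (π.prod (P.prod Q)) :=
    (h1.add (integrable_const zs)).congr (Filter.Eventually.of_forall fun p => by simp)
  have hf1 : Integrable (fun ξ : ZSpace dx dy × ZSpace dx dy => ξ.1) π :=
    ((measurePreserving_fst (μ := π) (ν := P.prod Q)).integrable_comp
      (g := fun ξ : ZSpace dx dy × ZSpace dx dy => ξ.1) (by fun_prop)).1 h2
  have hf2 : Integrable (fun ξ : ZSpace dx dy × ZSpace dx dy => ξ.2) π :=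
    (integrable_comp_step_iff hg hπ measurable_snd).1 h2
  have hξ : Integrable (fun ξ : ZSpace dx dy × ZSpace dx dy => ξ) π := hf1.prodMk hf2
  have hfst (g : ZSpace dx dy × ZSpace dx dy → ZSpace dx dy) :
      ∫ p, g p.1 ∂(π.prod (P.prod Q)) = ∫ ξ, g ξ ∂π := by
    have := integral_fun_fst (μ := π) (ν := P.prod Q) g
    simpa using this
  have h12 : ∫ ξ, ξ.2 ∂π = ∫ ξ, ξ.1 ∂π := by
    rw [← hfst fun ξ => ξ.2, ← hfst fun ξ => ξ.1]
    exact (integral_comp_step hg hπ measurable_snd).symm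
  refine ⟨hξ, ∫ ξ, ξ.1 ∂π, ?_, fun l => ?_⟩
  · refine Prod.ext (fst_integral hξ) ((snd_integral hξ).trans h12)
  · have h3 := (EuclideanSpace.proj (𝕜 := ℝ) l : ZSpace dx dy →L[ℝ] ℝ).integral_comp_comm h1
    have h4 : ∫ p : (ZSpace dx dy × ZSpace dx dy) × Ωx × Ωy × Ωy, (p.1.1 - zs) ∂(π.prod (P.prod Q))
        = ∫ ξ, ξ.1 ∂π - zs := by
      rw [hfst fun ξ => ξ.1 - zs, integral_sub hf1 (integrable_const zs)]
      simp
    rw [h4] at h3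
    exact h3.symm

/-- The expansion of the stationary mean. -/
theorem exists_norm_integral_sub_le (hf : IsAdmissibleObjective f μx μy)
    (hμx : 0 < μx) (hμy : 0 < μy) {zs : ZSpace dx dy} (hzs : IsSaddlePoint f zs)
    (hg : IsAdmissibleOracle f gx gy P Q) :
    ∃ h₀ ∈ Set.Ioc (0 : ℝ) 1, ∃ C : ℝ, ∀ θ ∈ Set.Ico (1 / (1 + h₀)) 1,
      ∀ π : Measure (ZSpace dx dy × ZSpace dx dy), IsProbabilityMeasure π →
      (chain gx gy P Q μx μy θ).Invariant π →
      Integrable (fun ξ => ξ) π ∧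
      ‖(∫ ξ, ξ ∂π) - ((zs, zs) + (1 - θ) •
          (biasVector f zs (biasMatrix f μx μy zs (noiseCov f gx gy P Q μy θ π)),
            biasVector f zs (biasMatrix f μx μy zs (noiseCov f gx gy P Q μy θ π))))‖
        ≤ C * (1 - θ) ^ (3 / 2 : ℝ) := by
  obtain ⟨h₀, hh₀, K₀, hK₀0, hK₀⟩ := exists_integral_stepScale_le hf hμx hμy hzs hg
  obtain ⟨K₁, hK₁0, hK₁⟩ := exists_abs_integral_gradient_le hf hμx hμy hzs hg
  obtain ⟨K₂, hK₂0, hK₂⟩ := exists_abs_integral_taylor_le (Ωx := Ωx) (Ωy := Ωy) (μx := μx)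
    (μy := μy) hf hzs gx gy
  obtain ⟨K₃, hK₃0, hK₃⟩ := exists_abs_secondMoment_add_le hf hμx hμy hzs hg
  obtain ⟨K₄, hK₄0, hK₄⟩ := exists_abs_mean_sub_le
    (isUnit_hessian_of_isDissipative hμx hμy (hf.isDissipative hμx hμy hzs))
  obtain ⟨C, hC0, hC⟩ := exists_abs_biasMatrix_le hf zs hg
  -- the factor `3` bounds `√h ^ 3 / (1 - θ) ^ (3 / 2)`, as `h ≤ 2 (1 - θ)`
  set D : ℝ := 3 * (K₁ * K₀ + K₂ * K₀ + K₃ * (K₀ + 1)) + 4 * C with hD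
  have hD0 : 0 ≤ D := by positivity
  refine ⟨h₀, hh₀, √(Fintype.card (Fin dx ⊕ Fin dy)) * (K₄ * D), fun θ hθ π _ hπ => ?_⟩
  obtain ⟨⟨hθ1, hθ2⟩, hh⟩ := stepSize_mem hh₀ hθ
  have hθ0 : 0 < θ := by linarith
  have hθ' : θ ∈ Set.Icc (0 : ℝ) 1 := ⟨hθ0.le, hθ2.le⟩
  rw [chain_eq_transition] at hπ
  have hσ : (1 - θ) / (μy * θ) = (1 - θ) / θ / μy := by rw [div_div, mul_comm θ]
  have hhle : 1 - θ ≤ (1 - θ) / θ := le_div_self (by linarith) hθ0 hθ2.le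
  have hhle2 : (1 - θ) / θ ≤ 2 * (1 - θ) := by
    rw [div_le_iff₀ hθ0]; nlinarith
  have hhd : (1 - θ) / θ - (1 - θ) ≤ 2 * (1 - θ) ^ 2 := by
    have : (1 - θ) / θ - (1 - θ) = (1 - θ) / θ * (1 - θ) := by field_simp
    rw [this]; nlinarith
  set h := (1 - θ) / θ with hh_def
  have hh1 : h ∈ Set.Ioc (0 : ℝ) 1 := ⟨hh.1, hh.2.trans hh₀.2⟩
  obtain ⟨hi, hiK⟩ := hK₀ h hh θ hθ' π ‹_› hπ
  obtain ⟨hξ, m, hm, hml⟩ := integral_eq_of_invariant hg hh1 hπ hi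
  refine ⟨hξ, ?_⟩
  have hθ3 : 0 ≤ 1 - θ := by linarith
  -- `r = √(1 - θ)`
  obtain ⟨r, hr⟩ : ∃ r, r = √(1 - θ) := ⟨_, rfl⟩
  have hr0 : 0 ≤ r := hr ▸ Real.sqrt_nonneg _
  have hr1 : r ≤ 1 := by rw [hr, Real.sqrt_le_one]; linarith
  have hr2 : r ^ 2 = 1 - θ := by rw [hr, Real.sq_sqrt hθ3]
  have hr3 : (1 - θ) ^ (3 / 2 : ℝ) = r ^ 3 := by
    rw [hr, Real.sqrt_eq_rpow, ← Real.rpow_natCast, ← Real.rpow_mul hθ3]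
    norm_num
  have hk3 : √h ^ 3 ≤ 3 * r ^ 3 := by
    have h1 : (√h ^ 2) ^ 3 ≤ (2 * r ^ 2) ^ 3 := by
      rw [Real.sq_sqrt hh.1.le, hr2]; gcongr
    refine (sq_le_sq₀ (by positivity) (by positivity)).1 ?_
    have : 0 ≤ r ^ 6 := by positivity
    calc (√h ^ 3) ^ 2 = (√h ^ 2) ^ 3 := by ring
      _ ≤ _ := h1
      _ ≤ _ := by nlinarith
  have hr4 : (1 - θ) ^ 2 ≤ r ^ 3 := by
    rw [← hr2, ← pow_mul]
    exact pow_le_pow_of_le_one hr0 hr1 (by norm_num)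
  set M := biasMatrix f μx μy zs (noiseCov f gx gy P Q μy θ π) with hM
  have e1 : K₁ * √h ^ 3 * K₀ ≤ 3 * (K₁ * K₀) * r ^ 3 := by
    calc _ = K₁ * K₀ * √h ^ 3 := by ring
      _ ≤ K₁ * K₀ * (3 * r ^ 3) := by gcongr
      _ = _ := by ring
  have e2 : K₂ * √h ^ 3 * K₀ ≤ 3 * (K₂ * K₀) * r ^ 3 := by
    calc _ = K₂ * K₀ * √h ^ 3 := by ring
      _ ≤ K₂ * K₀ * (3 * r ^ 3) := by gcongr
      _ = _ := by ring
  have e3 : K₃ * √h ^ 3 * (K₀ + 1) ≤ 3 * (K₃ * (K₀ + 1)) * r ^ 3 := by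
    calc _ = K₃ * (K₀ + 1) * √h ^ 3 := by ring
      _ ≤ K₃ * (K₀ + 1) * (3 * r ^ 3) := by gcongr
      _ = _ := by ring
  have p1 : 0 ≤ 3 * (K₁ * K₀) * r ^ 3 := by positivity
  have p2 : 0 ≤ 3 * (K₂ * K₀) * r ^ 3 := by positivity
  have p3 : 0 ≤ 3 * (K₃ * (K₀ + 1)) * r ^ 3 := by positivity
  have p4 : 0 ≤ 4 * C * r ^ 3 := by positivity
  have hDr : D * r ^ 3 = 3 * (K₁ * K₀) * r ^ 3 + 3 * (K₂ * K₀) * r ^ 3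
      + 3 * (K₃ * (K₀ + 1)) * r ^ 3 + 4 * C * r ^ 3 := by rw [hD]; ring
  have hmean := hK₄ (fun l => ∫ p, stepError zs p l ∂(π.prod (P.prod Q)))
    (fun l => ∫ p, gradient f p.1.1 l ∂(π.prod (P.prod Q)))
    (Matrix.of fun i j => ∫ p, stepError zs p i * stepError zs p j ∂(π.prod (P.prod Q))) M
    (1 - θ) (D * r ^ 3)
    (fun l => (hK₁ h hh1 θ hθ' π ‹_› hπ K₀ hK₀0 hi hiK l).2.trans (by linarith))
    (fun l => (hK₂ h hh1 θ _ K₀ hi hiK l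
      (hK₁ h hh1 θ hθ' π ‹_› hπ K₀ hK₀0 hi hiK l).1).trans (by linarith))
    (fun i j => by
      -- replacing `h` by `1 - θ` costs `O((1 - θ) ^ 2)`
      have h1 := hK₃ h hh1 θ hθ' hhle hσ π ‹_› hπ K₀ hK₀0 hi hiK i j
      have h2 : |2 * (h - (1 - θ)) * M i j| ≤ 4 * C * r ^ 3 := by
        rw [abs_mul, abs_of_nonneg (by linarith)]
        calc _ ≤ 2 * (2 * (1 - θ) ^ 2) * C := by
              gcongr
              exact hC θ π ‹_› i j
          _ ≤ 2 * (2 * r ^ 3) * C := by gcongr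
          _ = _ := by ring
      rw [Matrix.of_apply]
      set S := ∫ p, stepError zs p i * stepError zs p j ∂(π.prod (P.prod Q))
      calc |S + 2 * (1 - θ) * M i j|
          = |(S + 2 * h * M i j) - 2 * (h - (1 - θ)) * M i j| := by congr 1; ring
        _ ≤ K₃ * √h ^ 3 * (K₀ + 1) + 4 * C * r ^ 3 := (abs_sub _ _).trans (add_le_add h1 h2)
        _ ≤ _ := by linarith)
  have hnorm : ‖m - (zs + (1 - θ) • biasVector f zs M)‖
      ≤ √(Fintype.card (Fin dx ⊕ Fin dy)) * (K₄ * (D * r ^ 3)) := by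
    refine norm_le_of_abs_apply_le (by positivity) fun l => ?_
    have := hmean l
    rw [← hml] at this
    refine le_of_eq_of_le (congrArg _ ?_) this
    simp [biasVector]
    ring
  rw [hm, hr3, Prod.smul_mk, Prod.mk_add_mk, Prod.mk_sub_mk, Prod.norm_def, max_self]
  exact hnorm.trans_eq (by ring)

end MeanExpansion

/-! ### Oracles with constant error covariance -/

section ConstantCovariance

variable {dx dy : ℕ} {f : ZSpace dx dy → ℝ} {μx μy : ℝ}
  {Ωx Ωy : Type*} [MeasurableSpace Ωx] [MeasurableSpace Ωy]
  {gx : ZSpace dx dy → Ωx → XSpace dx} {gy : ZSpace dx dy → Ωy → YSpace dy}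
  {P : Measure Ωx} {Q : Measure (Ωy × Ωy)} [IsProbabilityMeasure P] [IsProbabilityMeasure Q]

theorem integral_gx_sub_apply_eq_zero (hg : IsAdmissibleOracle f gx gy P Q) (z : ZSpace dx dy)
    (i : Fin dx) : ∫ ω, (gx z ω - gradX f z) i ∂P = 0 := by
  obtain ⟨δ, hδ⟩ := hg.moment
  have hm : Measurable (gx z) := hg.measurable_gx.of_uncurry_left
  have hi : Integrable (fun ω => gx z ω - gradX f z) P :=
    integrable_of_lintegral_enorm_pow_four_le (by fun_prop) (by positivity) (hδ z).1
  have h := (EuclideanSpace.proj (𝕜 := ℝ) i : XSpace dx →L[ℝ] ℝ).integral_comp_comm hi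
  rw [integral_gx_sub_eq_zero hg, map_zero] at h
  exact h

/-- Given the `y`-samples, the point at which `∇_x f` is estimated is fixed, so that the error of
that estimate is uncorrelated with the other errors. -/
theorem noiseCov_eq_fromBlocks (hf : IsAdmissibleObjective f μx μy)
    (hg : IsAdmissibleOracle f gx gy P Q) {A : Matrix (Fin dx) (Fin dx) ℝ}
    {B : Matrix (Fin dy ⊕ Fin dy) (Fin dy ⊕ Fin dy) ℝ}
    (hA : ∀ z i j, ∫ ω, (gx z ω - gradX f z) i * (gx z ω - gradX f z) j ∂P = A i j)
    (hB : ∀ z z' i j, ∫ ω,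
      Sum.elim (fun l => (gy z ω.1 - gradY f z) l) (fun l => (gy z' ω.2 - gradY f z') l) i
        * Sum.elim (fun l => (gy z ω.1 - gradY f z) l) (fun l => (gy z' ω.2 - gradY f z') l) j ∂Q
      = B i j) (θ : ℝ)
    (π : Measure (ZSpace dx dy × ZSpace dx dy)) [IsProbabilityMeasure π] :
    noiseCov f gx gy P Q μy θ π = Matrix.fromBlocks A 0 0 B := by
  obtain ⟨c, hc⟩ := exists_lintegral_errNorm_le hf hg
  replace hc : HasErrorBound f gx gy P Q c := hc
  ext i j
  rw [noiseCov, Matrix.of_apply]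
  generalize (1 - θ) / (μy * θ) = σ
  rw [integral_prod _ (integrable_noise_mul_noise hc hf hg σ θ π i j).1]
  suffices hs : ∀ ξ, ∫ ω, noise f gx gy σ θ ξ ω i * noise f gx gy σ θ ξ ω j ∂(P.prod Q)
      = Matrix.fromBlocks A 0 0 B i j by
    simp [hs]
  intro ξ
  have hi (i j) : Integrable (fun ω => noise f gx gy σ θ ξ ω i * noise f gx gy σ θ ξ ω j)
      (P.prod Q) := by
    refine integrable_of_norm_le_one_add ?_ (hc.integrable hf hg σ θ ξ).1 fun ω => ?_
    · exact (((measurable_noise hf hg σ θ i).mul (measurable_noise hf hg σ θ j)).comp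
        measurable_prodMk_left).aestronglyMeasurable
    · rw [Real.norm_eq_abs, abs_mul]
      refine (mul_le_mul (abs_noise_le σ θ (ξ, ω) i) (abs_noise_le σ θ (ξ, ω) j) (abs_nonneg _)
        (errNorm_nonneg σ θ _)).trans ?_
      rw [← sq]; exact sq_le_one_add_pow_four
  have hxy (i : Fin dx) (j : Fin dy ⊕ Fin dy) :
      ∫ ω, noise f gx gy σ θ ξ ω (Sum.inl i) * noise f gx gy σ θ ξ ω (Sum.inr j) ∂(P.prod Q)
        = 0 := by
    rw [integral_prod_symm _ (hi _ _)]
    refine integral_eq_zero_of_ae (Filter.Eventually.of_forall fun ωy => ?_)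
    have h1 (ωx : Ωx) : noise f gx gy σ θ ξ (ωx, ωy) (Sum.inr j)
      = Sum.elim (fun l => (gy ξ.1 ωy.1 - gradY f ξ.1) l)
          (fun l => (gy ξ.2 ωy.2 - gradY f ξ.2) l) j := rfl
    simp only [h1, integral_mul_const]
    have h2 := integral_gx_sub_apply_eq_zero hg (pair (xPart ξ.1) (nextY gy σ θ ξ ωy)) i
    exact mul_eq_zero_of_left h2 _
  rcases i with i | i <;> rcases j with j | j
  · rw [integral_prod_symm _ (hi _ _), Matrix.fromBlocks_apply₁₁]
    refine (integral_congr_ae (g := fun _ => A i j)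
      (Filter.Eventually.of_forall fun ωy => ?_)).trans (by simp)
    exact hA (pair (xPart ξ.1) (nextY gy σ θ ξ ωy)) i j
  · rw [hxy, Matrix.fromBlocks_apply₁₂, Matrix.zero_apply]
  · rw [Matrix.fromBlocks_apply₂₁, Matrix.zero_apply, ← hxy j i]
    simp only [mul_comm]
  · rw [Matrix.fromBlocks_apply₂₂, ← hB ξ.1 ξ.2 i j]
    have h := integral_fun_snd (μ := P) (ν := Q) fun ω : Ωy × Ωy =>
      Sum.elim (fun l => (gy ξ.1 ω.1 - gradY f ξ.1) l) (fun l => (gy ξ.2 ω.2 - gradY f ξ.2) l) i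
        * Sum.elim (fun l => (gy ξ.1 ω.1 - gradY f ξ.1) l)
          (fun l => (gy ξ.2 ω.2 - gradY f ξ.2) l) j
    rw [probReal_univ, one_smul] at h
    exact h

end ConstantCovariance

end SAPD

end

theorem mainTheorem1 {dx dy : ℕ} (f : SAPD.ZSpace dx dy → ℝ) (μx μy : ℝ)
    (hμx : 0 < μx) (hμy : 0 < μy) (hf : SAPD.IsAdmissibleObjective f μx μy)
    (zs : SAPD.ZSpace dx dy) (hzs : SAPD.IsSaddlePoint f zs)
    {Ωx Ωy : Type*} [MeasurableSpace Ωx] [MeasurableSpace Ωy]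
    (P : MeasureTheory.Measure Ωx) (Q : MeasureTheory.Measure (Ωy × Ωy))
    [MeasureTheory.IsProbabilityMeasure P] [MeasureTheory.IsProbabilityMeasure Q]
    (gx : SAPD.ZSpace dx dy → Ωx → SAPD.XSpace dx)
    (gy : SAPD.ZSpace dx dy → Ωy → SAPD.YSpace dy)
    (hg : SAPD.IsAdmissibleOracle f gx gy P Q) :
    -- the two inverses in the expansion exist
    IsUnit (SAPD.hessian f zs) ∧
    IsUnit (SAPD.lyapunov (SAPD.C₀ dx dy μx μy * SAPD.hessian f zs)) ∧
    ∃ θ₀ ∈ Set.Ioo (0 : ℝ) 1, ∃ C : ℝ, ∀ θ ∈ Set.Ico θ₀ 1,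
      -- an invariant measure exists if the transition density is continuous
      (SAPD.HasContinuousDensity (SAPD.chain gx gy P Q μx μy θ) →
        ∃ π : MeasureTheory.Measure (SAPD.ZSpace dx dy × SAPD.ZSpace dx dy),
          MeasureTheory.IsProbabilityMeasure π ∧
          (SAPD.chain gx gy P Q μx μy θ).Invariant π) ∧
      ∀ π : MeasureTheory.Measure (SAPD.ZSpace dx dy × SAPD.ZSpace dx dy),
        MeasureTheory.IsProbabilityMeasure π →
        (SAPD.chain gx gy P Q μx μy θ).Invariant π →
        MeasureTheory.Integrable (fun ξ => ξ) π ∧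
        -- `M = O(1)`
        (∀ i j, |SAPD.biasMatrix f μx μy zs (SAPD.noiseCov f gx gy P Q μy θ π) i j| ≤ C) ∧
        -- the expansion of the mean
        ‖(∫ ξ, ξ ∂π) - ((zs, zs) + (1 - θ) •
          (SAPD.biasVector f zs
              (SAPD.biasMatrix f μx μy zs (SAPD.noiseCov f gx gy P Q μy θ π)),
            SAPD.biasVector f zs
              (SAPD.biasMatrix f μx μy zs (SAPD.noiseCov f gx gy P Q μy θ π))))‖
          ≤ C * (1 - θ) ^ (3 / 2 : ℝ) ∧
        -- if the error covariances of the oracle are the same at all points, then `W`, and with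
        -- it `M`, is a constant that does not depend on `θ`
        ∀ (A : Matrix (Fin dx) (Fin dx) ℝ) (B : Matrix (Fin dy ⊕ Fin dy) (Fin dy ⊕ Fin dy) ℝ),
          (∀ z i j, ∫ ω, (gx z ω - SAPD.gradX f z) i * (gx z ω - SAPD.gradX f z) j ∂P
            = A i j) →
          (∀ z z' i j, ∫ ω,
            Sum.elim (fun l => (gy z ω.1 - SAPD.gradY f z) l)
                (fun l => (gy z' ω.2 - SAPD.gradY f z') l) i
              * Sum.elim (fun l => (gy z ω.1 - SAPD.gradY f z) l)
                (fun l => (gy z' ω.2 - SAPD.gradY f z') l) j ∂Q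
            = B i j) →
          SAPD.noiseCov f gx gy P Q μy θ π = Matrix.fromBlocks A 0 0 B := by
  have hdiss := hf.isDissipative hμx hμy hzs
  refine ⟨SAPD.isUnit_hessian_of_isDissipative hμx hμy hdiss,
    SAPD.isUnit_lyapunov (SAPD.weight_pos hμx hμy) hdiss, ?_⟩
  obtain ⟨h₁, hh₁, K, hK0, hK⟩ := SAPD.exists_sq_drift hf hμx hμy hzs hg
  obtain ⟨h₂, hh₂, C₁, hC₁⟩ := SAPD.exists_norm_integral_sub_le hf hμx hμy hzs hg
  obtain ⟨C₂, -, hC₂⟩ := SAPD.exists_abs_biasMatrix_le hf zs hg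
  have hlt {h : ℝ} (hh : h ∈ Set.Ioc (0 : ℝ) 1) : 1 / (1 + h) ∈ Set.Ioo (0 : ℝ) 1 := by
    have := hh.1
    exact ⟨by positivity, by rw [div_lt_one] <;> linarith⟩
  refine ⟨max (1 / (1 + h₁)) (1 / (1 + h₂)),
    ⟨lt_max_of_lt_left (hlt hh₁).1, max_lt (hlt hh₁).2 (hlt hh₂).2⟩, max C₁ C₂,
    fun θ hθ => ⟨fun hdens => ?_, fun π hprob hπ => ?_⟩⟩
  · obtain ⟨⟨hθ1, hθ2⟩, hh⟩ := SAPD.stepSize_mem hh₁ ⟨(le_max_left _ _).trans hθ.1, hθ.2⟩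
    have h0 := hh.1
    rw [SAPD.chain_eq_transition] at hdens ⊢
    exact SAPD.exists_invariant_transition (zs := zs) hμx hμy hg
      (a := (1 - θ) / θ / 2) (b := K * ((1 - θ) / θ) ^ 3)
      ⟨by positivity, by linarith [hh.2, hh₁.2]⟩ (by positivity)
      (hK _ hh θ ⟨by linarith, hθ2.le⟩) hdens
  · obtain ⟨hint, hnorm⟩ := hC₁ θ ⟨(le_max_right _ _).trans hθ.1, hθ.2⟩ π hprob hπ
    refine ⟨hint, fun i j => (hC₂ θ π hprob i j).trans (le_max_right _ _), hnorm.trans ?_,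
      fun A B hA hB => SAPD.noiseCov_eq_fromBlocks hf hg hA hB θ π⟩
    exact mul_le_mul_of_nonneg_right (le_max_left _ _)
      (Real.rpow_nonneg (by linarith [hθ.2]) _)
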